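/- **Setting.** Let $\Theta\subset\mathbb R^m$ be compact and convex and let $\{f_\theta:\theta\in\Theta\}$ be an identifiable family of probability densities on $\mathbb R$ such that, on an open set around $\Theta$, $f_\theta(x)$ is positive, measurable in $x$ and three times continuously differentiable in $\theta$. Put $u_{\theta,i}=\partial_{\theta_i}\log f_\theta$, $u_{\theta,i,j}=\partial_{\theta_i}u_{\theta,j}$, $u_{\theta,i,j,l}=\partial_{\theta_i}u_{\theta,j,l}$, $\mathbf u_\theta=(u_{\theta,i})_i$, $\dot{\mathbf u}_\theta=(u_{\theta,i,j})_{i,j}$. Assume: the Fisher information $I(\theta)=-(\mathbf E_\theta u_{\theta,i,j}(X))_{i,j}$ is positive definite and continuous on $\Theta$; $\|\mathbf u_\theta f_\theta^{1/2}\|_2$, $\|\dot{\mathbf u}_\theta f_\theta^{1/2}\|_2$, $\|\mathbf u_\theta\mathbf u_\theta^T f_\theta^{1/2}\|_2$ are finite and continuous on $\Theta$; $\mathbf E_\theta\prod_i|u_{\theta,i}(X)|^{k_i}$ is finite and continuous on $\Theta$ whenever $\sum_i k_i\le 6$; $\mathbf E_\theta[u_{\theta,i,j}^2]$, $\mathbf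 E_\theta[u_{\theta,i,j,l}^2]$ and $\mathbf E_\theta[u_{\theta,i,j}^2u_{\theta,l}^2]$ are finite and bounded on $\Theta$; and for some $p_0\in(1,2)$, $1/p_0+1/q=1$, the expectations $\mathbf E_\theta\|\mathbf u_\theta f_\theta^{1/2-1/q}\|_1^q$, $\mathbf E_\theta\|\mathbf u_\theta\mathbf u_\theta^Tf_\theta^{1/2-1/q}\|_1^q$, $\mathbf E_\theta\|\dot{\mathbf u}_\theta f_\theta^{1/2-1/q}\|_1^q$ are finite and continuous on $\Theta$. Let $X_1,\dots,X_n$ be i.i.d. with density $g$, and let $\theta_g$ be the unique minimizer over $\Theta$ of $HD^2(f_\theta,g)=\int(\sqrt{f_\theta}-\sqrt g)^2$, assumed to lie in the interior of $\Theta$. Let $K$ be a symmetric probability density with compact support, $c_n>0$ with $c_n\to0$, $n^{1/2}c_n^2\to0$, $n^{1/2}c_n\to\infty$, let $b_n\nearrow\infty$, $a_n\to\infty$, and assume, with $X\sim f_{\theta_g}$: $n\sup_{t\in\mathrm{supp}K}\mathbf P(|X-c_nt|>a_n)\to0$; $\sup_{n\ge1}\sup_{|x|\le a_n}\sup_{t\in\mathrm{supp}K}f_{\theta_g}(x+tc_n)/f_{\theta_g}(x)<\infty$;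 $(n^{1/2}c_n)^{-1}\int_{-a_n}^{a_n}\mathbf u_{\theta_g}\to0$ and $n^{1/2}c_n^4\int_{-a_n}^{a_n}\mathbf u_{\theta_g}\to0$; $\sup_{t\in\mathrm{supp}K}\int[u_{\theta_g,i}(x+tc_n)-u_{\theta_g,i}(x)]^2f_{\theta_g}(x)\,dx\to0$ for all $i$. Let $\bar g_n(x)=\frac1{nc_n}\sum_{i}K\big(\frac{x-X_i}{c_n}\big)\mathbf 1(|X_i|<b_n)$, $L_n(\theta)=2HD^2(f_\theta,\bar g_n)$, with gradient $\nabla L_n(\theta)=-2\int\bar g_n^{1/2}f_\theta^{1/2}\mathbf u_\theta$ and Hessian $H_n(\theta)=-\int\bar g_n^{1/2}f_\theta^{1/2}[\mathbf u_\theta\mathbf u_\theta^T+2\dot{\mathbf u}_\theta]$ (both queries return $0$ at $\theta\notin\Theta$), and let $\hat\theta_n$ be a minimizer of $L_n$ over $\Theta$. Let $H_\infty$ be $H_n$ with $\bar g_n$ replaced by $g$. Let $\Delta_n,\Delta_n^{(H)}$ be upper bounds, of the same order, of the $L_2$ sensitivities $\sup_{\theta\in\Theta}\sup_{D,D'}\|\nabla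 L_n(\theta;D)-\nabla L_n(\theta;D')\|_2$ and $\sup_{\theta\in\Theta}\sup_{D,D'}\|H_n(\theta;D)-H_n(\theta;D')\|_2$ (entrywise norm), the suprema being over data sets $D,D'\in\mathbb R^n$ that differ in exactly one observation (adjacent data sets). Put $h_1(x)=x$, $h_k(x)=x+h_{k-1}(x)-\frac12xh_{k-1}(x)$ and $c_s=(-8\log(1-s/2))^{-1/2}$. Private Newton–Raphson with per-step privacy level $\epsilon'$, learning rate $\eta$ and initial value $\hat\theta_n^{(0)}$ is $$\hat\theta_n^{(k+1)}=\hat\theta_n^{(k)}-\eta\,\big(H_n(\hat\theta_n^{(k)})+\Delta_n^{(H)}c_{\epsilon'/2}\tilde Z_k\big)^{-1}\big(\nabla L_n(\hat\theta_n^{(k)})+\Delta_nc_{\epsilon'/2}Z_k\big),$$ with $Z_k$ standard normal in $\mathbb R^m$, $\tilde Z_k$ a symmetric $m\times m$ matrix whose entries on and above the diagonal are i.i.d. standard normal, all independent of each other and of the data. A mechanism is $\epsilon$-HDP if the squared Hellinger distance $\int(\sqrt{p_1}-\sqrt{p_2})^2$ of its output laws at any two adjacent data sets is at most $\epsilon$.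 **Theorem.** There are $\epsilon_0>0$ and $c_2>0$, depending only on the family $(f_\theta)_{\theta\in\Theta}$ (and $m$), such that for all $g,K,(c_n),(b_n)$ and $\Delta_n,\Delta_n^{(H)}$ as above and every $\epsilon\in(0,2]$: 1. (Privacy) For all $n$, $k$, $\eta$, all fixed initial values and every $\epsilon'\in(0,2]$ with $h_k(\epsilon')\le\epsilon$, the output $\hat\theta_n^{(k)}$ is $\epsilon$-HDP. 2. (Utility) Suppose $HD^2(f_{\theta_g},g)<\epsilon_0$ or, more generally, that $H_\infty(\theta_g)$ is invertible. Then there are $p\in(1,2)$, $c_1>0$, a learning rate $\eta>0$ and $\rho>0$ such that for all iteration numbers $K_n$ with $K_n\ge c_1\log\log n$ for all large $n$ and $n^{-1/p}(K_n\log K_n)^{1/2}\to0$, and all $\epsilon'_n\in(0,2]$ with $\epsilon'_n\ge\epsilon/K_n$ and $h_{K_n}(\epsilon'_n)\le\epsilon$ (for example $\epsilon'_n=\epsilon/K_n$): for every $\xi\in(0,1)$ there is $N$ such that for all $n>N$, with probability at least $1-\xi$, simultaneously for all initial values $\hat\theta_n^{(0)}$ with $\|\hat\theta_n^{(0)}-\theta_g\|_2\le\rho$,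 $$\|\hat\theta_n^{(K_n)}-\hat\theta_n\|_2\le c_2\,n^{-1/p}\big(K_n\log(K_n/\xi)\big)^{1/2}.$$ In particular $\|\hat\theta_n^{(K_n)}-\hat\theta_n\|_2=O_p\big(n^{-1/p}(K_n\log K_n)^{1/2}\big)$, uniformly over these initial values. -/

import Mathlib

open MeasureTheory ProbabilityTheory Filter Topology

noncomputable section

namespace PMHDE

/-! ### The parametric family and its scores -/

/-- The space `ℝ^m` of parameters, with its Euclidean norm. -/
abbrev Param (m : ℕ) := EuclideanSpace ℝ (Fin m)

/-- The partial derivative of `F` in the `i`-th coordinate of the parameter. -/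
def pderiv {m : ℕ} (i : Fin m) (F : Param m → ℝ) (θ : Param m) : ℝ :=
  lineDeriv ℝ F θ (EuclideanSpace.single i 1)

/-- `u_{θ,i}(x) = ∂/∂θ_i log f_θ(x)`. -/
def score {m : ℕ} (f : Param m → ℝ → ℝ) (θ : Param m) (x : ℝ) (i : Fin m) : ℝ :=
  pderiv i (fun t => Real.log (f t x)) θ

/-- `u_{θ,i,j}(x) = ∂/∂θ_i u_{θ,j}(x)`. -/
def score2 {m : ℕ} (f : Param m → ℝ → ℝ) (θ : Param m) (x : ℝ) (i j : Fin m) : ℝ :=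
  pderiv i (fun t => score f t x j) θ

/-- `u_{θ,i,j,l}(x) = ∂/∂θ_i u_{θ,j,l}(x)`. -/
def score3 {m : ℕ} (f : Param m → ℝ → ℝ) (θ : Param m) (x : ℝ) (i j l : Fin m) : ℝ :=
  pderiv i (fun t => score2 f t x j l) θ

/-- The Fisher information matrix `I(θ) = -E_θ[u_{θ,i,j}(X)]`. -/
def fisher {m : ℕ} (f : Param m → ℝ → ℝ) (θ : Param m) : Matrix (Fin m) (Fin m) ℝ :=
  Matrix.of fun i j => -∫ x, score2 f θ x i j * f θ x

/-- `q` is a probability density on the real line. -/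
structure IsDensity (q : ℝ → ℝ) : Prop where
  measurable : Measurable q
  nonneg : ∀ x, 0 ≤ q x
  integral_eq_one : ∫ x, q x = 1

/-- `E_θ[h_θ(X)]` is finite for every `θ ∈ Θ` and continuous in `θ ∈ Θ`. -/
def HasContMoment {m : ℕ} (Θ : Set (Param m)) (f h : Param m → ℝ → ℝ) : Prop :=
  (∀ θ ∈ Θ, Integrable fun x => h θ x * f θ x) ∧
    ContinuousOn (fun θ => ∫ x, h θ x * f θ x) Θ

/-- The regularity conditions on the parameter set and on the family of densities. -/
structure FamilyAssumptions {m : ℕ} (Θ : Set (Param m)) (f : Param m → ℝ → ℝ) : Prop where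
  compact : IsCompact Θ
  convex : Convex ℝ Θ
  density : ∀ θ ∈ Θ, IsDensity (f θ)
  identifiable : ∀ θ₁ ∈ Θ, ∀ θ₂ ∈ Θ, θ₁ ≠ θ₂ → ¬ (f θ₁ =ᵐ[volume] f θ₂)
  /-- `f_θ(x)` is positive and three times continuously differentiable in `θ`
  (on an open set around `Θ`, so that derivatives make sense at its boundary). -/
  smooth : ∃ U : Set (Param m), IsOpen U ∧ Θ ⊆ U ∧
    (∀ θ ∈ U, Measurable (f θ) ∧ ∀ x, 0 < f θ x) ∧
    ∀ x, ContDiffOn ℝ 3 (fun t => f t x) U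
  fisher_posDef : ∀ θ ∈ Θ, (fisher f θ).PosDef
  fisher_continuous : ContinuousOn (fisher f) Θ
  /-- The `L²` norms of `u f^{1/2}`, `u̇ f^{1/2}`, `u uᵀ f^{1/2}` (squared here). -/
  l2_score : HasContMoment Θ f fun θ x => ∑ i, score f θ x i ^ 2
  l2_score2 : HasContMoment Θ f fun θ x => ∑ i, ∑ j, score2 f θ x i j ^ 2
  l2_outer : HasContMoment Θ f fun θ x => ∑ i, ∑ j, (score f θ x i * score f θ x j) ^ 2
  /-- Score moments up to total order six. -/
  score_moments : ∀ k : Fin m → ℕ, ∑ i, k i ≤ 6 →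
    HasContMoment Θ f fun θ x => ∏ i, |score f θ x i| ^ k i
  /-- Second moments of the higher scores, bounded on `Θ`. -/
  higher_moments : ∃ C : ℝ, ∀ θ ∈ Θ, ∀ i j l : Fin m,
    (Integrable (fun x => score2 f θ x i j ^ 2 * f θ x) ∧
      ∫ x, score2 f θ x i j ^ 2 * f θ x ≤ C) ∧
    (Integrable (fun x => score3 f θ x i j l ^ 2 * f θ x) ∧
      ∫ x, score3 f θ x i j l ^ 2 * f θ x ≤ C) ∧
    (Integrable (fun x => (score2 f θ x i j * score f θ x l) ^ 2 * f θ x) ∧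
      ∫ x, (score2 f θ x i j * score f θ x l) ^ 2 * f θ x ≤ C)
  /-- Moments of conjugate order `q`, for some `p ∈ (1, 2)` with `1/p + 1/q = 1`. -/
  conj_moments : ∃ p q : ℝ, 1 < p ∧ p < 2 ∧ 1 / p + 1 / q = 1 ∧
    (HasContMoment Θ f fun θ x =>
      (∑ i, |score f θ x i * f θ x ^ (1 / 2 - 1 / q)|) ^ q) ∧
    (HasContMoment Θ f fun θ x =>
      (∑ i, ∑ j, |score f θ x i * score f θ x j * f θ x ^ (1 / 2 - 1 / q)|) ^ q) ∧
    (HasContMoment Θ f fun θ x =>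
      (∑ i, ∑ j, |score2 f θ x i j * f θ x ^ (1 / 2 - 1 / q)|) ^ q)

/-! ### The Hellinger loss, its gradient and Hessian, and the density estimator -/

/-- The squared Hellinger distance `∫ (√p - √q)²` of two densities on the line. -/
def hellSq (p q : ℝ → ℝ) : ℝ := ∫ x, (√(p x) - √(q x)) ^ 2

/-- The loss `L(θ) = 2 ∫ (√f_θ - √q)²`. -/
def loss {m : ℕ} (f : Param m → ℝ → ℝ) (q : ℝ → ℝ) (θ : Param m) : ℝ :=
  2 * hellSq (f θ) q

/-- The gradient of the loss, `-2 ∫ q^{1/2} f_θ^{1/2} u_θ`. -/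
def lossGrad {m : ℕ} (f : Param m → ℝ → ℝ) (q : ℝ → ℝ) (θ : Param m) : Param m :=
  WithLp.toLp 2 fun i => -2 * ∫ x, √(q x) * √(f θ x) * score f θ x i

/-- The Hessian of the loss, `-∫ q^{1/2} f_θ^{1/2} (u_θ u_θᵀ + 2 u̇_θ)`. -/
def lossHess {m : ℕ} (f : Param m → ℝ → ℝ) (q : ℝ → ℝ) (θ : Param m) :
    Matrix (Fin m) (Fin m) ℝ :=
  Matrix.of fun i j =>
    -∫ x, √(q x) * √(f θ x) * (score f θ x i * score f θ x j + 2 * score2 f θ x i j)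

/-- The kernel density estimator with bandwidth `c` that uses only the observations in
`(-b, b)`. -/
def truncKDE (K : ℝ → ℝ) (c b : ℝ) {n : ℕ} (D : Fin n → ℝ) (x : ℝ) : ℝ :=
  1 / (n * c) * ∑ i, K ((x - D i) / c) * (Set.Ioo (-b) b).indicator 1 (D i)

/-- The conditions on the data density `g`, the kernel `K`, the bandwidths `c n`, the truncation
levels `b n` and the population minimizer `θg`. -/
structure SamplingAssumptions {m : ℕ} (Θ : Set (Param m)) (f : Param m → ℝ → ℝ)
    (g K : ℝ → ℝ) (c b a : ℕ → ℝ) (θg : Param m) : Prop where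
  density : IsDensity g
  interior : θg ∈ interior Θ
  /-- `θg` is the unique minimizer over `Θ` of the Hellinger distance to `g`. -/
  unique_min : ∀ θ ∈ Θ, θ ≠ θg → hellSq (f θg) g < hellSq (f θ) g
  kernel_density : IsDensity K
  kernel_symm : ∀ x, K (-x) = K x
  kernel_support : HasCompactSupport K
  bandwidth_pos : ∀ n, 0 < c n
  bandwidth_zero : Tendsto c atTop (𝓝 0)
  bandwidth_upper : Tendsto (fun n : ℕ => √(n : ℝ) * c n ^ 2) atTop (𝓝 0)
  bandwidth_lower : Tendsto (fun n : ℕ => √(n : ℝ) * c n) atTop atTop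
  trunc_mono : Monotone b
  trunc_top : Tendsto b atTop atTop
  a_top : Tendsto a atTop atTop
  tail : Tendsto (fun n : ℕ => (n : ENNReal) * ⨆ t ∈ Function.support K,
      (volume.withDensity fun x => ENNReal.ofReal (f θg x)) {x | a n < |x - c n * t|})
    atTop (𝓝 0)
  ratio : (⨆ (n : ℕ) (_ : 1 ≤ n) (x : ℝ) (_ : |x| ≤ a n) (t ∈ Function.support K),
    ENNReal.ofReal |(f θg x)⁻¹ * f θg (x + t * c n)|) < ⊤
  central : ∀ i, (∀ n, IntervalIntegrable (fun x => score f θg x i) volume (-a n) (a n)) ∧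
    Tendsto (fun n : ℕ => (√(n : ℝ) * c n)⁻¹ * ∫ x in (-a n)..(a n), score f θg x i)
      atTop (𝓝 0) ∧
    Tendsto (fun n : ℕ => √(n : ℝ) * c n ^ 4 * ∫ x in (-a n)..(a n), score f θg x i)
      atTop (𝓝 0)
  l2_smooth : ∀ i, Tendsto (fun n : ℕ => ⨆ t ∈ Function.support K,
      ∫⁻ x, ENNReal.ofReal ((score f θg (x + t * c n) i - score f θg x i) ^ 2 * f θg x))
    atTop (𝓝 0)

/-! ### Hellinger differential privacy -/

/-- The squared Hellinger distance `∫ (√(dP/dμ) - √(dQ/dμ))² dμ` of two finite measures, with the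
dominating measure `μ = P + Q` (the value is the same for every dominating measure, in particular
for Lebesgue measure when `P` and `Q` have Lebesgue densities). -/
def hellDist {α : Type*} [MeasurableSpace α] (P Q : Measure α) : ℝ :=
  ∫ x, (√(P.rnDeriv (P + Q) x).toReal - √(Q.rnDeriv (P + Q) x).toReal) ^ 2 ∂(P + Q)

/-- The randomized mechanism `M`, which maps a data set of size `n` to the law of its output, is
`ε`-Hellinger differentially private. -/
def IsHDP {α : Type*} [MeasurableSpace α] {n : ℕ} (ε : ℝ) (M : (Fin n → ℝ) → Measure α) : Prop :=
  (∀ D, IsProbabilityMeasure (M D)) ∧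
    ∀ D D', hammingDist D D' = 1 → hellDist (M D) (M D') ≤ ε

/-- The privacy level `h_k(x)` of a `k`-fold composition: `h_1(x) = x` and
`h_k(x) = x + h_{k-1}(x) - x h_{k-1}(x) / 2`. -/
def compLevel : ℕ → ℝ → ℝ
  | 0, _ => 0
  | k + 1, x => x + compLevel k x - 1 / 2 * x * compLevel k x

/-- The noise multiplier `(-8 log (1 - ε/2))^{-1/2}` of the Gaussian mechanism. -/
def noiseMult (ε : ℝ) : ℝ := √(1 / (-8 * Real.log (1 - 0.5 * ε)))

/-- The `L²` sensitivity, over `Θ`, of the gradient of the loss for data sets of size `n`. -/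
def gradSens {m : ℕ} (Θ : Set (Param m)) (f : Param m → ℝ → ℝ) (K : ℝ → ℝ) (c b : ℝ)
    (n : ℕ) : ℝ :=
  sSup {r | ∃ θ ∈ Θ, ∃ D D' : Fin n → ℝ, hammingDist D D' = 1 ∧
    r = ‖lossGrad f (truncKDE K c b D) θ - lossGrad f (truncKDE K c b D') θ‖}

/-- The `L²` (entrywise) sensitivity, over `Θ`, of the Hessian of the loss for data sets of
size `n`. -/
def hessSens {m : ℕ} (Θ : Set (Param m)) (f : Param m → ℝ → ℝ) (K : ℝ → ℝ) (c b : ℝ)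
    (n : ℕ) : ℝ :=
  sSup {r | ∃ θ ∈ Θ, ∃ D D' : Fin n → ℝ, hammingDist D D' = 1 ∧
    r = √(∑ i, ∑ j, (lossHess f (truncKDE K c b D) θ i j
      - lossHess f (truncKDE K c b D') θ i j) ^ 2)}

/-! ### Private Newton-Raphson -/

/-- The standard normal variables used in one step: a vector, and a matrix of which only the upper
triangle is used. -/
abbrev StepNoise (m : ℕ) := (Fin m → ℝ) × (Fin m → Fin m → ℝ)

/-- The law of the noise of one step: all entries are independent standard normal. -/
def stepNoiseLaw (m : ℕ) : Measure (StepNoise m) :=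
  (Measure.pi fun _ => gaussianReal 0 1).prod
    (Measure.pi fun _ => Measure.pi fun _ => gaussianReal 0 1)

/-- The law of the noise of `k` independent steps. -/
def noiseLaw (m k : ℕ) : Measure (Fin k → StepNoise m) :=
  Measure.pi fun _ => stepNoiseLaw m

/-- The symmetric matrix with the upper triangle (and diagonal) of `G`. -/
def symmOfUpper {m : ℕ} (G : Fin m → Fin m → ℝ) : Matrix (Fin m) (Fin m) ℝ :=
  Matrix.of fun i j => G (min i j) (max i j)

/-- One private Newton-Raphson step, for the loss built from the density estimate `q`:
`θ - η (H(θ) + W)⁻¹ (∇L(θ) + N)` with `N = Δ c_{ε'/2} Z` and `W = Δ_H c_{ε'/2} Z̃`.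
The queries `∇L` and `H`, defined on `Θ` only, return zero at a point outside `Θ`. -/
def pnrStep {m : ℕ} (Θ : Set (Param m)) (f : Param m → ℝ → ℝ) (q : ℝ → ℝ) (Δ ΔH ε' η : ℝ)
    (θ : Param m) (z : StepNoise m) : Param m :=
  θ - η • WithLp.toLp 2
    ((Θ.indicator (lossHess f q) θ + (ΔH * noiseMult (ε' / 2)) • symmOfUpper z.2)⁻¹.mulVec
      fun i => Θ.indicator (lossGrad f q) θ i + Δ * noiseMult (ε' / 2) * z.1 i)

/-- The private Newton-Raphson iterate after `k` steps, started at `θ₀`. -/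
def pnr {m : ℕ} (Θ : Set (Param m)) (f : Param m → ℝ → ℝ) (q : ℝ → ℝ) (Δ ΔH ε' η : ℝ)
    (θ₀ : Param m) : (k : ℕ) → (Fin k → StepNoise m) → Param m
  | 0, _ => θ₀
  | k + 1, z =>
    pnrStep Θ f q Δ ΔH ε' η (pnr Θ f q Δ ΔH ε' η θ₀ k fun i => z i.castSucc) (z (Fin.last k))

/-- The law of the private Newton-Raphson iterate after `k` steps, for a fixed data set. -/
def pnrLaw {m : ℕ} (Θ : Set (Param m)) (f : Param m → ℝ → ℝ) (q : ℝ → ℝ) (Δ ΔH ε' η : ℝ)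
    (θ₀ : Param m) (k : ℕ) : Measure (Param m) :=
  (noiseLaw m k).map (pnr Θ f q Δ ΔH ε' η θ₀ k)

/-- The law of `n` independent observations with density `g`. -/
def sampleLaw (g : ℝ → ℝ) (n : ℕ) : Measure (Fin n → ℝ) :=
  Measure.pi fun _ => volume.withDensity fun x => ENNReal.ofReal (g x)

end PMHDE

end

/-! Privacy. The Hellinger affinity ∫√(dP dQ) of two probability measures is one minus half their
squared Hellinger distance. Lower bounds for it are expressed through AM-GM: 2a ≤ ∫ h dP + ∫ h⁻¹ dQ
for every test function h. In this form (`OverlapGE`) a bound passes to images at once, and bounds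
multiply under adaptive composition (`OverlapGE.comp`) without any density of the output laws. A
shift of standard normal noise by a vector a costs the factor exp(-|a|²/8). Exchanging one
observation changes a query by at most its sensitivity bound, so it acts as a shift of the noise of
squared length at most 1/c², where c is the noise multiplier (`exists_pnrStep_shift`). At level ε'/2
each of the two queries then costs 1 - ε'/4, so a step keeps (1 - ε'/4)² ≥ 1 - ε'/2, and k steps
keep (1 - ε'/2)^k = 1 - h_k(ε')/2 (`one_sub_compLevel`).

Utility. On a good event the argument is deterministic. A sub-density q enters the loss only through
√q, which has L² norm at most one, so Cauchy-Schwarz and the score moments give Taylor bounds for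
the loss and the gradient and a Lipschitz bound for the Hessian, uniform over Θ and over all q. In
the same way losses, up to a constant free of θ, and Hessians depend on q in a Lipschitz way for the
Hellinger distance. If q is Hellinger-close to g, then its minimizer is near θ_g, its Hessian near
θ_g is close to the invertible matrix H_∞(θ_g), and full Newton steps (η = 1) with noise of size at
most τ leave an error of at most (1/2)^(2^k) + bτ (`exists_newton_convergence`). When g is itself
close to the model, H_∞(θ_g) is invertible because it is close to a Fisher information matrix
(`exists_isUnit_det`).

The good event combines Hellinger consistency of the density estimator
(`hellSq_truncKDE_consistent`) with a bound of order √log(k/ξ) for all the normal variables. One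
observation moves the root of the estimator by at most two root bumps, whose L^{p₀} norms are of
order n^{-1/2} c_n^{1/p₀-1/2}; Hölder's inequality against the conjugate moments bounds the
sensitivities at this order, and n^{1/2}c_n² → 0 makes that O(n^{-1/2-δ}) with δ = (1/p₀ - 1/2)/4.
The rate is taken with 1/p = 1/2 + δ/2. The spare factor n^{-δ/2} absorbs every constant that
depends on g, K or ε, which is why c₂ can be chosen before them, and even equal to one. -/

open scoped ENNReal

/-! ### Calculus of Hellinger affinities -/

namespace PMHDE

/-- A variational lower bound for the Hellinger affinity `∫ √(dP dQ)`. -/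
def OverlapGE {α : Type*} [MeasurableSpace α] (a : ℝ≥0∞) (P Q : Measure α) : Prop :=
  ∀ h : α → ℝ≥0∞, Measurable h → 2 * a ≤ ∫⁻ x, h x ∂P + ∫⁻ x, (h x)⁻¹ ∂Q

lemma two_mul_le_sq_add_sq (x y : ℝ≥0∞) : 2 * (x * y) ≤ x ^ 2 + y ^ 2 := by
  rcases eq_or_ne x ∞ with rfl | hx
  · simp
  rcases eq_or_ne y ∞ with rfl | hy
  · simp
  lift x to NNReal using hx
  lift y to NNReal using hy
  norm_cast
  rw [← mul_assoc]
  exact two_mul_le_add_sq x y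

/-- AM-GM at a single point, with p and q in the role of density values. The degenerate values of h
are harmless: h = 0 makes the right side infinite unless q = 0, and h = ∞ does so unless p = 0. -/
lemma two_mul_rpow_half_le {h : ℝ≥0∞} {p q : ℝ≥0∞} :
    2 * (p * q) ^ (1 / 2 : ℝ) ≤ h * p + h⁻¹ * q := by
  have sq : ∀ x : ℝ≥0∞, (x ^ (1 / 2 : ℝ)) ^ 2 = x := fun x => by
    rw [← ENNReal.rpow_natCast, ← ENNReal.rpow_mul]; norm_num
  rcases eq_or_ne h 0 with rfl | h0
  · rcases eq_or_ne q 0 with rfl | hq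
    · simp
    · simp [hq]
  rcases eq_or_ne h ∞ with rfl | hT
  · rcases eq_or_ne p 0 with rfl | hp
    · simp
    · simp [hp]
  have := two_mul_le_sq_add_sq ((h * p) ^ (1 / 2 : ℝ)) ((h⁻¹ * q) ^ (1 / 2 : ℝ))
  rw [sq, sq, ← ENNReal.mul_rpow_of_nonneg _ _ (by norm_num)] at this
  convert this using 3
  rw [mul_mul_mul_comm, ENNReal.mul_inv_cancel h0 hT, one_mul]

/-- Data processing: test functions on the target pull back to test functions on the source. -/
lemma OverlapGE.map {α β : Type*} [MeasurableSpace α] [MeasurableSpace β] {a : ℝ≥0∞}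
    {P Q : Measure α} (hPQ : OverlapGE a P Q) {T : α → β} (hT : Measurable T) :
    OverlapGE a (P.map T) (Q.map T) := by
  intro h hh
  rw [lintegral_map hh hT, lintegral_map (f := fun x => (h x)⁻¹) hh.inv hT]
  exact hPQ _ (hh.comp hT)

lemma OverlapGE.refl {α : Type*} [MeasurableSpace α] (P : Measure α) [IsProbabilityMeasure P] :
    OverlapGE 1 P P := by
  intro h hh
  rw [← lintegral_add_left hh]
  calc (2 : ℝ≥0∞) * 1 = ∫⁻ _, 2 ∂P := by simp
    _ ≤ _ := lintegral_mono fun x => by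
      simpa using two_mul_rpow_half_le (h := h x) (p := 1) (q := 1)

lemma OverlapGE.mono {α : Type*} [MeasurableSpace α] {a b : ℝ≥0∞} {P Q : Measure α}
    (h : OverlapGE b P Q) (hab : a ≤ b) : OverlapGE a P Q :=
  fun k hk => (mul_le_mul_right hab 2).trans (h k hk)

/-- Optimizing over the scale t turns the additive bound 2b ≤ tφ + ψ/t into the multiplicative one
b² ≤ φψ, here solved for ψ so that it makes sense at the values 0 and ∞. -/
lemma sq_mul_inv_le_of_scaling {b φ ψ : ℝ≥0∞} (hb0 : b ≠ 0) (hb : b ≠ ∞)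
    (H : ∀ t : ℝ≥0∞, t ≠ 0 → t ≠ ∞ → 2 * b ≤ t * φ + t⁻¹ * ψ) : b ^ 2 * φ⁻¹ ≤ ψ := by
  rcases eq_or_ne φ ∞ with rfl | hT
  · simp
  rcases eq_or_ne φ 0 with rfl | h0
  · have : ψ = ∞ := by
      by_contra hψ
      lift ψ to NNReal using hψ
      lift b to NNReal using hb
      have hb' : 0 < b := by simpa [pos_iff_ne_zero] using hb0
      -- With φ = 0 this scale yields 2b ≤ bψ/(ψ + 1), which is absurd for finite ψ.
      have h1 := H ((ψ + 1) / b : NNReal) (by simp; exact hb'.ne') (by simp)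
      have hne : (ψ + 1) / b ≠ 0 := by positivity
      rw [mul_zero, zero_add, ← ENNReal.coe_inv hne] at h1
      norm_cast at h1
      rw [inv_div, div_mul_eq_mul_div, le_div_iff₀ (by positivity)] at h1
      have : (0 : NNReal) ≤ b * ψ := by positivity
      have h2 : (b : ℝ) * ψ ≥ 0 := by positivity
      have h3 : (2 : ℝ) * b * (ψ + 1) ≤ b * ψ := by exact_mod_cast h1
      have h4 : (0 : ℝ) < b := by exact_mod_cast hb'
      nlinarith
    simp [this]
  -- This scale makes the first summand equal to b, leaving b ≤ t⁻¹ψ.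
  have h1 := H (b * φ⁻¹) (by simp [hb0, hT]) (ENNReal.mul_ne_top hb (by simpa using h0))
  rw [mul_assoc, ENNReal.inv_mul_cancel h0 hT, mul_one, two_mul,
    ENNReal.add_le_add_iff_left hb] at h1
  calc b ^ 2 * φ⁻¹ = (b * φ⁻¹) * b := by ring
    _ ≤ (b * φ⁻¹) * ((b * φ⁻¹)⁻¹ * ψ) := by gcongr
    _ = ψ := by
      rw [← mul_assoc, ENNReal.mul_inv_cancel (by simp [hb0, hT])
        (ENNReal.mul_ne_top hb (by simpa using h0)), one_mul]

/-- Adaptive composition: overlaps multiply. -/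
lemma OverlapGE.comp {α β : Type*} [MeasurableSpace α] [MeasurableSpace β]
    {a b : ℝ≥0∞} (hb : b ≠ ∞) {P Q : Measure α} (hPQ : OverlapGE a P Q)
    {P' Q' : Measure β} {κ κ' : α → Measure β} (hκ : ∀ x, OverlapGE b (κ x) (κ' x))
    (hm : ∀ h : β → ℝ≥0∞, Measurable h → Measurable fun x => ∫⁻ y, h y ∂(κ x))
    (hP' : ∀ h : β → ℝ≥0∞, Measurable h → ∫⁻ y, h y ∂P' = ∫⁻ x, ∫⁻ y, h y ∂(κ x) ∂P)
    (hQ' : ∀ h : β → ℝ≥0∞, Measurable h → ∫⁻ y, h y ∂Q' = ∫⁻ x, ∫⁻ y, h y ∂(κ' x) ∂Q) :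
    OverlapGE (a * b) P' Q' := by
  intro h hh
  rcases eq_or_ne b 0 with rfl | hb0
  · simp
  rw [hP' h hh, hQ' (fun x => (h x)⁻¹) hh.inv]
  -- Rescaling h inside the bound for the second stage gives the multiplicative form for each x
  -- separately.
  have key : ∀ x, b ^ 2 * (∫⁻ y, h y ∂(κ x))⁻¹ ≤ ∫⁻ y, (h y)⁻¹ ∂(κ' x) := by
    intro x
    refine sq_mul_inv_le_of_scaling hb0 hb fun t ht0 htT => ?_
    have := hκ x (fun y => t * h y) (hh.const_mul t)
    rw [lintegral_const_mul _ hh] at this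
    refine this.trans (le_of_eq ?_)
    rw [← lintegral_const_mul (f := fun y => (h y)⁻¹) _ hh.inv]
    congr 2
    ext y
    rw [ENNReal.mul_inv (Or.inl ht0) (Or.inl htT)]
  -- The inner integral itself, normalized by b, is the test function for the first stage; `key`
  -- then controls its reciprocal.
  have h1 := hPQ (fun x => b⁻¹ * ∫⁻ y, h y ∂(κ x)) ((hm h hh).const_mul _)
  calc 2 * (a * b) = b * (2 * a) := by ring
    _ ≤ b * (∫⁻ x, b⁻¹ * ∫⁻ y, h y ∂(κ x) ∂P + ∫⁻ x, (b⁻¹ * ∫⁻ y, h y ∂(κ x))⁻¹ ∂Q) := by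
      gcongr
    _ = ∫⁻ x, ∫⁻ y, h y ∂(κ x) ∂P + ∫⁻ x, b ^ 2 * (∫⁻ y, h y ∂(κ x))⁻¹ ∂Q := by
      rw [mul_add, lintegral_const_mul _ (hm h hh), ← mul_assoc, ENNReal.mul_inv_cancel hb0 hb,
        one_mul, ← lintegral_const_mul (f := fun x => (b⁻¹ * ∫⁻ y, h y ∂(κ x))⁻¹) b
          ((hm h hh).const_mul _).inv]
      congr 2
      ext x
      rw [ENNReal.mul_inv (Or.inl (by simpa using hb)) (Or.inl (by simpa using hb0)), inv_inv]
      ring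
    _ ≤ _ := by gcongr; exact key _

/-- A product is a composition whose second stage ignores the outcome of the first. -/
lemma OverlapGE.prod {α β : Type*} [MeasurableSpace α] [MeasurableSpace β]
    {a b : ℝ≥0∞} (hb : b ≠ ∞) {P Q : Measure α} (hPQ : OverlapGE a P Q)
    {P' Q' : Measure β} [SFinite P'] [SFinite Q'] (h' : OverlapGE b P' Q') :
    OverlapGE (a * b) (P.prod P') (Q.prod Q') := by
  refine hPQ.comp hb (κ := fun x => P'.map (Prod.mk x)) (κ' := fun x => Q'.map (Prod.mk x))
    (fun x => h'.map measurable_prodMk_left) ?_ ?_ ?_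
  · intro h hh
    simp_rw [lintegral_map hh measurable_prodMk_left]
    exact hh.lintegral_prod_right'
  · intro h hh
    simp_rw [lintegral_map hh measurable_prodMk_left]
    exact lintegral_prod _ hh.aemeasurable
  · intro h hh
    simp_rw [lintegral_map hh measurable_prodMk_left]
    exact lintegral_prod _ hh.aemeasurable

lemma OverlapGE.pi {α : Type*} [MeasurableSpace α] {n : ℕ} (P Q : Fin n → Measure α)
    [∀ i, IsProbabilityMeasure (P i)] [∀ i, IsProbabilityMeasure (Q i)] (b : Fin n → ℝ≥0∞)
    (hb : ∀ i, b i ≠ ∞) (h : ∀ i, OverlapGE (b i) (P i) (Q i)) :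
    OverlapGE (∏ i, b i) (Measure.pi P) (Measure.pi Q) := by
  induction n with
  | zero =>
    simp only [Finset.univ_eq_empty, Finset.prod_empty]
    have : Measure.pi P = Measure.pi Q := by
      congr 1; ext i; exact i.elim0
    rw [this]
    exact OverlapGE.refl _
  | succ n ih =>
    have hP := (measurePreserving_piFinSuccAbove P 0).symm
    have hQ := (measurePreserving_piFinSuccAbove Q 0).symm
    rw [← hP.map_eq, ← hQ.map_eq, Fin.prod_univ_succ]
    refine OverlapGE.map ?_ (MeasurableEquiv.measurable _)
    refine (h 0).prod (ENNReal.prod_ne_top fun i _ => hb i.succ) ?_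
    exact ih (fun i => P i.succ) (fun i => Q i.succ) (fun i => b i.succ) (fun i => hb _)
      fun i => h _

/-- The geometric mean of the two normal densities is exp(-(a-b)²/8) times the normal density
centred at (a+b)/2, which has mass one. -/
lemma overlapGE_gaussian (a b : ℝ) :
    OverlapGE (ENNReal.ofReal (Real.exp (-(a - b) ^ 2 / 8)))
      ((gaussianReal 0 1).map (· + a)) ((gaussianReal 0 1).map (· + b)) := by
  rw [gaussianReal_map_add_const, gaussianReal_map_add_const]
  simp only [zero_add]
  intro h hh
  rw [gaussianReal_of_var_ne_zero _ one_ne_zero, gaussianReal_of_var_ne_zero _ one_ne_zero,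
    lintegral_withDensity_eq_lintegral_mul _ (measurable_gaussianPDF _ _) hh,
    lintegral_withDensity_eq_lintegral_mul _ (measurable_gaussianPDF _ _)
      (g := fun x => (h x)⁻¹) hh.inv,
    ← lintegral_add_left ((measurable_gaussianPDF _ _).mul hh)]
  have h1 : ∫⁻ x, gaussianPDF ((a + b) / 2) 1 x = 1 := lintegral_gaussianPDF_eq_one _ one_ne_zero
  rw [← mul_one (2 * _), ← h1, ← lintegral_const_mul _ (measurable_gaussianPDF _ _)]
  refine lintegral_mono fun x => ?_
  refine le_trans (le_of_eq ?_) ((two_mul_rpow_half_le (h := h x) (p := gaussianPDF a 1 x)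
    (q := gaussianPDF b 1 x)).trans (le_of_eq ?_))
  · rw [mul_assoc]
    congr 1
    simp only [gaussianPDF]
    rw [← ENNReal.ofReal_mul (Real.exp_nonneg _),
      ← ENNReal.ofReal_mul (gaussianPDFReal_nonneg _ _ _),
      ENNReal.ofReal_rpow_of_nonneg (mul_nonneg (gaussianPDFReal_nonneg _ _ _)
        (gaussianPDFReal_nonneg _ _ _)) (by norm_num), ← Real.sqrt_eq_rpow]
    congr 1
    symm
    rw [Real.sqrt_eq_iff_mul_self_eq (mul_nonneg (gaussianPDFReal_nonneg _ _ _)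
        (gaussianPDFReal_nonneg _ _ _)) (mul_nonneg (Real.exp_nonneg _)
        (gaussianPDFReal_nonneg _ _ _))]
    simp only [gaussianPDFReal]
    have e : Real.exp (-(a - b) ^ 2 / 8) * Real.exp (-(a - b) ^ 2 / 8) *
      (Real.exp (-(x - (a + b) / 2) ^ 2 / (2 * (1 : NNReal))) *
        Real.exp (-(x - (a + b) / 2) ^ 2 / (2 * (1 : NNReal)))) =
      Real.exp (-(x - a) ^ 2 / (2 * (1 : NNReal))) *
        Real.exp (-(x - b) ^ 2 / (2 * (1 : NNReal))) := by
      rw [← Real.exp_add, ← Real.exp_add, ← Real.exp_add, ← Real.exp_add]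
      congr 1
      simp only [NNReal.coe_one]
      ring
    linear_combination -((√(2 * Real.pi * (1 : NNReal)))⁻¹) ^ 2 * e
  · simp [mul_comm]

/-- The test function √(q/p) is optimal: with it both integrals reduce to the affinity ∫√(pq).
Expanding the square expresses the Hellinger distance as two minus twice the affinity. -/
lemma hellDist_le_of_overlapGE {α : Type*} [MeasurableSpace α] {P Q : Measure α}
    [IsProbabilityMeasure P] [IsProbabilityMeasure Q] {a : ℝ}
    (h : OverlapGE (ENNReal.ofReal a) P Q) : hellDist P Q ≤ 2 - 2 * a := by
  set μ := P + Q with hμ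
  have hPμ : P ≪ μ := Measure.absolutelyContinuous_of_le (Measure.le_add_right le_rfl)
  have hQμ : Q ≪ μ := Measure.absolutelyContinuous_of_le (Measure.le_add_left le_rfl)
  set p := P.rnDeriv μ
  set q := Q.rnDeriv μ
  have hp : Measurable p := Measure.measurable_rnDeriv _ _
  have hq : Measurable q := Measure.measurable_rnDeriv _ _
  have hpi : Integrable (fun x => (p x).toReal) μ := Measure.integrable_toReal_rnDeriv
  have hqi : Integrable (fun x => (q x).toReal) μ := Measure.integrable_toReal_rnDeriv
  have hp1 : ∫ x, (p x).toReal ∂μ = 1 := by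
    rw [Measure.integral_toReal_rnDeriv hPμ]; simp
  have hq1 : ∫ x, (q x).toReal ∂μ = 1 := by
    rw [Measure.integral_toReal_rnDeriv hQμ]; simp
  have hpf : ∀ᵐ x ∂μ, p x ≠ ∞ := Measure.rnDeriv_ne_top _ _
  have hqf : ∀ᵐ x ∂μ, q x ≠ ∞ := Measure.rnDeriv_ne_top _ _
  have hpq : Integrable (fun x => √(p x).toReal * √(q x).toReal) μ := by
    refine (hpi.add hqi).mono' ?_ ?_
    · exact (hp.ennreal_toReal.sqrt.mul hq.ennreal_toReal.sqrt).aestronglyMeasurable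
    · refine ae_of_all _ fun x => ?_
      have h1 := Real.mul_self_sqrt (ENNReal.toReal_nonneg (a := p x))
      have h2 := Real.mul_self_sqrt (ENNReal.toReal_nonneg (a := q x))
      rw [Real.norm_of_nonneg (by positivity), Pi.add_apply]
      nlinarith [sq_nonneg (√(p x).toReal - √(q x).toReal),
        Real.sqrt_nonneg (p x).toReal, Real.sqrt_nonneg (q x).toReal]
  have hmain : a ≤ ∫ x, √(p x).toReal * √(q x).toReal ∂μ := by
    have h1 := h (fun x => (q x / p x) ^ (1 / 2 : ℝ)) ((hq.div hp).pow_const _)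
    rw [← lintegral_rnDeriv_mul hPμ (f := fun x => (q x / p x) ^ (1 / 2 : ℝ))
        (((hq.div hp).pow_const _).aemeasurable),
      ← lintegral_rnDeriv_mul hQμ (f := fun x => ((q x / p x) ^ (1 / 2 : ℝ))⁻¹)
        (((hq.div hp).pow_const _).inv.aemeasurable)] at h1
    have e : ∀ᵐ x ∂μ, p x * (q x / p x) ^ (1 / 2 : ℝ) ≤
          ENNReal.ofReal (√(p x).toReal * √(q x).toReal) ∧
        q x * ((q x / p x) ^ (1 / 2 : ℝ))⁻¹ ≤
          ENNReal.ofReal (√(p x).toReal * √(q x).toReal) := by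
      have aux : ∀ s t : ℝ≥0∞, s ≠ ∞ → t ≠ ∞ → s * (t / s) ^ (1 / 2 : ℝ) ≤
          ENNReal.ofReal (√s.toReal * √t.toReal) := by
        intro s t hs ht
        rcases eq_or_ne s 0 with rfl | hs0
        · simp
        rw [ENNReal.ofReal_mul (by positivity), Real.sqrt_eq_rpow, Real.sqrt_eq_rpow,
          ← ENNReal.ofReal_rpow_of_nonneg ENNReal.toReal_nonneg (by norm_num),
          ← ENNReal.ofReal_rpow_of_nonneg ENNReal.toReal_nonneg (by norm_num),
          ENNReal.ofReal_toReal hs, ENNReal.ofReal_toReal ht,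
          ENNReal.div_rpow_of_nonneg _ _ (by norm_num)]
        have : s = s ^ (1 / 2 : ℝ) * s ^ (1 / 2 : ℝ) := by
          rw [← ENNReal.rpow_add _ _ hs0 hs]; norm_num
        have h0 : s ^ (1 / 2 : ℝ) ≠ 0 := by simp [hs0, hs]
        have hT : s ^ (1 / 2 : ℝ) ≠ ∞ := by simp [hs0, hs]
        nth_rewrite 1 [this]
        rw [mul_assoc, ENNReal.mul_div_cancel h0 hT]
      filter_upwards [hpf, hqf] with x h1 h2
      refine ⟨aux _ _ h1 h2, ?_⟩
      rw [mul_comm √(p x).toReal]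
      rw [← ENNReal.inv_rpow]
      rcases eq_or_ne (q x) 0 with h0 | h0
      · simp [h0]
      rw [ENNReal.inv_div (Or.inl h1) (Or.inr h0)]
      exact aux _ _ h2 h1
    have h2 : 2 * ENNReal.ofReal a ≤
        2 * ∫⁻ x, ENNReal.ofReal (√(p x).toReal * √(q x).toReal) ∂μ := by
      rw [two_mul (∫⁻ x, _ ∂μ)]
      refine h1.trans (add_le_add (lintegral_mono_ae ?_) (lintegral_mono_ae ?_))
      · filter_upwards [e] with x hx using hx.1
      · filter_upwards [e] with x hx using hx.2
    rw [ENNReal.mul_le_mul_iff_right two_ne_zero ENNReal.ofNat_ne_top,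
      ← ofReal_integral_eq_lintegral_ofReal hpq (ae_of_all _ fun x => by positivity)] at h2
    exact (ENNReal.ofReal_le_ofReal_iff (integral_nonneg fun x => by positivity)).1 h2
  have : hellDist P Q = ∫ x, ((p x).toReal + (q x).toReal
      - 2 * (√(p x).toReal * √(q x).toReal)) ∂μ := by
    unfold hellDist
    refine integral_congr_ae (ae_of_all _ fun x => ?_)
    have h1 := Real.sq_sqrt (ENNReal.toReal_nonneg (a := p x))
    have h2 := Real.sq_sqrt (ENNReal.toReal_nonneg (a := q x))
    simp only
    linear_combination h1 + h2
  rw [this, integral_sub (f := fun x => (p x).toReal + (q x).toReal) (hpi.add hqi)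
    (hpq.const_mul 2), integral_add hpi hqi, hp1, hq1, integral_const_mul]
  linarith

end PMHDE

/-! ### Partial derivatives and measurability of the scores -/

namespace PMHDE

variable {m : ℕ}

/-- `F` is differentiable at `θ` with partial derivatives `a`. -/
def HasPartials (F : Param m → ℝ) (a : Fin m → ℝ) (θ : Param m) : Prop :=
  HasFDerivAt F (∑ j, a j • (EuclideanSpace.proj j : Param m →L[ℝ] ℝ)) θ

lemma HasPartials.congr {F : Param m → ℝ} {a b : Fin m → ℝ} {θ : Param m}
    (h : HasPartials F a θ) (hab : ∀ j, a j = b j) : HasPartials F b θ := by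
  rwa [← show a = b from funext hab]

lemma HasPartials.mul {F G : Param m → ℝ} {a b : Fin m → ℝ} {θ : Param m}
    (hF : HasPartials F a θ) (hG : HasPartials G b θ) :
    HasPartials (fun t => F t * G t) (fun j => F θ * b j + G θ * a j) θ := by
  refine (HasFDerivAt.mul hF hG).congr_fderiv ?_
  ext v
  simp [Finset.mul_sum, Finset.sum_add_distrib, add_mul, mul_assoc]

lemma HasPartials.add {F G : Param m → ℝ} {a b : Fin m → ℝ} {θ : Param m}
    (hF : HasPartials F a θ) (hG : HasPartials G b θ) :
    HasPartials (fun t => F t + G t) (fun j => a j + b j) θ := by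
  refine (HasFDerivAt.add hF hG).congr_fderiv ?_
  ext v
  simp [Finset.sum_add_distrib, add_mul]

lemma HasPartials.const_mul {F : Param m → ℝ} {a : Fin m → ℝ} {θ : Param m} (c : ℝ)
    (hF : HasPartials F a θ) : HasPartials (fun t => c * F t) (fun j => c * a j) θ := by
  refine (HasFDerivAt.const_mul hF c).congr_fderiv ?_
  ext v
  simp [Finset.mul_sum, mul_assoc]

lemma HasPartials.exp {F : Param m → ℝ} {a : Fin m → ℝ} {θ : Param m}
    (hF : HasPartials F a θ) :
    HasPartials (fun t => Real.exp (F t)) (fun j => Real.exp (F θ) * a j) θ := by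
  refine (HasFDerivAt.exp hF).congr_fderiv ?_
  ext v
  simp [Finset.mul_sum, mul_assoc]

lemma HasPartials.hasDerivAt_line {F : Param m → ℝ} {a : Fin m → ℝ} {θ v : Param m} {s : ℝ}
    (hF : HasPartials F a (θ + s • v)) :
    HasDerivAt (fun s : ℝ => F (θ + s • v)) (∑ j, v j * a j) s := by
  have h1 : HasDerivAt (fun s : ℝ => θ + s • v) v s := by
    simpa using ((hasDerivAt_id s).smul_const v).const_add θ
  refine (HasFDerivAt.comp_hasDerivAt (f := fun s : ℝ => θ + s • v) s hF h1).congr_deriv ?_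
  simp [mul_comm]

lemma hasPartials_affine (c : Fin m → ℝ) (d θ : Param m) :
    HasPartials (fun t => ∑ j, c j * (t j - d j)) c θ := by
  refine HasFDerivAt.fun_sum fun j _ => ?_
  exact ((EuclideanSpace.proj j : Param m →L[ℝ] ℝ).hasFDerivAt.sub_const (d j)).const_mul (c j)

lemma hasPartials_pderiv {U : Set (Param m)} (hU : IsOpen U) {F : Param m → ℝ}
    {n : WithTop ℕ∞} (hn : n ≠ 0) (hF : ContDiffOn ℝ n F U) {θ : Param m} (hθ : θ ∈ U) :
    HasPartials F (fun i => pderiv i F θ) θ := by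
  have hd : DifferentiableAt ℝ F θ :=
    (hF.differentiableOn hn).differentiableAt (hU.mem_nhds hθ)
  refine hd.hasFDerivAt.congr_fderiv (Eq.symm ?_)
  have : ∀ i, pderiv i F θ = fderiv ℝ F θ (EuclideanSpace.single i 1) := fun i =>
    hd.lineDeriv_eq_fderiv
  refine ContinuousLinearMap.coe_injective ?_
  refine (EuclideanSpace.basisFun (Fin m) ℝ).toBasis.ext fun i => ?_
  simp [this, PiLp.single_apply]

lemma contDiffOn_pderiv {U : Set (Param m)} (hU : IsOpen U) {F : Param m → ℝ}
    {n : WithTop ℕ∞} (hF : ContDiffOn ℝ (n + 1) F U) (i : Fin m) :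
    ContDiffOn ℝ n (pderiv i F) U := by
  have h1 : ContDiffOn ℝ n (fun θ => fderiv ℝ F θ (EuclideanSpace.single i 1)) U :=
    (hF.fderiv_of_isOpen hU le_rfl).clm_apply contDiffOn_const
  refine h1.congr fun θ hθ => ?_
  have hd : DifferentiableAt ℝ F θ :=
    (hF.differentiableOn (by simp)).differentiableAt (hU.mem_nhds hθ)
  exact hd.lineDeriv_eq_fderiv

lemma pderiv_pderiv_comm {U : Set (Param m)} (hU : IsOpen U) {F : Param m → ℝ}
    (hF : ContDiffOn ℝ 2 F U) {θ : Param m} (hθ : θ ∈ U) (i j : Fin m) :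
    pderiv i (pderiv j F) θ = pderiv j (pderiv i F) θ := by
  have hC : ContDiffAt ℝ 2 F θ := hF.contDiffAt (hU.mem_nhds hθ)
  have key : ∀ i j : Fin m, pderiv i (pderiv j F) θ =
      fderiv ℝ (fderiv ℝ F) θ (EuclideanSpace.single i 1) (EuclideanSpace.single j 1) := by
    intro i j
    have h1 : pderiv j F =ᶠ[𝓝 θ] fun t => fderiv ℝ F t (EuclideanSpace.single j 1) := by
      filter_upwards [hU.mem_nhds hθ] with t ht
      exact ((hF.differentiableOn (by simp)).differentiableAt (hU.mem_nhds ht)).lineDeriv_eq_fderiv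
    have h2 : DifferentiableAt ℝ (fderiv ℝ F) θ :=
      (hC.fderiv_right (m := 1) (by norm_num)).differentiableAt (by simp)
    have h3 : HasFDerivAt (fun t => fderiv ℝ F t (EuclideanSpace.single j 1))
        ((fderiv ℝ (fderiv ℝ F) θ).flip (EuclideanSpace.single j 1)) θ := by
      refine (h2.hasFDerivAt.clm_apply
        (hasFDerivAt_const (EuclideanSpace.single j (1 : ℝ)) θ)).congr_fderiv ?_
      ext v; simp
    have h4 := h3.congr_of_eventuallyEq h1
    unfold pderiv at h4 ⊢
    rw [h4.differentiableAt.lineDeriv_eq_fderiv, h4.fderiv]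
    rfl
  rw [key, key]
  exact (hC.isSymmSndFDerivAt (by simp)) _ _

/-- A partial derivative is the pointwise limit in x of difference quotients along a fixed sequence
of increments, and each quotient is measurable. -/
lemma measurable_pderiv {U : Set (Param m)} (hU : IsOpen U) {F : Param m → ℝ → ℝ}
    (hm : ∀ θ ∈ U, Measurable (F θ)) {n : WithTop ℕ∞} (hn : n ≠ 0)
    (hF : ∀ x, ContDiffOn ℝ n (fun t => F t x) U) {θ : Param m} (hθ : θ ∈ U) (i : Fin m) :
    Measurable fun x => pderiv i (fun t => F t x) θ := by
  classical
  set e : Param m := EuclideanSpace.single i 1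
  have ht : Tendsto (fun n : ℕ => (1 : ℝ) / (n + 1)) atTop (𝓝[>] 0) :=
    tendsto_nhdsWithin_iff.2 ⟨tendsto_one_div_add_atTop_nhds_zero_nat,
      Eventually.of_forall fun n => Set.mem_Ioi.2 (by positivity)⟩
  have hmem : ∀ᶠ n : ℕ in atTop, θ + ((1 : ℝ) / (n + 1)) • e ∈ U := by
    have : Tendsto (fun n : ℕ => θ + ((1 : ℝ) / (n + 1)) • e) atTop (𝓝 θ) := by
      simpa using (tendsto_const_nhds (x := θ)).add
        ((tendsto_one_div_add_atTop_nhds_zero_nat (𝕜 := ℝ)).smul_const e)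
    exact this.eventually (hU.mem_nhds hθ)
  -- Measurability in x is available only for parameters in U, so the quotient is replaced by zero
  -- for the finitely many increments that may leave U.
  refine measurable_of_tendsto_metrizable (f := fun (n : ℕ) x =>
    if θ + ((1 : ℝ) / (n + 1)) • e ∈ U then
      ((1 : ℝ) / (n + 1))⁻¹ • (F (θ + ((1 : ℝ) / (n + 1)) • e) x - F θ x) else 0) ?_ ?_
  · intro n
    split_ifs with h
    · exact ((hm _ h).sub (hm _ hθ)).const_mul _
    · exact measurable_const
  · rw [tendsto_pi_nhds]
    intro x
    have hd : DifferentiableAt ℝ (fun t => F t x) θ :=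
      ((hF x).differentiableOn hn).differentiableAt (hU.mem_nhds hθ)
    have h1 := hd.lineDifferentiableAt (v := e) |>.hasLineDerivAt
    have h2 := h1.tendsto_slope_zero_right.comp ht
    refine h2.congr' ?_
    filter_upwards [hmem] with n hn
    rw [if_pos hn]
    rfl

/-- `f_θ(x)` is positive, measurable in `x` and `C³` in `θ` on the open set `U`. -/
structure SmoothFamily (U : Set (Param m)) (f : Param m → ℝ → ℝ) : Prop where
  isOpen : IsOpen U
  measurable : ∀ θ ∈ U, Measurable (f θ)
  pos : ∀ θ ∈ U, ∀ x, 0 < f θ x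
  contDiffOn : ∀ x, ContDiffOn ℝ 3 (fun t => f t x) U

namespace SmoothFamily

variable {U : Set (Param m)} {f : Param m → ℝ → ℝ} (hf : SmoothFamily U f)
include hf

lemma contDiffOn_log (x : ℝ) : ContDiffOn ℝ 3 (fun t => Real.log (f t x)) U :=
  (hf.contDiffOn x).log fun t ht => (hf.pos t ht x).ne'

lemma measurable_log {θ : Param m} (hθ : θ ∈ U) : Measurable fun x => Real.log (f θ x) :=
  (hf.measurable θ hθ).log

lemma contDiffOn_score (x : ℝ) (i : Fin m) : ContDiffOn ℝ 2 (fun t => score f t x i) U :=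
  contDiffOn_pderiv hf.isOpen (n := 2) (by convert hf.contDiffOn_log x using 1; norm_num) i

lemma contDiffOn_score2 (x : ℝ) (i j : Fin m) : ContDiffOn ℝ 1 (fun t => score2 f t x i j) U :=
  contDiffOn_pderiv hf.isOpen (n := 1) (by convert hf.contDiffOn_score x j using 1; norm_num) i

lemma contDiffOn_score3 (x : ℝ) (i j l : Fin m) :
    ContDiffOn ℝ 0 (fun t => score3 f t x i j l) U :=
  contDiffOn_pderiv hf.isOpen (n := 0)
    (by convert hf.contDiffOn_score2 x j l using 1; norm_num) i

lemma measurable_score {θ : Param m} (hθ : θ ∈ U) (i : Fin m) :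
    Measurable fun x => score f θ x i :=
  measurable_pderiv hf.isOpen (F := fun t x => Real.log (f t x))
    (fun _ h => hf.measurable_log h) (by simp) hf.contDiffOn_log hθ i

lemma measurable_score2 {θ : Param m} (hθ : θ ∈ U) (i j : Fin m) :
    Measurable fun x => score2 f θ x i j :=
  measurable_pderiv hf.isOpen (F := fun t x => score f t x j)
    (fun _ h => hf.measurable_score h j) (by simp) (fun x => hf.contDiffOn_score x j) hθ i

lemma measurable_score3 {θ : Param m} (hθ : θ ∈ U) (i j l : Fin m) :
    Measurable fun x => score3 f θ x i j l :=
  measurable_pderiv hf.isOpen (F := fun t x => score2 f t x j l)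
    (fun _ h => hf.measurable_score2 h j l) (by simp) (fun x => hf.contDiffOn_score2 x j l) hθ i

lemma hasPartials_log {θ : Param m} (hθ : θ ∈ U) (x : ℝ) :
    HasPartials (fun t => Real.log (f t x)) (fun i => score f θ x i) θ :=
  hasPartials_pderiv hf.isOpen (by simp) (hf.contDiffOn_log x) hθ

lemma hasPartials_score {θ : Param m} (hθ : θ ∈ U) (x : ℝ) (i : Fin m) :
    HasPartials (fun t => score f t x i) (fun j => score2 f θ x j i) θ :=
  hasPartials_pderiv hf.isOpen (by simp) (hf.contDiffOn_score x i) hθ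

lemma hasPartials_score2 {θ : Param m} (hθ : θ ∈ U) (x : ℝ) (i j : Fin m) :
    HasPartials (fun t => score2 f t x i j) (fun l => score3 f θ x l i j) θ :=
  hasPartials_pderiv hf.isOpen (by simp) (hf.contDiffOn_score2 x i j) hθ

lemma score2_comm {θ : Param m} (hθ : θ ∈ U) (x : ℝ) (i j : Fin m) :
    score2 f θ x i j = score2 f θ x j i :=
  pderiv_pderiv_comm hf.isOpen ((hf.contDiffOn_log x).of_le (by norm_num)) hθ i j

end SmoothFamily

/-- `f_θ^α`. -/
noncomputable def powDensity (f : Param m → ℝ → ℝ) (α : ℝ) (θ : Param m) (x : ℝ) : ℝ :=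
  Real.exp (α * Real.log (f θ x))

/-- `f_θ^α u_i`; the derivative of `f_θ^α` is `α` times this. -/
noncomputable def powScore (f : Param m → ℝ → ℝ) (α : ℝ) (i : Fin m) (θ : Param m) (x : ℝ) : ℝ :=
  powDensity f α θ x * score f θ x i

/-- The `j`-th partial derivative of `f_θ^α u_i`. -/
noncomputable def powScore2 (f : Param m → ℝ → ℝ) (α : ℝ) (i j : Fin m) (θ : Param m) (x : ℝ) : ℝ :=
  powDensity f α θ x * (α * (score f θ x i * score f θ x j) + score2 f θ x j i)

/-- The polynomial in the scores for which `f_θ^α` times it is the second mixed partial derivative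
of `f_θ^α u_i`. -/
noncomputable def scorePoly3 (f : Param m → ℝ → ℝ) (α : ℝ) (i j l : Fin m) (θ : Param m)
    (x : ℝ) : ℝ :=
  α * score f θ x l * (α * (score f θ x i * score f θ x j) + score2 f θ x j i)
    + (α * (score f θ x i * score2 f θ x l j + score f θ x j * score2 f θ x l i)
      + score3 f θ x l j i)

/-- The `l`-th partial derivative of `powScore2`. -/
noncomputable def powScore3 (f : Param m → ℝ → ℝ) (α : ℝ) (i j l : Fin m) (θ : Param m)
    (x : ℝ) : ℝ :=
  powDensity f α θ x * scorePoly3 f α i j l θ x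

namespace SmoothFamily

variable {U : Set (Param m)} {f : Param m → ℝ → ℝ} (hf : SmoothFamily U f)
include hf

lemma powDensity_one {θ : Param m} (hθ : θ ∈ U) (x : ℝ) : powDensity f 1 θ x = f θ x := by
  simp [powDensity, Real.exp_log (hf.pos θ hθ x)]

lemma powDensity_half {θ : Param m} (hθ : θ ∈ U) (x : ℝ) :
    powDensity f (1 / 2) θ x = √(f θ x) := by
  rw [Real.sqrt_eq_rpow, Real.rpow_def_of_pos (hf.pos θ hθ x), powDensity, mul_comm]

lemma hasPartials_powDensity {θ : Param m} (hθ : θ ∈ U) (α x : ℝ) :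
    HasPartials (fun t => powDensity f α t x) (fun i => α * powScore f α i θ x) θ :=
  ((hf.hasPartials_log hθ x).const_mul α).exp.congr fun j => by
    simp only [powScore, powDensity]; ring

lemma hasPartials_powScore {θ : Param m} (hθ : θ ∈ U) (α x : ℝ) (i : Fin m) :
    HasPartials (fun t => powScore f α i t x) (fun j => powScore2 f α i j θ x) θ :=
  ((hf.hasPartials_powDensity hθ α x).mul (hf.hasPartials_score hθ x i)).congr fun j => by
    simp only [powScore, powScore2]; ring

lemma hasPartials_powScore2 {θ : Param m} (hθ : θ ∈ U) (α x : ℝ) (i j : Fin m) :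
    HasPartials (fun t => powScore2 f α i j t x) (fun l => powScore3 f α i j l θ x) θ :=
  ((hf.hasPartials_powDensity hθ α x).mul
    ((((hf.hasPartials_score hθ x i).mul (hf.hasPartials_score hθ x j)).const_mul α).add
      (hf.hasPartials_score2 hθ x j i))).congr fun l => by
    simp only [powScore, powScore3, scorePoly3]; ring

lemma continuousOn_powDensity (α x : ℝ) : ContinuousOn (fun t => powDensity f α t x) U :=
  Real.continuous_exp.comp_continuousOn ((hf.contDiffOn_log x).continuousOn.const_smul α)

lemma continuousOn_powScore (α x : ℝ) (i : Fin m) :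
    ContinuousOn (fun t => powScore f α i t x) U :=
  (hf.continuousOn_powDensity α x).mul (hf.contDiffOn_score x i).continuousOn

lemma continuousOn_powScore2 (α x : ℝ) (i j : Fin m) :
    ContinuousOn (fun t => powScore2 f α i j t x) U :=
  (hf.continuousOn_powDensity α x).mul
    ((((hf.contDiffOn_score x i).continuousOn.mul
      (hf.contDiffOn_score x j).continuousOn).const_smul α).add
        (hf.contDiffOn_score2 x j i).continuousOn)

lemma continuousOn_powScore3 (α x : ℝ) (i j l : Fin m) :
    ContinuousOn (fun t => powScore3 f α i j l t x) U := by
  have s := fun i => (hf.contDiffOn_score x i).continuousOn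
  have s2 := fun i j => (hf.contDiffOn_score2 x i j).continuousOn
  have s3 := (hf.contDiffOn_score3 x l j i).continuousOn
  have d := hf.continuousOn_powDensity α x
  unfold powScore3 scorePoly3
  exact d.mul (((continuousOn_const.mul (s l)).mul ((continuousOn_const.mul ((s i).mul (s j))).add
    (s2 j i))).add
      ((continuousOn_const.mul (((s i).mul (s2 l j)).add ((s j).mul (s2 l i)))).add s3))

lemma measurable_powDensity {θ : Param m} (hθ : θ ∈ U) (α : ℝ) :
    Measurable (powDensity f α θ) :=
  ((hf.measurable_log hθ).const_mul α).exp

lemma measurable_powScore {θ : Param m} (hθ : θ ∈ U) (α : ℝ) (i : Fin m) :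
    Measurable (powScore f α i θ) :=
  (hf.measurable_powDensity hθ α).mul (hf.measurable_score hθ i)

lemma measurable_powScore2 {θ : Param m} (hθ : θ ∈ U) (α : ℝ) (i j : Fin m) :
    Measurable (powScore2 f α i j θ) :=
  (hf.measurable_powDensity hθ α).mul
    ((((hf.measurable_score hθ i).mul (hf.measurable_score hθ j)).const_mul α).add
      (hf.measurable_score2 hθ j i))

lemma measurable_scorePoly3 {θ : Param m} (hθ : θ ∈ U) (α : ℝ) (i j l : Fin m) :
    Measurable (scorePoly3 f α i j l θ) := by
  have s := hf.measurable_score hθ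
  have s2 := hf.measurable_score2 hθ
  have s3 := hf.measurable_score3 hθ
  unfold scorePoly3
  fun_prop

lemma measurable_powScore3 {θ : Param m} (hθ : θ ∈ U) (α : ℝ) (i j l : Fin m) :
    Measurable (powScore3 f α i j l θ) :=
  (hf.measurable_powDensity hθ α).mul (hf.measurable_scorePoly3 hθ α i j l)

end SmoothFamily

end PMHDE

/-! ### Mean value and Taylor bounds under an integral -/

namespace PMHDE

variable {m : ℕ}

lemma enorm_coord_le (v : Param m) (j : Fin m) : ‖v j‖ₑ ≤ ‖v‖ₑ := by
  simpa [enorm_le_iff_norm_le] using PiLp.norm_apply_le v j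

lemma add_smul_mem_segment {θ θ' : Param m} {s : ℝ} (hs : s ∈ Set.Icc (0 : ℝ) 1) :
    θ + s • (θ' - θ) ∈ segment ℝ θ θ' := by
  rw [segment_eq_image']
  exact ⟨s, hs, rfl⟩

/-- A Carathéodory function is jointly measurable; this is what permits exchanging the integral
along a segment with the integral over x. -/
lemma measurable_uncurry_of_continuous {u : ℝ → ℝ → ℝ} (hc : ∀ x, Continuous fun s => u s x)
    (hm : ∀ s, Measurable (u s)) : Measurable (Function.uncurry fun x s => u s x) :=
  (stronglyMeasurable_uncurry_of_continuous_of_stronglyMeasurable hc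
    fun s => (hm s).stronglyMeasurable).measurable.comp measurable_swap

/-- The mean value inequality under a weighted integral. -/
lemma lintegral_increment_le {U : Set (Param m)} {F : Param m → ℝ → ℝ}
    {DF : Fin m → Param m → ℝ → ℝ} {θ θ' : Param m} (hseg : segment ℝ θ θ' ⊆ U)
    (hF : ∀ σ ∈ U, ∀ x, HasPartials (fun t => F t x) (fun j => DF j σ x) σ)
    (hc : ∀ j x, ContinuousOn (fun t => DF j t x) U)
    (hm : ∀ j, ∀ σ ∈ U, Measurable (DF j σ)) {w : ℝ → ℝ} (hw : Measurable w) {M : ℝ≥0∞}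
    (hb : ∀ j, ∀ σ ∈ segment ℝ θ θ', ∫⁻ x, ‖w x‖ₑ * ‖DF j σ x‖ₑ ≤ M) :
    ∫⁻ x, ‖w x‖ₑ * ‖F θ' x - F θ x‖ₑ ≤ m * M * ‖θ' - θ‖ₑ := by
  set v := θ' - θ with hv
  -- The parameter of the segment is clamped to [0, 1], so that the integrand is continuous and
  -- measurable on all of ℝ although the derivatives are controlled only on U.
  obtain ⟨cl, hcl_c, hcl_m, hcl_e⟩ : ∃ cl : ℝ → ℝ, Continuous cl ∧
      (∀ s, cl s ∈ Set.Icc (0 : ℝ) 1) ∧ ∀ s ∈ Set.Icc (0 : ℝ) 1, cl s = s :=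
    ⟨fun s => (Set.projIcc (0 : ℝ) 1 zero_le_one s : ℝ),
      continuous_subtype_val.comp continuous_projIcc,
      fun s => (Set.projIcc (0 : ℝ) 1 _ s).2, fun s hs => by simp [Set.projIcc_of_mem _ hs]⟩
  have hmem : ∀ s, θ + cl s • v ∈ segment ℝ θ θ' := fun s => add_smul_mem_segment (hcl_m s)
  have hcont : ∀ j x, Continuous fun s => DF j (θ + cl s • v) x := fun j x =>
    (hc j x).comp_continuous (by fun_prop) fun s => hseg (hmem s)
  have hjoint : ∀ j, Measurable (Function.uncurry fun (x s : ℝ) => DF j (θ + cl s • v) x) :=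
    fun j => measurable_uncurry_of_continuous (u := fun s x => DF j (θ + cl s • v) x) (hcont j)
      fun s => hm j _ (hseg (hmem s))
  -- Fundamental theorem of calculus along the segment, for fixed x. Exchanging integrals afterwards
  -- avoids any domination argument for differentiation under the integral sign.
  have hpt : ∀ x, ‖F θ' x - F θ x‖ₑ ≤
      ∫⁻ s in Set.Icc (0 : ℝ) 1, ∑ j, ‖v j‖ₑ * ‖DF j (θ + cl s • v) x‖ₑ := by
    intro x
    have h1 : ∫ s in (0 : ℝ)..1, ∑ j, v j * DF j (θ + cl s • v) x = F θ' x - F θ x := by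
      have := intervalIntegral.integral_eq_sub_of_hasDerivAt (a := 0) (b := 1)
        (f := fun s : ℝ => F (θ + s • v) x) (f' := fun s => ∑ j, v j * DF j (θ + cl s • v) x)
        (fun s hs => ?_) ?_
      · rw [this]; simp [hv]
      · rw [Set.uIcc_of_le zero_le_one] at hs
        have := (hF _ (hseg (hmem s)) x)
        rw [hcl_e s hs] at this ⊢
        exact this.hasDerivAt_line
      · exact (continuous_finsetSum _ fun j _ => (hcont j x).const_mul _).intervalIntegrable _ _
    rw [← h1, intervalIntegral.integral_of_le zero_le_one, ← integral_Icc_eq_integral_Ioc]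
    refine (enorm_integral_le_lintegral_enorm _).trans (lintegral_mono fun s => ?_)
    refine (enorm_sum_le _ _).trans (Finset.sum_le_sum fun j _ => ?_)
    rw [enorm_mul]
  calc ∫⁻ x, ‖w x‖ₑ * ‖F θ' x - F θ x‖ₑ
      ≤ ∫⁻ x, ∫⁻ s in Set.Icc (0 : ℝ) 1,
          ∑ j, ‖v j‖ₑ * (‖w x‖ₑ * ‖DF j (θ + cl s • v) x‖ₑ) := by
        refine lintegral_mono fun x => ?_
        refine (mul_le_mul_right (hpt x) _).trans (le_of_eq ?_)
        rw [← lintegral_const_mul']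
        · simp_rw [Finset.mul_sum]
          refine lintegral_congr fun s => Finset.sum_congr rfl fun j _ => by ring
        · simp
    _ = ∫⁻ s in Set.Icc (0 : ℝ) 1, ∫⁻ x,
          ∑ j, ‖v j‖ₑ * (‖w x‖ₑ * ‖DF j (θ + cl s • v) x‖ₑ) := by
        refine lintegral_lintegral_swap (Measurable.aemeasurable ?_)
        refine Finset.measurable_sum _ fun j _ => ?_
        exact ((hw.comp measurable_fst).enorm.mul (hjoint j).enorm).const_mul _
    _ ≤ ∫⁻ _ in Set.Icc (0 : ℝ) 1, m * M * ‖v‖ₑ := by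
        refine lintegral_mono fun s => ?_
        have hmj : ∀ j, Measurable fun x => ‖w x‖ₑ * ‖DF j (θ + cl s • v) x‖ₑ := fun j =>
          hw.enorm.mul (hm j _ (hseg (hmem s))).enorm
        rw [lintegral_finsetSum _ fun j _ => (hmj j).const_mul _]
        calc ∑ j, ∫⁻ x, ‖v j‖ₑ * (‖w x‖ₑ * ‖DF j (θ + cl s • v) x‖ₑ)
            ≤ ∑ _j : Fin m, ‖v‖ₑ * M := by
              refine Finset.sum_le_sum fun j _ => ?_
              rw [lintegral_const_mul _ (hmj j)]
              exact mul_le_mul' (enorm_coord_le v j) (hb j _ (hmem s))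
          _ = m * M * ‖v‖ₑ := by simp; ring
    _ = _ := by simp

/-- First-order Taylor expansion under a weighted integral. -/
lemma lintegral_taylor_le {U : Set (Param m)} {F : Param m → ℝ → ℝ}
    {DF : Fin m → Param m → ℝ → ℝ} {D2F : Fin m → Fin m → Param m → ℝ → ℝ}
    {θ θ' : Param m} (hseg : segment ℝ θ θ' ⊆ U)
    (hF : ∀ σ ∈ U, ∀ x, HasPartials (fun t => F t x) (fun j => DF j σ x) σ)
    (hDF : ∀ j, ∀ σ ∈ U, ∀ x, HasPartials (fun t => DF j t x) (fun l => D2F j l σ x) σ)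
    (hc1 : ∀ j x, ContinuousOn (fun t => DF j t x) U)
    (hm1 : ∀ j, ∀ σ ∈ U, Measurable (DF j σ))
    (hc : ∀ j l x, ContinuousOn (fun t => D2F j l t x) U)
    (hm : ∀ j l, ∀ σ ∈ U, Measurable (D2F j l σ)) {w : ℝ → ℝ} (hw : Measurable w) {M : ℝ≥0∞}
    (hb : ∀ j l, ∀ σ ∈ segment ℝ θ θ', ∫⁻ x, ‖w x‖ₑ * ‖D2F j l σ x‖ₑ ≤ M) :
    ∫⁻ x, ‖w x‖ₑ * ‖F θ' x - F θ x - ∑ j, DF j θ x * (θ' j - θ j)‖ₑ ≤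
      m * (m * M * ‖θ' - θ‖ₑ) * ‖θ' - θ‖ₑ := by
  have hθ : θ ∈ U := hseg (left_mem_segment ℝ θ θ')
  -- The mean value bound is applied to F minus its linearization at θ. The partial derivatives of
  -- this difference are increments of those of F, to which the mean value bound applies again.
  have := lintegral_increment_le (F := fun t x => F t x + ∑ j, (-DF j θ x) * (t j - θ j))
    (DF := fun j t x => DF j t x + (-DF j θ x)) hseg (fun σ hσ x =>
      (hF σ hσ x).add (hasPartials_affine _ _ _))
    (fun j x => (hc1 j x).add continuousOn_const) (fun j σ hσ => (hm1 j σ hσ).add (hm1 j θ hθ).neg)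
    hw (M := m * M * ‖θ' - θ‖ₑ) ?_
  · refine le_trans (le_of_eq (lintegral_congr fun x => ?_)) this
    congr 2
    simp only [sub_self, mul_zero, Finset.sum_const_zero, add_zero, neg_mul,
      Finset.sum_neg_distrib]
    ring
  · intro j σ hσ
    have hsub : segment ℝ θ σ ⊆ segment ℝ θ θ' :=
      (convex_segment θ θ').segment_subset (left_mem_segment ℝ θ θ') hσ
    have h1 := lintegral_increment_le (F := DF j) (DF := D2F j) (hsub.trans hseg) (hDF j)
      (hc j) (hm j) hw fun l τ hτ => hb j l τ (hsub hτ)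
    simp only [← sub_eq_add_neg]
    refine h1.trans ?_
    gcongr
    obtain ⟨s, hs, rfl⟩ := (segment_eq_image' ℝ θ θ') ▸ hσ
    simp only [add_sub_cancel_left, enorm_smul]
    calc ‖s‖ₑ * ‖θ' - θ‖ₑ ≤ 1 * ‖θ' - θ‖ₑ := by
          gcongr
          rw [← enorm_one (G := ℝ), enorm_le_iff_norm_le, Real.norm_of_nonneg hs.1]
          simpa using hs.2
      _ = _ := one_mul _

lemma abs_integral_le_of_lintegral {h : ℝ → ℝ} {M : ℝ} (hM : 0 ≤ M)
    (hh : ∫⁻ x, ‖h x‖ₑ ≤ ENNReal.ofReal M) : |∫ x, h x| ≤ M := by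
  have := (enorm_integral_le_lintegral_enorm h).trans hh
  rwa [← ofReal_norm, ENNReal.ofReal_le_ofReal_iff hM] at this

section Real

variable {Θ U : Set (Param m)} {F : Param m → ℝ → ℝ}
    {DF : Fin m → Param m → ℝ → ℝ} {D2F : Fin m → Fin m → Param m → ℝ → ℝ}

lemma abs_integral_increment_le (hΘ : Convex ℝ Θ) (hΘU : Θ ⊆ U)
    (hF : ∀ σ ∈ U, ∀ x, HasPartials (fun t => F t x) (fun j => DF j σ x) σ)
    (hc : ∀ j x, ContinuousOn (fun t => DF j t x) U)
    (hm : ∀ j, ∀ σ ∈ U, Measurable (DF j σ)) {w : ℝ → ℝ} (hw : Measurable w)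
    (hi : ∀ σ ∈ Θ, Integrable fun x => w x * F σ x) {M : ℝ} (hM : 0 ≤ M)
    (hb : ∀ j, ∀ σ ∈ Θ, ∫⁻ x, ‖w x‖ₑ * ‖DF j σ x‖ₑ ≤ ENNReal.ofReal M)
    {θ θ' : Param m} (hθ : θ ∈ Θ) (hθ' : θ' ∈ Θ) :
    |(∫ x, w x * F θ' x) - ∫ x, w x * F θ x| ≤ m * M * ‖θ' - θ‖ := by
  have hsub : segment ℝ θ θ' ⊆ Θ := hΘ.segment_subset hθ hθ'
  have := lintegral_increment_le (hsub.trans hΘU) hF hc hm hw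
    fun j σ hσ => hb j σ (hsub hσ)
  rw [← integral_sub (hi θ' hθ') (hi θ hθ)]
  refine abs_integral_le_of_lintegral (by positivity) ?_
  simp_rw [← mul_sub, enorm_mul]
  refine this.trans (le_of_eq ?_)
  rw [← ofReal_norm, ENNReal.ofReal_mul (by positivity),
    ENNReal.ofReal_mul (by positivity), ENNReal.ofReal_natCast]

lemma abs_integral_taylor_le (hΘ : Convex ℝ Θ) (hΘU : Θ ⊆ U)
    (hF : ∀ σ ∈ U, ∀ x, HasPartials (fun t => F t x) (fun j => DF j σ x) σ)
    (hDF : ∀ j, ∀ σ ∈ U, ∀ x, HasPartials (fun t => DF j t x) (fun l => D2F j l σ x) σ)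
    (hc1 : ∀ j x, ContinuousOn (fun t => DF j t x) U)
    (hm1 : ∀ j, ∀ σ ∈ U, Measurable (DF j σ))
    (hc : ∀ j l x, ContinuousOn (fun t => D2F j l t x) U)
    (hm : ∀ j l, ∀ σ ∈ U, Measurable (D2F j l σ)) {w : ℝ → ℝ} (hw : Measurable w)
    (hi : ∀ σ ∈ Θ, Integrable fun x => w x * F σ x)
    (hi1 : ∀ j, ∀ σ ∈ Θ, Integrable fun x => w x * DF j σ x) {M : ℝ} (hM : 0 ≤ M)
    (hb : ∀ j l, ∀ σ ∈ Θ, ∫⁻ x, ‖w x‖ₑ * ‖D2F j l σ x‖ₑ ≤ ENNReal.ofReal M)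
    {θ θ' : Param m} (hθ : θ ∈ Θ) (hθ' : θ' ∈ Θ) :
    |(∫ x, w x * F θ' x) - (∫ x, w x * F θ x) - ∑ j, (∫ x, w x * DF j θ x) * (θ' j - θ j)| ≤
      m * m * M * ‖θ' - θ‖ ^ 2 := by
  have hsub : segment ℝ θ θ' ⊆ Θ := hΘ.segment_subset hθ hθ'
  have := lintegral_taylor_le (hsub.trans hΘU) hF hDF hc1 hm1 hc hm hw
    fun j l σ hσ => hb j l σ (hsub hσ)
  have e : (∫ x, w x * F θ' x) - (∫ x, w x * F θ x)
      - ∑ j, (∫ x, w x * DF j θ x) * (θ' j - θ j) =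
      ∫ x, w x * (F θ' x - F θ x - ∑ j, DF j θ x * (θ' j - θ j)) := by
    simp_rw [← integral_mul_const]
    rw [← integral_finsetSum _ fun j _ => (hi1 j θ hθ).mul_const _,
      ← integral_sub (hi θ' hθ') (hi θ hθ),
      ← integral_sub (f := fun x => w x * F θ' x - w x * F θ x) ((hi θ' hθ').sub (hi θ hθ))
        (integrable_finsetSum _ fun j _ => (hi1 j θ hθ).mul_const _)]
    refine integral_congr_ae (ae_of_all _ fun x => ?_)
    simp only [mul_sub, Finset.mul_sum, mul_assoc]
  rw [e]
  refine abs_integral_le_of_lintegral (by positivity) ?_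
  simp_rw [enorm_mul]
  refine this.trans (le_of_eq ?_)
  rw [← ofReal_norm, ENNReal.ofReal_mul (by positivity),
    ENNReal.ofReal_mul (by positivity), ENNReal.ofReal_mul (by positivity),
    ENNReal.ofReal_natCast, ENNReal.ofReal_pow (norm_nonneg _)]
  ring

end Real

end PMHDE

/-! ### Uniform moment bounds for the family -/

namespace PMHDE

variable {m : ℕ} {Θ U : Set (Param m)} {f : Param m → ℝ → ℝ}

/-- The norm of `P` in `L²(f_θ dx)`. -/
noncomputable def momentNorm (f : Param m → ℝ → ℝ) (θ : Param m) (P : ℝ → ℝ) : ℝ≥0∞ :=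
  eLpNorm (fun x => powDensity f (1 / 2) θ x * P x) 2 volume

lemma eLpNorm_two_le_of_sq_le {h H : ℝ → ℝ} (hH : Integrable H) {C : ℝ} (hC : ∫ x, H x ≤ C)
    (hle : ∀ x, h x ^ 2 ≤ H x) : eLpNorm h 2 volume ≤ ENNReal.ofReal √C := by
  have h0 : ∀ x, 0 ≤ H x := fun x => (sq_nonneg _).trans (hle x)
  rw [eLpNorm_eq_lintegral_rpow_enorm_toReal two_ne_zero ENNReal.ofNat_ne_top,
    Real.sqrt_eq_rpow, ← ENNReal.ofReal_rpow_of_nonneg ((integral_nonneg h0).trans hC)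
      (by norm_num)]
  simp only [ENNReal.toReal_ofNat]
  gcongr
  refine le_trans (lintegral_mono fun x => ?_)
    ((ofReal_integral_eq_lintegral_ofReal hH (ae_of_all _ h0)).symm.le.trans
      (ENNReal.ofReal_le_ofReal hC))
  rw [← ofReal_norm, ENNReal.ofReal_rpow_of_nonneg (norm_nonneg _) (by norm_num)]
  refine ENNReal.ofReal_le_ofReal ?_
  simpa using hle x

namespace SmoothFamily

variable (hs : SmoothFamily U f)
include hs

lemma sq_powDensity_half {θ : Param m} (hθ : θ ∈ U) (x : ℝ) :
    powDensity f (1 / 2) θ x ^ 2 = f θ x := by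
  rw [hs.powDensity_half hθ, Real.sq_sqrt (hs.pos θ hθ x).le]

lemma momentNorm_le {θ : Param m} (hθ : θ ∈ U) {P H : ℝ → ℝ} {C : ℝ}
    (hH : Integrable fun x => H x * f θ x) (hC : ∫ x, H x * f θ x ≤ C)
    (hle : ∀ x, P x ^ 2 ≤ H x) : momentNorm f θ P ≤ ENNReal.ofReal √C := by
  refine eLpNorm_two_le_of_sq_le hH hC fun x => ?_
  rw [mul_pow, hs.sq_powDensity_half hθ, mul_comm]
  exact mul_le_mul_of_nonneg_right (hle x) (hs.pos θ hθ x).le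

lemma momentNorm_add_le {θ : Param m} (hθ : θ ∈ U) {P Q : ℝ → ℝ} (hP : Measurable P)
    (hQ : Measurable Q) :
    momentNorm f θ (fun x => P x + Q x) ≤ momentNorm f θ P + momentNorm f θ Q := by
  have hd := hs.measurable_powDensity hθ (1 / 2)
  refine le_trans (le_of_eq ?_) (eLpNorm_add_le (hd.mul hP).aestronglyMeasurable
    (hd.mul hQ).aestronglyMeasurable one_le_two)
  unfold momentNorm
  congr 1
  ext x
  simp [mul_add]

omit hs in
lemma momentNorm_const_mul_le {θ : Param m} {P : ℝ → ℝ} {a : ℝ} (ha0 : 0 ≤ a) (ha : a ≤ 1) :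
    momentNorm f θ (fun x => a * P x) ≤ momentNorm f θ P := by
  refine eLpNorm_mono fun x => ?_
  simp only [norm_mul, Real.norm_of_nonneg ha0]
  nlinarith [mul_nonneg (norm_nonneg (powDensity f (1 / 2) θ x)) (norm_nonneg (P x))]

/-- Cauchy-Schwarz for a weighted moment. -/
lemma lintegral_weight_mul_le {θ : Param m} (hθ : θ ∈ U) {w : ℝ → ℝ} (hw : Measurable w)
    {α W C : ℝ} (hW : 0 ≤ W)
    (hwW : eLpNorm (fun x => w x * powDensity f (α - 1 / 2) θ x) 2 volume ≤ ENNReal.ofReal W)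
    {P : ℝ → ℝ} (hP : Measurable P) (hC : momentNorm f θ P ≤ ENNReal.ofReal C) :
    ∫⁻ x, ‖w x‖ₑ * ‖powDensity f α θ x * P x‖ₑ ≤ ENNReal.ofReal (W * C) := by
  have h1 := eLpNorm_smul_le_mul_eLpNorm (p := 2) (q := 2) (r := 1) (μ := volume)
    (φ := fun x => w x * powDensity f (α - 1 / 2) θ x)
    (f := fun x => powDensity f (1 / 2) θ x * P x)
    ((hs.measurable_powDensity hθ _).mul hP).aestronglyMeasurable
    (hw.mul (hs.measurable_powDensity hθ _)).aestronglyMeasurable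
  rw [eLpNorm_one_eq_lintegral_enorm] at h1
  rw [ENNReal.ofReal_mul hW]
  refine le_trans (le_of_eq (lintegral_congr fun x => ?_)) (h1.trans (mul_le_mul' hwW hC))
  rw [← enorm_mul]
  congr 1
  have : powDensity f α θ x = powDensity f (α - 1 / 2) θ x * powDensity f (1 / 2) θ x := by
    simp only [powDensity]
    rw [← Real.exp_add]
    congr 1; ring
  simp only [Pi.smul_apply', smul_eq_mul]
  rw [this]; ring

end SmoothFamily

lemma FamilyAssumptions.exists_smooth (hf : FamilyAssumptions Θ f) :
    ∃ U, SmoothFamily U f ∧ Θ ⊆ U := by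
  obtain ⟨U, hU, hΘU, h1, h2⟩ := hf.smooth
  exact ⟨U, ⟨hU, fun θ h => (h1 θ h).1, fun θ h => (h1 θ h).2, h2⟩, hΘU⟩

lemma HasContMoment.exists_le {h : Param m → ℝ → ℝ} (hh : HasContMoment Θ f h)
    (hΘ : IsCompact Θ) : ∃ C, ∀ θ ∈ Θ, ∫ x, h θ x * f θ x ≤ C := by
  obtain ⟨C, hC⟩ := (hΘ.image_of_continuousOn hh.2).bddAbove
  exact ⟨C, fun θ hθ => hC ⟨θ, hθ, rfl⟩⟩

/-- AM-GM for the three squares. Through it, products of three scores are controlled in L² by sixth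
moments of single scores. -/
lemma sq_mul_mul_le (a b c : ℝ) :
    (a * (b * c)) ^ 2 ≤ |a| ^ 6 + |b| ^ 6 + |c| ^ 6 := by
  have e : ∀ t : ℝ, |t| ^ 6 = (t ^ 2) ^ 3 := fun t => by
    rw [← sq_abs t]; ring
  rw [e, e, e, mul_pow, mul_pow]
  have ha := sq_nonneg a
  have hb := sq_nonneg b
  have hc := sq_nonneg c
  generalize a ^ 2 = x at *
  generalize b ^ 2 = y at *
  generalize c ^ 2 = z at *
  have h3 : 3 * (x * (y * z)) ≤ x ^ 3 + y ^ 3 + z ^ 3 := by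
    nlinarith [mul_nonneg (add_nonneg (add_nonneg ha hb) hc)
      (add_nonneg (add_nonneg (sq_nonneg (x - y)) (sq_nonneg (y - z))) (sq_nonneg (z - x)))]
  have : 0 ≤ x * (y * z) := by positivity
  linarith

/-- Successive derivatives of f^α u_i are f^α times polynomials in the scores, with at most five
terms and coefficients 1, α or α². For α in [0, 1] the triangle inequality in L²(f_θ) leaves only
the assumed moments, which are bounded on Θ, by compactness when they are continuous. -/
lemma FamilyAssumptions.exists_momentNorm_le (hf : FamilyAssumptions Θ f)
    (hs : SmoothFamily U f) (hΘU : Θ ⊆ U) :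
    ∃ C : ℝ, 0 < C ∧ ∀ θ ∈ Θ,
      momentNorm f θ (fun _ => 1) ≤ ENNReal.ofReal C ∧
      (∀ i, momentNorm f θ (fun x => score f θ x i) ≤ ENNReal.ofReal C) ∧
      (∀ α, 0 ≤ α → α ≤ 1 → ∀ i j, momentNorm f θ
        (fun x => α * (score f θ x i * score f θ x j) + score2 f θ x j i) ≤ ENNReal.ofReal C) ∧
      ∀ α, 0 ≤ α → α ≤ 1 → ∀ i j l, momentNorm f θ (scorePoly3 f α i j l θ)
        ≤ ENNReal.ofReal C := by
  obtain ⟨C1, h1⟩ := hf.l2_score.exists_le hf.compact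
  obtain ⟨C2, h2⟩ := hf.l2_outer.exists_le hf.compact
  obtain ⟨C3, h3⟩ := hf.higher_moments
  have h6 : ∀ i : Fin m, ∃ C, ∀ θ ∈ Θ, Integrable (fun x => |score f θ x i| ^ 6 * f θ x) ∧
      ∫ x, |score f θ x i| ^ 6 * f θ x ≤ C := by
    intro i
    have hk := hf.score_moments (Pi.single i 6) (by simp)
    have e : (fun (θ : Param m) (x : ℝ) => ∏ j, |score f θ x j| ^ (Pi.single i 6 : Fin m → ℕ) j)
        = fun θ x => |score f θ x i| ^ 6 := by
      ext θ x
      rw [Fintype.prod_eq_single i]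
      · simp
      · intro j hj; simp [hj]
    rw [e] at hk
    obtain ⟨C, hC⟩ := hk.exists_le hf.compact
    exact ⟨C, fun θ hθ => ⟨hk.1 θ hθ, hC θ hθ⟩⟩
  choose C6 h6 using h6
  -- The summand 1 covers the total mass, and the factor 3 the three sixth moments from
  -- `sq_mul_mul_le`.
  set B : ℝ := 1 + |C1| + |C2| + |C3| + 3 * ∑ i, |C6 i| with hB
  have hsum : ∀ i, |C6 i| ≤ ∑ i, |C6 i| := fun i =>
    Finset.single_le_sum (f := fun i => |C6 i|) (fun _ _ => abs_nonneg _) (Finset.mem_univ i)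
  have hsum0 : 0 ≤ ∑ i, |C6 i| := Finset.sum_nonneg fun _ _ => abs_nonneg _
  have a1 := abs_nonneg C1
  have a2 := abs_nonneg C2
  have a3 := abs_nonneg C3
  have b1 := le_abs_self C1
  have b2 := le_abs_self C2
  have b3 := le_abs_self C3
  have hB1 : 1 ≤ B := by linarith
  have hR : 1 ≤ √B := by simpa using Real.sqrt_le_sqrt hB1
  refine ⟨6 * √B, by positivity, fun θ hθ => ?_⟩
  have hθU := hΘU hθ
  have s := hs.measurable_score hθU
  have s2 := hs.measurable_score2 hθU
  have s3 := hs.measurable_score3 hθU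
  have n0 : momentNorm f θ (fun _ => 1) ≤ ENNReal.ofReal √B := by
    have hi : Integrable (f θ) := by
      by_contra h
      have := (hf.density θ hθ).integral_eq_one
      rw [integral_undef h] at this
      exact zero_ne_one this
    refine hs.momentNorm_le hθU (H := fun _ => 1) (by simpa using hi) ?_ (by simp)
    simpa [(hf.density θ hθ).integral_eq_one] using hB1
  have n1 : ∀ i, momentNorm f θ (fun x => score f θ x i) ≤ ENNReal.ofReal √B := fun i =>
    hs.momentNorm_le hθU (hf.l2_score.1 θ hθ) ((h1 θ hθ).trans (by linarith)) fun x =>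
      Finset.single_le_sum (f := fun i => score f θ x i ^ 2) (fun _ _ => sq_nonneg _)
        (Finset.mem_univ i)
  have n2 : ∀ i j, momentNorm f θ (fun x => score f θ x i * score f θ x j) ≤
      ENNReal.ofReal √B := fun i j =>
    hs.momentNorm_le hθU (hf.l2_outer.1 θ hθ) ((h2 θ hθ).trans (by linarith)) fun x =>
      (Finset.single_le_sum (f := fun j => (score f θ x i * score f θ x j) ^ 2)
        (fun _ _ => sq_nonneg _) (Finset.mem_univ j)).trans
      (Finset.single_le_sum (f := fun i => ∑ j, (score f θ x i * score f θ x j) ^ 2)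
        (fun _ _ => Finset.sum_nonneg fun _ _ => sq_nonneg _) (Finset.mem_univ i))
  have n3 : ∀ i j, momentNorm f θ (fun x => score2 f θ x i j) ≤ ENNReal.ofReal √B := fun i j =>
    hs.momentNorm_le hθU (h3 θ hθ i j i).1.1 ((h3 θ hθ i j i).1.2.trans (by linarith))
      fun x => le_rfl
  have n4 : ∀ i j l, momentNorm f θ (fun x => score3 f θ x i j l) ≤ ENNReal.ofReal √B :=
    fun i j l => hs.momentNorm_le hθU (h3 θ hθ i j l).2.1.1
      ((h3 θ hθ i j l).2.1.2.trans (by linarith)) fun x => le_rfl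
  have n5 : ∀ i j l, momentNorm f θ (fun x => score f θ x l * score2 f θ x i j) ≤
      ENNReal.ofReal √B :=
    fun i j l => hs.momentNorm_le hθU (h3 θ hθ i j l).2.2.1
      ((h3 θ hθ i j l).2.2.2.trans (by linarith)) fun x => by rw [mul_comm]
  have n6 : ∀ i j l, momentNorm f θ
      (fun x => score f θ x l * (score f θ x i * score f θ x j)) ≤ ENNReal.ofReal √B := by
    intro i j l
    have hint := ((h6 l θ hθ).1.add (h6 i θ hθ).1).add (h6 j θ hθ).1
    refine hs.momentNorm_le hθU (H := fun x => |score f θ x l| ^ 6 + |score f θ x i| ^ 6 +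
      |score f θ x j| ^ 6) ?_ ?_ fun x => sq_mul_mul_le _ _ _
    · refine hint.congr (ae_of_all _ fun x => ?_)
      simp only [Pi.add_apply]; ring
    · have e : ∫ x, (|score f θ x l| ^ 6 + |score f θ x i| ^ 6 + |score f θ x j| ^ 6) * f θ x =
          (∫ x, |score f θ x l| ^ 6 * f θ x) + (∫ x, |score f θ x i| ^ 6 * f θ x)
            + ∫ x, |score f θ x j| ^ 6 * f θ x := by
        rw [← integral_add (h6 l θ hθ).1 (h6 i θ hθ).1,
          ← integral_add (f := fun x => |score f θ x l| ^ 6 * f θ x + |score f θ x i| ^ 6 * f θ x)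
            ((h6 l θ hθ).1.add (h6 i θ hθ).1) (h6 j θ hθ).1]
        refine integral_congr_ae (ae_of_all _ fun x => ?_)
        simp only; ring
      rw [e]
      have := (h6 l θ hθ).2
      have := (h6 i θ hθ).2
      have := (h6 j θ hθ).2
      have := hsum l
      have := hsum i
      have := hsum j
      have := le_abs_self (C6 i)
      have := le_abs_self (C6 j)
      have := le_abs_self (C6 l)
      linarith
  have add : ∀ {P Q : ℝ → ℝ} {a b : ℝ}, Measurable P → Measurable Q → 0 ≤ a → 0 ≤ b →
      momentNorm f θ P ≤ ENNReal.ofReal a → momentNorm f θ Q ≤ ENNReal.ofReal b →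
      momentNorm f θ (fun x => P x + Q x) ≤ ENNReal.ofReal (a + b) := by
    intro P Q a b hP hQ ha hb h1 h2
    rw [ENNReal.ofReal_add ha hb]
    exact (hs.momentNorm_add_le hθU hP hQ).trans (add_le_add h1 h2)
  have up : ∀ {x : ℝ≥0∞} {k : ℝ}, k ≤ 6 → x ≤ ENNReal.ofReal (k * √B) →
      x ≤ ENNReal.ofReal (6 * √B) := fun hk hx => hx.trans (ENNReal.ofReal_le_ofReal (by gcongr))
  have hB0 := Real.sqrt_nonneg B
  refine ⟨up (k := 1) (by norm_num) (by simpa using n0),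
    fun i => up (k := 1) (by norm_num) (by simpa using n1 i), fun α h0 h1 i j => ?_,
    fun α h0 h1 i j l => ?_⟩
  · refine up (k := 2) (by norm_num) ?_
    rw [two_mul]
    exact add (((s i).mul (s j)).const_mul α) (s2 j i) hB0 hB0
      ((SmoothFamily.momentNorm_const_mul_le h0 h1).trans (n2 i j)) (n3 j i)
  · refine up (k := 5) (by norm_num) ?_
    -- Five summands, each of norm at most √B.
    have e : scorePoly3 f α i j l θ = fun x =>
        (α * (α * (score f θ x l * (score f θ x i * score f θ x j)))
          + α * (score f θ x l * score2 f θ x j i))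
        + ((α * (score f θ x i * score2 f θ x l j) + α * (score f θ x j * score2 f θ x l i))
          + score3 f θ x l j i) := by
      ext x
      simp only [scorePoly3]; ring
    rw [e, show 5 * √B = (√B + √B) + ((√B + √B) + √B) by ring]
    have ms := fun i j l => ((s l).mul (s2 i j)).const_mul α
    have m3 := ((((s l).mul ((s i).mul (s j))).const_mul α).const_mul α)
    refine add (m3.add (ms j i l)) (((ms l j i).add (ms l i j)).add (s3 l j i)) (by positivity)
      (by positivity) (add m3 (ms j i l) hB0 hB0 ?_ ?_)
      (add ((ms l j i).add (ms l i j)) (s3 l j i) (by positivity) hB0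
        (add (ms l j i) (ms l i j) hB0 hB0 ?_ ?_) (n4 l j i))
    · exact (SmoothFamily.momentNorm_const_mul_le h0 h1).trans
        ((SmoothFamily.momentNorm_const_mul_le h0 h1).trans (n6 i j l))
    · exact (SmoothFamily.momentNorm_const_mul_le h0 h1).trans (n5 j i l)
    · exact (SmoothFamily.momentNorm_const_mul_le h0 h1).trans (n5 l j i)
    · exact (SmoothFamily.momentNorm_const_mul_le h0 h1).trans (n5 l i j)

/-- A measurable weight `w` for which `w f_θ^{α - 1/2}` is bounded by `W` in `L²` on `Θ`. -/
structure WeightBound (Θ : Set (Param m)) (f : Param m → ℝ → ℝ) (α W : ℝ) (w : ℝ → ℝ) : Prop where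
  measurable : Measurable w
  nonneg : 0 ≤ W
  le : ∀ θ ∈ Θ, eLpNorm (fun x => w x * powDensity f (α - 1 / 2) θ x) 2 volume ≤ ENNReal.ofReal W

/-- A uniform bound for the moments of the family, in the form in which it is used. -/
structure MomentBound (Θ U : Set (Param m)) (f : Param m → ℝ → ℝ) (C : ℝ) : Prop where
  smooth : SmoothFamily U f
  subset : Θ ⊆ U
  convex : Convex ℝ Θ
  pos : 0 < C
  one_le : ∀ θ ∈ Θ, momentNorm f θ (fun _ => 1) ≤ ENNReal.ofReal C
  score_le : ∀ θ ∈ Θ, ∀ i, momentNorm f θ (fun x => score f θ x i) ≤ ENNReal.ofReal C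
  score2_le : ∀ θ ∈ Θ, ∀ α, 0 ≤ α → α ≤ 1 → ∀ i j, momentNorm f θ
    (fun x => α * (score f θ x i * score f θ x j) + score2 f θ x j i) ≤ ENNReal.ofReal C
  score3_le : ∀ θ ∈ Θ, ∀ α, 0 ≤ α → α ≤ 1 → ∀ i j l,
    momentNorm f θ (scorePoly3 f α i j l θ) ≤ ENNReal.ofReal C

lemma FamilyAssumptions.exists_momentBound (hf : FamilyAssumptions Θ f) :
    ∃ U C, MomentBound Θ U f C := by
  obtain ⟨U, hs, hΘU⟩ := hf.exists_smooth
  obtain ⟨C, hC, h⟩ := hf.exists_momentNorm_le hs hΘU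
  exact ⟨U, C, hs, hΘU, hf.convex, hC, fun θ hθ => (h θ hθ).1, fun θ hθ => (h θ hθ).2.1,
    fun θ hθ => (h θ hθ).2.2.1, fun θ hθ => (h θ hθ).2.2.2⟩

namespace MomentBound

variable {C : ℝ} (hB : MomentBound Θ U f C) {α W : ℝ} {w : ℝ → ℝ} (hw : WeightBound Θ f α W w)
include hB hw

lemma lintegral_powDensity_le {θ : Param m} (hθ : θ ∈ Θ) :
    ∫⁻ x, ‖w x‖ₑ * ‖powDensity f α θ x‖ₑ ≤ ENNReal.ofReal (W * C) := by
  simpa using hB.smooth.lintegral_weight_mul_le (hB.subset hθ) hw.measurable hw.nonneg (hw.le θ hθ)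
    measurable_const (hB.one_le θ hθ)

lemma lintegral_powScore_le {θ : Param m} (hθ : θ ∈ Θ) (i : Fin m) :
    ∫⁻ x, ‖w x‖ₑ * ‖powScore f α i θ x‖ₑ ≤ ENNReal.ofReal (W * C) :=
  hB.smooth.lintegral_weight_mul_le (hB.subset hθ) hw.measurable hw.nonneg (hw.le θ hθ)
    (hB.smooth.measurable_score (hB.subset hθ) i) (hB.score_le θ hθ i)

variable (h0 : 0 ≤ α) (h1 : α ≤ 1)

include h0 h1 in
lemma lintegral_powScore2_le {θ : Param m} (hθ : θ ∈ Θ) (i j : Fin m) :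
    ∫⁻ x, ‖w x‖ₑ * ‖powScore2 f α i j θ x‖ₑ ≤ ENNReal.ofReal (W * C) := by
  have s := hB.smooth.measurable_score (hB.subset hθ)
  exact hB.smooth.lintegral_weight_mul_le (hB.subset hθ) hw.measurable hw.nonneg (hw.le θ hθ)
    ((((s i).mul (s j)).const_mul α).add (hB.smooth.measurable_score2 (hB.subset hθ) j i))
    (hB.score2_le θ hθ α h0 h1 i j)

include h0 h1 in
lemma lintegral_powScore3_le {θ : Param m} (hθ : θ ∈ Θ) (i j l : Fin m) :
    ∫⁻ x, ‖w x‖ₑ * ‖powScore3 f α i j l θ x‖ₑ ≤ ENNReal.ofReal (W * C) :=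
  hB.smooth.lintegral_weight_mul_le (hB.subset hθ) hw.measurable hw.nonneg (hw.le θ hθ)
    (hB.smooth.measurable_scorePoly3 (hB.subset hθ) α i j l) (hB.score3_le θ hθ α h0 h1 i j l)

omit hB hw in
lemma integrable_of_lintegral_mul_le {w P : ℝ → ℝ} (hw : Measurable w) (hP : Measurable P)
    {M : ℝ} (h : ∫⁻ x, ‖w x‖ₑ * ‖P x‖ₑ ≤ ENNReal.ofReal M) :
    Integrable fun x => w x * P x := by
  refine ⟨(hw.mul hP).aestronglyMeasurable, ?_⟩
  rw [hasFiniteIntegral_iff_enorm]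
  simp_rw [enorm_mul]
  exact h.trans_lt ENNReal.ofReal_lt_top

lemma integrable_powDensity {θ : Param m} (hθ : θ ∈ Θ) :
    Integrable fun x => w x * powDensity f α θ x :=
  integrable_of_lintegral_mul_le hw.measurable
    (hB.smooth.measurable_powDensity (hB.subset hθ) α) (hB.lintegral_powDensity_le hw hθ)

lemma integrable_powScore {θ : Param m} (hθ : θ ∈ Θ) (i : Fin m) :
    Integrable fun x => w x * powScore f α i θ x :=
  integrable_of_lintegral_mul_le hw.measurable
    (hB.smooth.measurable_powScore (hB.subset hθ) α i) (hB.lintegral_powScore_le hw hθ i)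

include h0 h1 in
lemma integrable_powScore2 {θ : Param m} (hθ : θ ∈ Θ) (i j : Fin m) :
    Integrable fun x => w x * powScore2 f α i j θ x :=
  integrable_of_lintegral_mul_le hw.measurable
    (hB.smooth.measurable_powScore2 (hB.subset hθ) α i j)
    (hB.lintegral_powScore2_le hw h0 h1 hθ i j)

lemma mulWC_nonneg : 0 ≤ W * C := mul_nonneg hw.nonneg hB.pos.le

include h0 h1 in
lemma taylor_powDensity {θ θ' : Param m} (hθ : θ ∈ Θ) (hθ' : θ' ∈ Θ) :
    |(∫ x, w x * powDensity f α θ' x) - (∫ x, w x * powDensity f α θ x)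
      - ∑ j, (α * ∫ x, w x * powScore f α j θ x) * (θ' j - θ j)| ≤
      m * m * (W * C) * ‖θ' - θ‖ ^ 2 := by
  have hs := hB.smooth
  have := abs_integral_taylor_le (F := powDensity f α) (DF := fun j θ x => α * powScore f α j θ x)
    (D2F := fun j l θ x => α * powScore2 f α j l θ x) hB.convex hB.subset
    (fun σ hσ x => hs.hasPartials_powDensity hσ α x)
    (fun j σ hσ x => (hs.hasPartials_powScore hσ α x j).const_mul α)
    (fun j x => (hs.continuousOn_powScore α x j).const_smul α)
    (fun j σ hσ => (hs.measurable_powScore hσ α j).const_mul α)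
    (fun j l x => (hs.continuousOn_powScore2 α x j l).const_smul α)
    (fun j l σ hσ => (hs.measurable_powScore2 hσ α j l).const_mul α) hw.measurable
    (fun σ hσ => hB.integrable_powDensity hw hσ)
    (fun j σ hσ => ((hB.integrable_powScore hw hσ j).const_mul α).congr
      (ae_of_all _ fun x => by ring)) (hB.mulWC_nonneg hw)
    (fun j l σ hσ => (lintegral_mono fun x => ?_).trans
      (hB.lintegral_powScore2_le hw h0 h1 hσ j l)) hθ hθ'
  · simpa only [mul_left_comm (w _) α, integral_const_mul] using this
  · gcongr
    rw [enorm_mul]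
    calc _ ≤ 1 * ‖powScore2 f α j l σ x‖ₑ := by
          gcongr
          rw [← enorm_one (G := ℝ), enorm_le_iff_norm_le, Real.norm_of_nonneg h0]
          simpa using h1
      _ = _ := one_mul _

include h0 h1 in
lemma taylor_powScore {θ θ' : Param m} (hθ : θ ∈ Θ) (hθ' : θ' ∈ Θ) (i : Fin m) :
    |(∫ x, w x * powScore f α i θ' x) - (∫ x, w x * powScore f α i θ x)
      - ∑ j, (∫ x, w x * powScore2 f α i j θ x) * (θ' j - θ j)| ≤
      m * m * (W * C) * ‖θ' - θ‖ ^ 2 := by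
  have hs := hB.smooth
  exact abs_integral_taylor_le hB.convex hB.subset
    (fun σ hσ x => hs.hasPartials_powScore hσ α x i)
    (fun j σ hσ x => (hs.hasPartials_powScore2 hσ α x i j))
    (fun j x => (hs.continuousOn_powScore2 α x i j))
    (fun j σ hσ => (hs.measurable_powScore2 hσ α i j))
    (fun j l x => (hs.continuousOn_powScore3 α x i j l))
    (fun j l σ hσ => (hs.measurable_powScore3 hσ α i j l)) hw.measurable
    (fun σ hσ => hB.integrable_powScore hw hσ i)
    (fun j σ hσ => hB.integrable_powScore2 hw h0 h1 hσ i j) (hB.mulWC_nonneg hw)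
    (fun j l σ hσ => hB.lintegral_powScore3_le hw h0 h1 hσ i j l) hθ hθ'

include h0 h1 in
lemma increment_powScore2 {θ θ' : Param m} (hθ : θ ∈ Θ) (hθ' : θ' ∈ Θ) (i j : Fin m) :
    |(∫ x, w x * powScore2 f α i j θ' x) - (∫ x, w x * powScore2 f α i j θ x)| ≤
      m * (W * C) * ‖θ' - θ‖ := by
  have hs := hB.smooth
  exact abs_integral_increment_le hB.convex hB.subset
    (fun σ hσ x => hs.hasPartials_powScore2 hσ α x i j)
    (fun l x => (hs.continuousOn_powScore3 α x i j l))
    (fun l σ hσ => (hs.measurable_powScore3 hσ α i j l)) hw.measurable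
    (fun σ hσ => hB.integrable_powScore2 hw h0 h1 hσ i j) (hB.mulWC_nonneg hw)
    (fun l σ hσ => hB.lintegral_powScore3_le hw h0 h1 hσ i j l) hθ hθ'

lemma abs_integral_powDensity_le {θ : Param m} (hθ : θ ∈ Θ) :
    |∫ x, w x * powDensity f α θ x| ≤ W * C :=
  abs_integral_le_of_lintegral (hB.mulWC_nonneg hw)
    (by simpa only [enorm_mul] using hB.lintegral_powDensity_le hw hθ)

include h0 h1 in
lemma abs_integral_powScore2_le {θ : Param m} (hθ : θ ∈ Θ) (i j : Fin m) :
    |∫ x, w x * powScore2 f α i j θ x| ≤ W * C :=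
  abs_integral_le_of_lintegral (hB.mulWC_nonneg hw)
    (by simpa only [enorm_mul] using hB.lintegral_powScore2_le hw h0 h1 hθ i j)

end MomentBound

end PMHDE

/-! ### Sub-densities and the derivatives of the loss -/

namespace PMHDE

variable {m : ℕ} {Θ U : Set (Param m)} {f : Param m → ℝ → ℝ}

/-- `q` is a nonnegative function of total mass at most one. -/
structure IsSubDensity (q : ℝ → ℝ) : Prop where
  measurable : Measurable q
  nonneg : ∀ x, 0 ≤ q x
  integrable : Integrable q
  integral_le_one : ∫ x, q x ≤ 1

lemma IsDensity.integrable {q : ℝ → ℝ} (hq : IsDensity q) : Integrable q := by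
  by_contra h
  have := hq.integral_eq_one
  rw [integral_undef h] at this
  exact zero_ne_one this

lemma IsDensity.isSubDensity {q : ℝ → ℝ} (hq : IsDensity q) : IsSubDensity q :=
  ⟨hq.measurable, hq.nonneg, hq.integrable, hq.integral_eq_one.le⟩

/-- At α = 1/2 the factor f^{α-1/2} is one, so only ‖√q‖₂ ≤ 1 matters. Hence all estimates for the
loss are uniform in q. -/
lemma IsSubDensity.weightBound {q : ℝ → ℝ} (hq : IsSubDensity q) :
    WeightBound Θ f (1 / 2) 1 fun x => √(q x) where
  measurable := hq.measurable.sqrt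
  nonneg := zero_le_one
  le θ _ := by
    have := eLpNorm_two_le_of_sq_le (h := fun x => √(q x)) hq.integrable hq.integral_le_one
      fun x => by rw [Real.sq_sqrt (hq.nonneg x)]
    simpa [powDensity] using this

lemma integrable_sqrt_mul_sqrt {p q : ℝ → ℝ} (hpm : Measurable p) (hqm : Measurable q)
    (hp0 : ∀ x, 0 ≤ p x) (hq0 : ∀ x, 0 ≤ q x) (hp : Integrable p) (hq : Integrable q) :
    Integrable fun x => √(p x) * √(q x) := by
  refine (hp.add hq).mono' (hpm.sqrt.mul hqm.sqrt).aestronglyMeasurable (ae_of_all _ fun x => ?_)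
  rw [Real.norm_of_nonneg (by positivity), Pi.add_apply]
  nlinarith [Real.sq_sqrt (hp0 x), Real.sq_sqrt (hq0 x), sq_nonneg (√(p x) - √(q x)),
    Real.sqrt_nonneg (p x), Real.sqrt_nonneg (q x)]

lemma IsSubDensity.integrable_hellSq {p q : ℝ → ℝ} (hp : IsSubDensity p) (hq : IsSubDensity q) :
    Integrable fun x => (√(p x) - √(q x)) ^ 2 := by
  refine ((hp.integrable.add hq.integrable).sub ((integrable_sqrt_mul_sqrt hp.measurable
    hq.measurable hp.nonneg hq.nonneg hp.integrable hq.integrable).const_mul 2)).congr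
    (ae_of_all _ fun x => ?_)
  simp only [Pi.add_apply, Pi.sub_apply]
  linear_combination -Real.sq_sqrt (hp.nonneg x) - Real.sq_sqrt (hq.nonneg x)

lemma IsSubDensity.hellSq_eq {p q : ℝ → ℝ} (hp : IsSubDensity p) (hq : IsSubDensity q) :
    hellSq p q = (∫ x, p x) + (∫ x, q x) - 2 * ∫ x, √(q x) * √(p x) := by
  have hi := integrable_sqrt_mul_sqrt hq.measurable
    hp.measurable hq.nonneg hp.nonneg hq.integrable hp.integrable
  rw [← integral_const_mul, ← integral_add hp.integrable hq.integrable,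
    ← integral_sub (f := fun x => p x + q x) (hp.integrable.add hq.integrable) (hi.const_mul 2)]
  refine integral_congr_ae (ae_of_all _ fun x => ?_)
  simp only
  linear_combination Real.sq_sqrt (hp.nonneg x) + Real.sq_sqrt (hq.nonneg x)

/-- The L² norm of √p - √q is by definition the Hellinger distance. This is the source of the
Lipschitz dependence of losses and Hessians on the density. -/
lemma IsSubDensity.weightBound_sub {p q : ℝ → ℝ} (hp : IsSubDensity p) (hq : IsSubDensity q) :
    WeightBound Θ f (1 / 2) √(hellSq p q) fun x => √(p x) - √(q x) where
  measurable := hp.measurable.sqrt.sub hq.measurable.sqrt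
  nonneg := Real.sqrt_nonneg _
  le θ _ := by
    have := eLpNorm_two_le_of_sq_le (h := fun x => √(p x) - √(q x)) (hp.integrable_hellSq hq)
      (C := hellSq p q) le_rfl fun x => le_rfl
    simpa [powDensity] using this

lemma continuousOn_of_increment_le {F : Param m → ℝ} {B : Param m → ℝ} {A : ℝ}
    (h : ∀ θ ∈ Θ, ∀ θ' ∈ Θ, |F θ' - F θ| ≤ B θ * ‖θ' - θ‖ + A * ‖θ' - θ‖ ^ 2) :
    ContinuousOn F Θ := by
  intro θ hθ
  have ht : Tendsto (fun θ' => B θ * ‖θ' - θ‖ + A * ‖θ' - θ‖ ^ 2) (𝓝[Θ] θ) (𝓝 0) := by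
    have : Continuous fun θ' => B θ * ‖θ' - θ‖ + A * ‖θ' - θ‖ ^ 2 := by fun_prop
    have h2 := (this.tendsto θ).mono_left (nhdsWithin_le_nhds (s := Θ))
    simpa using h2
  rw [ContinuousWithinAt, tendsto_iff_dist_tendsto_zero]
  refine squeeze_zero' (Eventually.of_forall fun _ => dist_nonneg) ?_ ht
  filter_upwards [self_mem_nhdsWithin] with θ' hθ'
  exact h θ hθ θ' hθ'

lemma abs_sum_mul_coord_le (a : Fin m → ℝ) (v : Param m) :
    |∑ j, a j * v j| ≤ (∑ j, |a j|) * ‖v‖ := by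
  refine (Finset.abs_sum_le_sum_abs _ _).trans ?_
  rw [Finset.sum_mul]
  refine Finset.sum_le_sum fun j _ => ?_
  rw [abs_mul]
  exact mul_le_mul_of_nonneg_left (PiLp.norm_apply_le v j) (abs_nonneg _)

/-- Moving from θ by -t·a changes the linear term by -t|a|² and the quadratic term by only A t²|a|²,
which for small t would be negative in total unless a = 0. -/
lemma eq_zero_of_linear_add_sq_nonneg {θ : Param m} (hθ : θ ∈ interior Θ) {a : Fin m → ℝ} {A : ℝ}
    (h : ∀ θ' ∈ Θ, 0 ≤ ∑ j, a j * (θ' j - θ j) + A * ‖θ' - θ‖ ^ 2) : a = 0 := by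
  set v : Param m := WithLp.toLp 2 a with hv
  have hn : ‖v‖ ^ 2 = ∑ j, a j * a j := by
    rw [EuclideanSpace.norm_sq_eq]
    exact Finset.sum_congr rfl fun j _ => by simp [hv, sq]
  have ht : Tendsto (fun t : ℝ => θ - t • v) (𝓝[>] 0) (𝓝 θ) := by
    have : Continuous fun t : ℝ => θ - t • v := by fun_prop
    simpa using (this.tendsto 0).mono_left (nhdsWithin_le_nhds (s := Set.Ioi 0))
  have hs : Tendsto (fun t : ℝ => A * t) (𝓝[>] 0) (𝓝 0) := by
    have : Continuous fun t : ℝ => A * t := by fun_prop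
    simpa using (this.tendsto 0).mono_left (nhdsWithin_le_nhds (s := Set.Ioi 0))
  obtain ⟨t, ht1, ht2, ht0⟩ := ((ht.eventually (mem_interior_iff_mem_nhds.1 hθ)).and
    ((hs.eventually (gt_mem_nhds zero_lt_one)).and self_mem_nhdsWithin)).exists
  have h1 := h _ ht1
  have e : ∑ j, a j * ((θ - t • v) j - θ j) = -t * ‖v‖ ^ 2 := by
    rw [hn, Finset.mul_sum]
    exact Finset.sum_congr rfl fun j _ => by simp [hv]; ring
  rw [e] at h1
  have e2 : ‖θ - t • v - θ‖ ^ 2 = t ^ 2 * ‖v‖ ^ 2 := by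
    rw [sub_sub_cancel_left, norm_neg, norm_smul, mul_pow, Real.norm_eq_abs, sq_abs]
  rw [e2] at h1
  have hv0 : ‖v‖ = 0 := by
    by_contra hne
    have : 0 < ‖v‖ ^ 2 := by positivity
    have ht0' : 0 < t := ht0
    have : 0 < t * ‖v‖ ^ 2 * (1 - A * t) := by
      have : 0 < 1 - A * t := by linarith
      positivity
    nlinarith
  have hv1 : v = 0 := norm_eq_zero.1 hv0
  ext j
  simpa [hv] using congrArg (fun w : Param m => w j) hv1

lemma eq_zero_of_linear_le_sq {θ : Param m} (hθ : θ ∈ interior Θ) {a : Fin m → ℝ} {A : ℝ}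
    (h : ∀ θ' ∈ Θ, |∑ j, a j * (θ' j - θ j)| ≤ A * ‖θ' - θ‖ ^ 2) : a = 0 :=
  eq_zero_of_linear_add_sq_nonneg hθ (A := A) fun θ' hθ' => by
    have := (abs_le.1 (h θ' hθ')).1
    linarith

namespace MomentBound

variable {C : ℝ} (hB : MomentBound Θ U f C)
include hB

/-- The mass of f_θ is constant on Θ, so the linear term of its Taylor bound vanishes at interior
points. The integrals of the first derivatives are therefore constantly zero on the interior, and
the same argument applies to them. -/
lemma integral_powScore2_one_eq_zero (hd : ∀ θ ∈ Θ, IsDensity (f θ)) {θ : Param m}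
    (hθ : θ ∈ interior Θ) (i j : Fin m) : ∫ x, powScore2 f 1 i j θ x = 0 := by
  -- At α = 1 the constant weight leaves f^{1/2}, whose L² norm is already among the moment bounds.
  have hw : WeightBound Θ f 1 C fun _ => 1 := by
    refine ⟨measurable_const, hB.pos.le, fun θ hθ => ?_⟩
    have := hB.one_le θ hθ
    unfold momentNorm at this
    norm_num at this ⊢
    exact this
  have h1 : ∀ θ ∈ interior Θ, ∀ i, ∫ x, powScore f 1 i θ x = 0 := by
    intro θ hθ i
    have hΘ := interior_subset hθ
    have mass : ∀ θ ∈ Θ, ∫ x, powDensity f 1 θ x = 1 := fun θ hθ => by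
      simpa only [hB.smooth.powDensity_one (hB.subset hθ)] using (hd θ hθ).integral_eq_one
    refine congrFun (eq_zero_of_linear_le_sq (a := fun i => ∫ x, powScore f 1 i θ x)
      (A := m * m * (C * C)) hθ fun θ' hθ' => ?_) i
    have := hB.taylor_powDensity hw zero_le_one le_rfl hΘ hθ'
    simpa only [one_mul, mass θ hΘ, mass θ' hθ', sub_self, zero_sub, abs_neg] using this
  -- the second derivative vanishes because the first does near `θ`
  have hΘ := interior_subset hθ
  have hθ2 : θ ∈ interior (interior Θ) := by rwa [interior_interior]
  refine congrFun (eq_zero_of_linear_le_sq (a := fun j => ∫ x, powScore2 f 1 i j θ x)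
    (A := m * m * (C * C)) hθ2 fun θ' hθ' => ?_) j
  have := hB.taylor_powScore hw zero_le_one le_rfl hΘ (interior_subset hθ') i
  simpa only [one_mul, h1 θ hθ, h1 θ' hθ', sub_self, zero_sub, abs_neg] using this

lemma lossGrad_apply (q : ℝ → ℝ) {θ : Param m} (hθ : θ ∈ Θ) (i : Fin m) :
    lossGrad f q θ i = -2 * ∫ x, √(q x) * powScore f (1 / 2) i θ x := by
  simp only [lossGrad, powScore, hB.smooth.powDensity_half (hB.subset hθ), mul_assoc]

lemma lossHess_apply (q : ℝ → ℝ) {θ : Param m} (hθ : θ ∈ Θ) (i j : Fin m) :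
    lossHess f q θ i j = -2 * ∫ x, √(q x) * powScore2 f (1 / 2) i j θ x := by
  simp only [lossHess, powScore2, hB.smooth.powDensity_half (hB.subset hθ), Matrix.of_apply]
  rw [neg_mul, neg_inj, ← integral_const_mul]
  refine integral_congr_ae (ae_of_all _ fun x => ?_)
  simp only
  rw [hB.smooth.score2_comm (hB.subset hθ) x j i]
  ring

lemma lossHess_symm (q : ℝ → ℝ) {θ : Param m} (hθ : θ ∈ Θ) (i j : Fin m) :
    lossHess f q θ i j = lossHess f q θ j i := by
  simp only [lossHess, Matrix.of_apply]
  refine congrArg _ (integral_congr_ae (ae_of_all _ fun x => ?_))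
  simp only
  rw [hB.smooth.score2_comm (hB.subset hθ) x j i]
  ring

/-- For q = f_θ the integrand f(uuᵀ + 2u̇) is the second derivative of f plus f u̇, and the former
integrates to zero. -/
lemma lossHess_self (hd : ∀ θ ∈ Θ, IsDensity (f θ)) {θ : Param m}
    (hθ : θ ∈ interior Θ) : lossHess f (f θ) θ = fisher f θ := by
  have hΘ := interior_subset hθ
  have hU := hB.subset hΘ
  have h0 := hB.integral_powScore2_one_eq_zero hd hθ
  ext i j
  rw [hB.lossHess_apply _ hΘ]
  simp only [fisher, Matrix.of_apply]
  have e1 : ∀ x, √(f θ x) * powScore2 f (1 / 2) i j θ x =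
      (1 / 2) * powScore2 f 1 i j θ x + (1 / 2) * (score2 f θ x i j * f θ x) := by
    intro x
    simp only [powScore2, hB.smooth.powDensity_half hU, hB.smooth.powDensity_one hU]
    rw [hB.smooth.score2_comm hU x j i]
    linear_combination (1 / 2 * (score f θ x i * score f θ x j) + score2 f θ x i j)
      * Real.mul_self_sqrt (hB.smooth.pos θ hU x).le
  have hi := hB.integrable_powScore2 (hd θ hΘ).isSubDensity.weightBound (α := 1 / 2)
    (by norm_num) (by norm_num) hΘ i j
  have hw : WeightBound Θ f 1 C fun _ => 1 := by
    refine ⟨measurable_const, hB.pos.le, fun θ hθ => ?_⟩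
    have := hB.one_le θ hθ
    unfold momentNorm at this
    norm_num at this ⊢
    exact this
  have hi1 := hB.integrable_powScore2 hw zero_le_one le_rfl hΘ i j
  simp only [one_mul] at hi1
  have hi2 : Integrable fun x => (1 / 2 : ℝ) * (score2 f θ x i j * f θ x) := by
    refine (hi.sub (hi1.const_mul (1 / 2))).congr (ae_of_all _ fun x => ?_)
    simp only [Pi.sub_apply, e1]
    ring
  simp_rw [e1]
  rw [integral_add (hi1.const_mul _) hi2, integral_const_mul, integral_const_mul, h0]
  ring

variable {q : ℝ → ℝ} (hq : IsSubDensity q)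
include hq

lemma loss_eq (hd : ∀ θ ∈ Θ, IsDensity (f θ)) {θ : Param m} (hθ : θ ∈ Θ) :
    loss f q θ = 2 * (1 + ∫ x, q x) - 4 * ∫ x, √(q x) * powDensity f (1 / 2) θ x := by
  rw [loss, (hd θ hθ).isSubDensity.hellSq_eq hq, (hd θ hθ).integral_eq_one]
  simp only [hB.smooth.powDensity_half (hB.subset hθ)]
  ring

lemma loss_taylor (hd : ∀ θ ∈ Θ, IsDensity (f θ)) {θ θ' : Param m} (hθ : θ ∈ Θ)
    (hθ' : θ' ∈ Θ) :
    |loss f q θ' - loss f q θ - ∑ j, lossGrad f q θ j * (θ' j - θ j)| ≤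
      4 * (m * m * C) * ‖θ' - θ‖ ^ 2 := by
  have := hB.taylor_powDensity hq.weightBound (by norm_num) (by norm_num) hθ hθ'
  rw [hB.loss_eq hq hd hθ, hB.loss_eq hq hd hθ']
  simp only [hB.lossGrad_apply q hθ]
  have e : ∀ a b : ℝ, ∀ s : Fin m → ℝ, 2 * (1 + ∫ x, q x) - 4 * a - (2 * (1 + ∫ x, q x) - 4 * b)
      - ∑ j, -2 * s j * (θ' j - θ j) = -4 * (a - b - ∑ j, 1 / 2 * s j * (θ' j - θ j)) := by
    intro a b s
    rw [mul_sub, Finset.mul_sum]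
    have : ∀ j, -2 * s j * (θ' j - θ j) = -4 * (1 / 2 * s j * (θ' j - θ j)) := fun j => by ring
    simp_rw [this]
    rw [← Finset.mul_sum]
    ring
  rw [e, abs_mul]
  norm_num at this ⊢
  linarith

lemma lossGrad_taylor {θ θ' : Param m} (hθ : θ ∈ Θ) (hθ' : θ' ∈ Θ) (i : Fin m) :
    |lossGrad f q θ' i - lossGrad f q θ i - ∑ j, lossHess f q θ i j * (θ' j - θ j)| ≤
      2 * (m * m * C) * ‖θ' - θ‖ ^ 2 := by
  have := hB.taylor_powScore hq.weightBound (by norm_num) (by norm_num) hθ hθ' i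
  simp only [hB.lossGrad_apply q hθ, hB.lossGrad_apply q hθ', hB.lossHess_apply q hθ]
  have e : ∀ a b : ℝ, ∀ s : Fin m → ℝ, -2 * a - -2 * b
      - ∑ j, -2 * s j * (θ' j - θ j) = -2 * (a - b - ∑ j, s j * (θ' j - θ j)) := by
    intro a b s
    rw [mul_sub, Finset.mul_sum]
    simp_rw [mul_assoc]
    ring
  rw [e, abs_mul]
  norm_num at this ⊢
  linarith

lemma lossHess_increment {θ θ' : Param m} (hθ : θ ∈ Θ) (hθ' : θ' ∈ Θ) (i j : Fin m) :
    |lossHess f q θ' i j - lossHess f q θ i j| ≤ 2 * (m * C) * ‖θ' - θ‖ := by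
  have := hB.increment_powScore2 hq.weightBound (by norm_num) (by norm_num) hθ hθ' i j
  simp only [hB.lossHess_apply q hθ, hB.lossHess_apply q hθ']
  rw [← mul_sub, abs_mul]
  norm_num at this ⊢
  linarith

lemma continuousOn_loss (hd : ∀ θ ∈ Θ, IsDensity (f θ)) : ContinuousOn (loss f q) Θ := by
  refine continuousOn_of_increment_le (B := fun θ => ∑ j, |lossGrad f q θ j|)
    (A := 4 * (m * m * C)) fun θ hθ θ' hθ' => ?_
  have h1 := hB.loss_taylor hq hd hθ hθ'
  have h2 := abs_sum_mul_coord_le (lossGrad f q θ) (θ' - θ)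
  simp only [PiLp.sub_apply] at h2
  calc |loss f q θ' - loss f q θ| = |(∑ j, lossGrad f q θ j * (θ' j - θ j)) +
        (loss f q θ' - loss f q θ - ∑ j, lossGrad f q θ j * (θ' j - θ j))| := by congr 1; ring
    _ ≤ _ := (abs_add_le _ _).trans (add_le_add h2 h1)

lemma continuousOn_lossGrad (i : Fin m) : ContinuousOn (fun θ => lossGrad f q θ i) Θ := by
  refine continuousOn_of_increment_le (B := fun θ => ∑ j, |lossHess f q θ i j|)
    (A := 2 * (m * m * C)) fun θ hθ θ' hθ' => ?_
  have h1 := hB.lossGrad_taylor hq hθ hθ' i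
  have h2 := abs_sum_mul_coord_le (lossHess f q θ i) (θ' - θ)
  simp only [PiLp.sub_apply] at h2
  calc |lossGrad f q θ' i - lossGrad f q θ i| = |(∑ j, lossHess f q θ i j * (θ' j - θ j)) +
        (lossGrad f q θ' i - lossGrad f q θ i - ∑ j, lossHess f q θ i j * (θ' j - θ j))| := by
        congr 1; ring
    _ ≤ _ := (abs_add_le _ _).trans (add_le_add h2 h1)

lemma continuousOn_lossHess (i j : Fin m) : ContinuousOn (fun θ => lossHess f q θ i j) Θ :=
  continuousOn_of_increment_le (B := fun _ => 2 * (m * C)) (A := 0) fun θ hθ θ' hθ' => by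
    simpa using hB.lossHess_increment hq hθ hθ' i j

/-- The Taylor bound turns minimality into nonnegativity of linear term plus quadratic remainder, so
`lossGrad` is treated as a gradient without differentiating the loss. -/
lemma lossGrad_eq_zero (hd : ∀ θ ∈ Θ, IsDensity (f θ)) {θ : Param m} (hθ : θ ∈ interior Θ)
    (hmin : IsMinOn (loss f q) Θ θ) : lossGrad f q θ = 0 := by
  have : (fun j => lossGrad f q θ j) = 0 :=
    eq_zero_of_linear_add_sq_nonneg hθ (A := 4 * (m * m * C)) fun θ' hθ' => by
      have h1 := hB.loss_taylor hq hd (interior_subset hθ) hθ'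
      have h2 : loss f q θ ≤ loss f q θ' := hmin hθ'
      have := (abs_le.1 h1).2
      linarith
  ext j
  exact congrFun this j

variable {p : ℝ → ℝ} (hp : IsSubDensity p)
include hp

lemma abs_lossHess_sub_le {θ : Param m} (hθ : θ ∈ Θ) (i j : Fin m) :
    |lossHess f p θ i j - lossHess f q θ i j| ≤ 2 * C * √(hellSq p q) := by
  have h := hB.abs_integral_powScore2_le (hp.weightBound_sub hq) (by norm_num) (by norm_num) hθ i j
  rw [hB.lossHess_apply p hθ, hB.lossHess_apply q hθ, ← mul_sub,
    ← integral_sub (hB.integrable_powScore2 hp.weightBound (by norm_num) (by norm_num) hθ i j)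
      (hB.integrable_powScore2 hq.weightBound (by norm_num) (by norm_num) hθ i j), abs_mul]
  simp_rw [← sub_mul]
  norm_num at h ⊢
  linarith

/-- The total masses are subtracted because they shift the loss by a constant free of θ and so do
not affect its minimizers. What remains is -4∫(√p - √q)√f_θ. -/
lemma abs_loss_sub_le (hd : ∀ θ ∈ Θ, IsDensity (f θ)) {θ : Param m} (hθ : θ ∈ Θ) :
    |(loss f p θ - 2 * ∫ x, p x) - (loss f q θ - 2 * ∫ x, q x)| ≤ 4 * C * √(hellSq p q) := by
  have h := hB.abs_integral_powDensity_le (hp.weightBound_sub hq) hθ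
  have e : (loss f p θ - 2 * ∫ x, p x) - (loss f q θ - 2 * ∫ x, q x) =
      -4 * ∫ x, (√(p x) - √(q x)) * powDensity f (1 / 2) θ x := by
    simp_rw [sub_mul]
    rw [integral_sub (hB.integrable_powDensity hp.weightBound hθ)
      (hB.integrable_powDensity hq.weightBound hθ), hB.loss_eq hq hd hθ, hB.loss_eq hp hd hθ]
    ring
  rw [e, abs_mul]
  norm_num at h ⊢
  linarith

end MomentBound

/-- A small Hellinger distance to the model makes the population Hessian invertible. -/
lemma FamilyAssumptions.exists_isUnit_det (hf : FamilyAssumptions Θ f) :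
    ∃ ε₀ > (0 : ℝ), ∀ g, IsDensity g → ∀ θ ∈ interior Θ, hellSq (f θ) g < ε₀ →
      IsUnit (lossHess f g θ).det := by
  obtain ⟨U, C, hB⟩ := hf.exists_momentBound
  have hK : IsCompact ((fun θ => (fun i j => fisher f θ i j : Fin m → Fin m → ℝ)) '' Θ) :=
    hf.compact.image_of_continuousOn hf.fisher_continuous
  have hdet : Continuous fun A : Fin m → Fin m → ℝ => (Matrix.of A).det :=
    Continuous.matrix_det (A := fun A : Fin m → Fin m → ℝ => Matrix.of A) continuous_id
  have hO : IsOpen {A : Fin m → Fin m → ℝ | (Matrix.of A).det ≠ 0} :=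
    isOpen_compl_singleton.preimage hdet
  -- The Fisher matrices over Θ form a compact subset of the open set of nonsingular matrices, so a
  -- whole neighbourhood of fixed width is nonsingular. The width does not depend on g.
  obtain ⟨δ, hδ, hsub⟩ := hK.exists_thickening_subset_open hO (by
    rintro _ ⟨θ, hθ, rfl⟩
    exact (hf.fisher_posDef θ hθ).det_pos.ne')
  -- The Hessian for g differs entrywise from the Fisher matrix by at most 2C times the Hellinger
  -- distance.
  refine ⟨(δ / (2 * C)) ^ 2, by have := hB.pos; positivity, fun g hg θ hθ hlt => ?_⟩
  have hΘ := interior_subset hθ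
  have h1 : √(hellSq (f θ) g) < δ / (2 * C) := by
    rw [Real.sqrt_lt' (by have := hB.pos; positivity)]
    exact hlt
  have h2 : (fun i j => lossHess f g θ i j : Fin m → Fin m → ℝ) ∈
      Metric.thickening δ ((fun θ => (fun i j => fisher f θ i j : Fin m → Fin m → ℝ)) '' Θ) := by
    rw [Metric.mem_thickening_iff]
    refine ⟨_, ⟨θ, hΘ, rfl⟩, ?_⟩
    rw [dist_pi_lt_iff hδ]
    intro i
    rw [dist_pi_lt_iff hδ]
    intro j
    rw [dist_comm, Real.dist_eq]
    change |fisher f θ i j - lossHess f g θ i j| < δ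
    rw [← hB.lossHess_self hf.density hθ]
    refine (hB.abs_lossHess_sub_le hg.isSubDensity (hf.density θ hΘ).isSubDensity hΘ i
      j).trans_lt ?_
    rw [lt_div_iff₀ (by have := hB.pos; positivity)] at h1
    linarith
  exact isUnit_iff_ne_zero.2 (hsub h2)

end PMHDE

/-! ### The density estimator and the sensitivities of its queries -/

namespace PMHDE

variable {m : ℕ} {Θ U : Set (Param m)} {f : Param m → ℝ → ℝ}

section KDE

variable {K : ℝ → ℝ} {c : ℝ}

/-- The contribution of an observation at `d` to the truncated density estimator. -/
noncomputable def kernelBump (K : ℝ → ℝ) (c b : ℝ) (n : ℕ) (d x : ℝ) : ℝ :=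
  1 / (n * c) * (K ((x - d) / c) * (Set.Ioo (-b) b).indicator 1 d)

lemma truncKDE_eq_sum (K : ℝ → ℝ) (c b : ℝ) {n : ℕ} (D : Fin n → ℝ) (x : ℝ) :
    truncKDE K c b D x = ∑ i, kernelBump K c b n (D i) x := by
  simp only [truncKDE, kernelBump, Finset.mul_sum]

lemma indicator_one_nonneg (s : Set ℝ) (d : ℝ) : 0 ≤ s.indicator (1 : ℝ → ℝ) d :=
  Set.indicator_nonneg (fun _ _ => zero_le_one) d

lemma indicator_one_le_one (s : Set ℝ) (d : ℝ) : s.indicator (1 : ℝ → ℝ) d ≤ 1 :=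
  Set.indicator_le_self' (fun _ _ => zero_le_one) d

lemma kernelBump_nonneg (hK : ∀ x, 0 ≤ K x) (hc : 0 < c) (b : ℝ) (n : ℕ) (d x : ℝ) :
    0 ≤ kernelBump K c b n d x := by
  have := hK ((x - d) / c)
  have := indicator_one_nonneg (Set.Ioo (-b) b) d
  unfold kernelBump
  positivity

lemma kernelBump_le (hK : ∀ x, 0 ≤ K x) (hc : 0 < c) (b : ℝ) (n : ℕ) (d x : ℝ) :
    kernelBump K c b n d x ≤ 1 / (n * c) * K ((x - d) / c) := by
  unfold kernelBump
  refine mul_le_mul_of_nonneg_left ?_ (by positivity)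
  exact mul_le_of_le_one_right (hK _) (indicator_one_le_one _ _)

lemma measurable_kernelBump (hK : Measurable K) (b : ℝ) (n : ℕ) (d : ℝ) :
    Measurable (kernelBump K c b n d) := by
  unfold kernelBump
  exact ((hK.comp (by fun_prop)).mul_const _).const_mul _

lemma integrable_scaled {h : ℝ → ℝ} (hh : Integrable h) (hc : 0 < c) (d : ℝ) :
    Integrable fun x => h ((x - d) / c) :=
  (hh.comp_div hc.ne').comp_sub_right d

lemma integral_scaled (h : ℝ → ℝ) (hc : 0 < c) (d : ℝ) :
    ∫ x, h ((x - d) / c) = c * ∫ x, h x := by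
  rw [integral_sub_right_eq_self (fun x => h (x / c)) d, Measure.integral_comp_div,
    abs_of_pos hc, smul_eq_mul]

lemma integrable_kernelBump (hK : IsDensity K) (hc : 0 < c) (b : ℝ) (n : ℕ) (d : ℝ) :
    Integrable (kernelBump K c b n d) :=
  ((integrable_scaled hK.integrable hc d).mul_const _).const_mul _

/-- Each bump has mass at most 1/n. Truncation discards observations without renormalizing, so the
estimator need not be a probability density. -/
lemma isSubDensity_truncKDE (hK : IsDensity K) (hc : 0 < c) (b : ℝ) {n : ℕ} (D : Fin n → ℝ) :
    IsSubDensity (truncKDE K c b D) := by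
  have e : truncKDE K c b D = fun x => ∑ i, kernelBump K c b n (D i) x :=
    funext fun x => truncKDE_eq_sum K c b D x
  rw [e]
  refine ⟨Finset.measurable_sum _ fun i _ => measurable_kernelBump hK.measurable b n _,
    fun x => Finset.sum_nonneg fun i _ => kernelBump_nonneg hK.nonneg hc b n _ x,
    integrable_finsetSum _ fun i _ => integrable_kernelBump hK hc b n _, ?_⟩
  rw [integral_finsetSum _ fun i _ => integrable_kernelBump hK hc b n _]
  calc ∑ i, ∫ x, kernelBump K c b n (D i) x ≤ ∑ _i : Fin n, (1 / n : ℝ) := by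
        refine Finset.sum_le_sum fun i _ => ?_
        refine (integral_mono (integrable_kernelBump hK hc b n _)
          ((integrable_scaled hK.integrable hc (D i)).const_mul _)
          fun x => kernelBump_le hK.nonneg hc b n _ x).trans (le_of_eq ?_)
        rw [integral_const_mul, integral_scaled K hc, hK.integral_eq_one]
        field_simp
    _ ≤ 1 := by
        rcases Nat.eq_zero_or_pos n with rfl | hn
        · simp
        · simp only [Finset.sum_const, Finset.card_univ, Fintype.card_fin, nsmul_eq_mul]
          field_simp
          rfl

lemma sqrt_add_le_sqrt_add_sqrt {a b : ℝ} (ha : 0 ≤ a) (hb : 0 ≤ b) : √(a + b) ≤ √a + √b := by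
  rw [Real.sqrt_le_left (by positivity)]
  nlinarith [Real.sq_sqrt ha, Real.sq_sqrt hb, Real.sqrt_nonneg a, Real.sqrt_nonneg b,
    mul_nonneg (Real.sqrt_nonneg a) (Real.sqrt_nonneg b)]

lemma abs_sqrt_add_sub_sqrt_add_le {r a b : ℝ} (hr : 0 ≤ r) (ha : 0 ≤ a) (hb : 0 ≤ b) :
    |√(r + a) - √(r + b)| ≤ √a + √b := by
  have h1 : √(r + a) ≤ √r + √a := sqrt_add_le_sqrt_add_sqrt hr ha
  have h2 : √(r + b) ≤ √r + √b := sqrt_add_le_sqrt_add_sqrt hr hb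
  have h3 : √r ≤ √(r + a) := Real.sqrt_le_sqrt (by linarith)
  have h4 : √r ≤ √(r + b) := Real.sqrt_le_sqrt (by linarith)
  have := Real.sqrt_nonneg a
  have := Real.sqrt_nonneg b
  rw [abs_le]
  constructor <;> linarith

/-- Adjacent data sets share all bumps but one. With r the common part, √(r+a) and √(r+b) exceed √r
by at most √a and √b respectively. -/
lemma exists_abs_sqrt_truncKDE_sub_le (hK : ∀ x, 0 ≤ K x) (hc : 0 < c) (b : ℝ) {n : ℕ}
    {D D' : Fin n → ℝ} (hD : hammingDist D D' = 1) :
    ∃ d d' : ℝ, ∀ x, |√(truncKDE K c b D x) - √(truncKDE K c b D' x)| ≤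
      √(kernelBump K c b n d x) + √(kernelBump K c b n d' x) := by
  classical
  rw [hammingDist, Finset.card_eq_one] at hD
  obtain ⟨i, hi⟩ := hD
  have hne : ∀ j, j ≠ i → D j = D' j := fun j hj => by
    by_contra h
    have : j ∈ ({i} : Finset (Fin n)) := by rw [← hi]; simpa using h
    exact hj (Finset.mem_singleton.1 this)
  refine ⟨D i, D' i, fun x => ?_⟩
  rw [truncKDE_eq_sum, truncKDE_eq_sum, ← Finset.add_sum_erase _ _ (Finset.mem_univ i),
    ← Finset.add_sum_erase (a := i) _ (fun j => kernelBump K c b n (D' j) x) (Finset.mem_univ i)]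
  have e : ∑ j ∈ Finset.univ.erase i, kernelBump K c b n (D' j) x =
      ∑ j ∈ Finset.univ.erase i, kernelBump K c b n (D j) x :=
    Finset.sum_congr rfl fun j hj => by rw [hne j (Finset.ne_of_mem_erase hj)]
  rw [e, add_comm, add_comm (kernelBump K c b n (D' i) x)]
  exact abs_sqrt_add_sub_sqrt_add_le
    (Finset.sum_nonneg fun j _ => kernelBump_nonneg hK hc b n _ x)
    (kernelBump_nonneg hK hc b n _ x) (kernelBump_nonneg hK hc b n _ x)

/-- On the compact support K^p ≤ 1 + K. Without a support condition a power below one of an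
integrable function need not be integrable. -/
lemma integrable_rpow_of_compactSupport (hK : IsDensity K) (hs : HasCompactSupport K) {p : ℝ}
    (hp : 0 < p) (hp1 : p ≤ 1) : Integrable fun x => K x ^ p := by
  have h1 : Integrable ((tsupport K).indicator fun _ => (1 : ℝ)) :=
    (integrable_indicator_iff (isClosed_tsupport K).measurableSet).2
      (integrableOn_const hs.isCompact.measure_lt_top.ne)
  refine (h1.add hK.integrable).mono' (hK.measurable.pow_const p).aestronglyMeasurable
    (ae_of_all _ fun x => ?_)
  rw [Real.norm_of_nonneg (Real.rpow_nonneg (hK.nonneg x) p), Pi.add_apply]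
  by_cases hx : x ∈ tsupport K
  · rw [Set.indicator_of_mem hx]
    rcases le_total (K x) 1 with h | h
    · have := Real.rpow_le_one (hK.nonneg x) h hp.le
      have := hK.nonneg x
      linarith
    · have := Real.rpow_le_rpow_of_exponent_le h hp1
      rw [Real.rpow_one] at this
      linarith
  · rw [image_eq_zero_of_notMem_tsupport hx, Real.zero_rpow hp.ne']
    simp [Set.indicator_of_notMem hx]

/-- The `L^p` norm of the square root of one bump. -/
lemma lintegral_sqrt_kernelBump_rpow_le (hK : IsDensity K) (hs : HasCompactSupport K) (hc : 0 < c)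
    (b : ℝ) {n : ℕ} (hn : 0 < n) (d : ℝ) {p : ℝ} (hp : 1 < p) (hp2 : p < 2) :
    (∫⁻ x, ‖√(kernelBump K c b n d x)‖ₑ ^ p) ^ (1 / p) ≤
      ENNReal.ofReal ((∫ x, K x ^ (p / 2)) ^ (1 / p) *
        ((n : ℝ) ^ (-(1 / 2) : ℝ) * c ^ (1 / p - 1 / 2))) := by
  have hp0 : 0 < p := by linarith
  have hn' : (0 : ℝ) < n := by exact_mod_cast hn
  have hi := integrable_rpow_of_compactSupport hK hs (p := p / 2) (by linarith) (by linarith)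
  have h0 : ∀ x, 0 ≤ K x ^ (p / 2) := fun x => Real.rpow_nonneg (hK.nonneg x) _
  have hI : 0 ≤ ∫ x, K x ^ (p / 2) := integral_nonneg h0
  have hn0 : (0 : ℝ) ≤ 1 / (n * c) := by positivity
  have h1 : ∫⁻ x, ‖√(kernelBump K c b n d x)‖ₑ ^ p ≤
      ENNReal.ofReal ((1 / (n * c)) ^ (p / 2) * (c * ∫ x, K x ^ (p / 2))) := by
    rw [← integral_scaled (fun x => K x ^ (p / 2)) hc d, ← integral_const_mul,
      ofReal_integral_eq_lintegral_ofReal ((integrable_scaled hi hc d).const_mul _)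
        (ae_of_all _ fun x => mul_nonneg (Real.rpow_nonneg hn0 _) (h0 _))]
    refine lintegral_mono fun x => ?_
    have hk := kernelBump_nonneg hK.nonneg hc b n d x
    rw [← ofReal_norm, Real.norm_of_nonneg (Real.sqrt_nonneg _),
      ENNReal.ofReal_rpow_of_nonneg (Real.sqrt_nonneg _) hp0.le, Real.sqrt_eq_rpow,
      ← Real.rpow_mul hk, ← Real.mul_rpow hn0 (hK.nonneg _)]
    refine ENNReal.ofReal_le_ofReal ?_
    rw [show 1 / 2 * p = p / 2 by ring]
    exact Real.rpow_le_rpow hk (kernelBump_le hK.nonneg hc b n d x) (by linarith)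
  -- Rescaling contributes c^{1/p} from the width of the bump and (nc)^{-1/2} from the root of its
  -- height.
  refine (ENNReal.rpow_le_rpow h1 (by positivity)).trans (le_of_eq ?_)
  rw [ENNReal.ofReal_rpow_of_nonneg (by positivity) (by positivity)]
  congr 1
  rw [Real.mul_rpow (by positivity) (by positivity), Real.mul_rpow hc.le hI,
    ← Real.rpow_mul hn0, show p / 2 * (1 / p) = 1 / 2 by field_simp, one_div (n * c : ℝ),
    Real.inv_rpow (by positivity), Real.mul_rpow hn'.le hc.le, Real.rpow_neg hn'.le,
    Real.rpow_sub hc]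
  field_simp

end KDE

/-- Bounds for the moments of conjugate order. -/
structure ConjBound (Θ : Set (Param m)) (f : Param m → ℝ → ℝ) (p q B : ℝ) : Prop where
  one_lt : 1 < p
  lt_two : p < 2
  conj : p.HolderConjugate q
  nonneg : 0 ≤ B
  score_le : ∀ θ ∈ Θ, ∀ i, (∫⁻ x, ‖powDensity f (1 / 2) θ x * score f θ x i‖ₑ ^ q) ^ (1 / q)
    ≤ ENNReal.ofReal B
  outer_le : ∀ θ ∈ Θ, ∀ i j, (∫⁻ x, ‖powDensity f (1 / 2) θ x *
    (score f θ x i * score f θ x j)‖ₑ ^ q) ^ (1 / q) ≤ ENNReal.ofReal B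
  score2_le : ∀ θ ∈ Θ, ∀ i j, (∫⁻ x, ‖powDensity f (1 / 2) θ x * score2 f θ x i j‖ₑ ^ q) ^ (1 / q)
    ≤ ENNReal.ofReal B

/-- The identity (f^{1/2}|P|)^q = (|P| f^{1/2-1/q})^q · f rewrites the L^q norm with respect to
Lebesgue measure as an expectation under f_θ. -/
lemma SmoothFamily.lintegral_rpow_le (hs : SmoothFamily U f) {θ : Param m} (hθ : θ ∈ U) {q : ℝ}
    (hq : 0 < q) {P S : ℝ → ℝ} {B : ℝ} (hi : Integrable fun x => S x ^ q * f θ x)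
    (hB : ∫ x, S x ^ q * f θ x ≤ B) (hPS : ∀ x, |P x * f θ x ^ (1 / 2 - 1 / q)| ≤ S x) :
    (∫⁻ x, ‖powDensity f (1 / 2) θ x * P x‖ₑ ^ q) ^ (1 / q) ≤ ENNReal.ofReal (B ^ (1 / q)) := by
  have hS : ∀ x, 0 ≤ S x := fun x => (abs_nonneg _).trans (hPS x)
  have h0 : ∀ x, 0 ≤ S x ^ q * f θ x := fun x =>
    mul_nonneg (Real.rpow_nonneg (hS x) _) (hs.pos θ hθ x).le
  rw [← ENNReal.ofReal_rpow_of_nonneg ((integral_nonneg h0).trans hB) (by positivity)]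
  refine ENNReal.rpow_le_rpow ?_ (by positivity)
  refine le_trans ?_ (ENNReal.ofReal_le_ofReal hB)
  rw [ofReal_integral_eq_lintegral_ofReal hi (ae_of_all _ h0)]
  refine lintegral_mono fun x => ?_
  have hf := hs.pos θ hθ x
  rw [← ofReal_norm, ENNReal.ofReal_rpow_of_nonneg (norm_nonneg _) hq.le]
  refine ENNReal.ofReal_le_ofReal ?_
  have e : ‖powDensity f (1 / 2) θ x * P x‖ =
      |P x * f θ x ^ (1 / 2 - 1 / q)| * f θ x ^ (1 / q) := by
    rw [hs.powDensity_half hθ, Real.sqrt_eq_rpow, norm_mul,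
      Real.norm_of_nonneg (Real.rpow_nonneg hf.le _), abs_mul,
      abs_of_nonneg (Real.rpow_nonneg hf.le (1 / 2 - 1 / q)), mul_assoc, ← Real.rpow_add hf,
      Real.norm_eq_abs, mul_comm]
    congr 2; ring
  rw [e, Real.mul_rpow (abs_nonneg _) (Real.rpow_nonneg hf.le _), ← Real.rpow_mul hf.le,
    one_div_mul_cancel hq.ne', Real.rpow_one]
  exact mul_le_mul_of_nonneg_right (Real.rpow_le_rpow (abs_nonneg _) (hPS x) hq.le) hf.le

lemma FamilyAssumptions.exists_conjBound (hf : FamilyAssumptions Θ f) (hs : SmoothFamily U f)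
    (hΘU : Θ ⊆ U) : ∃ p q B, ConjBound Θ f p q B := by
  obtain ⟨p, q, hp1, hp2, hpq, h1, h2, h3⟩ := hf.conj_moments
  obtain ⟨B1, hB1⟩ := h1.exists_le hf.compact
  obtain ⟨B2, hB2⟩ := h2.exists_le hf.compact
  obtain ⟨B3, hB3⟩ := h3.exists_le hf.compact
  have hc : p.HolderConjugate q := Real.holderConjugate_iff.2 ⟨hp1, by simpa using hpq⟩
  have hq : 0 < q := hc.symm.pos
  set B := |B1| + |B2| + |B3|
  have := le_abs_self B1
  have := le_abs_self B2
  have := le_abs_self B3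
  have := abs_nonneg B1
  have := abs_nonneg B2
  have := abs_nonneg B3
  refine ⟨p, q, B ^ (1 / q), hp1, hp2, hc, by positivity, fun θ hθ i => ?_, fun θ hθ i j => ?_,
    fun θ hθ i j => ?_⟩
  · exact hs.lintegral_rpow_le (hΘU hθ) hq (h1.1 θ hθ) ((hB1 θ hθ).trans (by linarith)) fun x =>
      Finset.single_le_sum (f := fun i => |score f θ x i * f θ x ^ (1 / 2 - 1 / q)|)
        (fun _ _ => abs_nonneg _) (Finset.mem_univ i)
  · refine hs.lintegral_rpow_le (hΘU hθ) hq (h2.1 θ hθ) ((hB2 θ hθ).trans (by linarith)) fun x =>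
      (Finset.single_le_sum
        (f := fun j => |score f θ x i * score f θ x j * f θ x ^ (1 / 2 - 1 / q)|)
        (fun _ _ => abs_nonneg _) (Finset.mem_univ j)).trans
      (Finset.single_le_sum
        (f := fun i => ∑ j, |score f θ x i * score f θ x j * f θ x ^ (1 / 2 - 1 / q)|)
        (fun _ _ => Finset.sum_nonneg fun _ _ => abs_nonneg _) (Finset.mem_univ i))
  · refine hs.lintegral_rpow_le (hΘU hθ) hq (h3.1 θ hθ) ((hB3 θ hθ).trans (by linarith)) fun x =>
      (Finset.single_le_sum
        (f := fun j => |score2 f θ x i j * f θ x ^ (1 / 2 - 1 / q)|)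
        (fun _ _ => abs_nonneg _) (Finset.mem_univ j)).trans
      (Finset.single_le_sum
        (f := fun i => ∑ j, |score2 f θ x i j * f θ x ^ (1 / 2 - 1 / q)|)
        (fun _ _ => Finset.sum_nonneg fun _ _ => abs_nonneg _) (Finset.mem_univ i))

section Sensitivity

variable {K : ℝ → ℝ} {c p q B : ℝ}

/-- The rate `n^{-1/2} c^{1/p - 1/2}` of the sensitivities. -/
noncomputable def sensRate (K : ℝ → ℝ) (p c : ℝ) (n : ℕ) : ℝ :=
  (∫ x, K x ^ (p / 2)) ^ (1 / p) * ((n : ℝ) ^ (-(1 / 2) : ℝ) * c ^ (1 / p - 1 / 2))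

lemma sensRate_nonneg (hK : IsDensity K) (hc : 0 < c) (n : ℕ) : 0 ≤ sensRate K p c n := by
  have : 0 ≤ ∫ x, K x ^ (p / 2) := integral_nonneg fun x => Real.rpow_nonneg (hK.nonneg x) _
  unfold sensRate
  positivity

/-- Hölder's inequality with exponent p < 2 on the bumps. Cauchy-Schwarz would give only n^{-1/2};
the smaller exponent gains the power c^{1/p-1/2} of the bandwidth. -/
lemma lintegral_sqrt_truncKDE_sub_mul_le (hK : IsDensity K) (hs : HasCompactSupport K) (hc : 0 < c)
    (b : ℝ) {n : ℕ} {D D' : Fin n → ℝ} (hD : hammingDist D D' = 1) (hp : 1 < p) (hp2 : p < 2)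
    (hpq : p.HolderConjugate q) {P : ℝ → ℝ} (hP : Measurable P) (hB : 0 ≤ B)
    (hPB : (∫⁻ x, ‖P x‖ₑ ^ q) ^ (1 / q) ≤ ENNReal.ofReal B) :
    ∫⁻ x, ‖√(truncKDE K c b D x) - √(truncKDE K c b D' x)‖ₑ * ‖P x‖ₑ ≤
      ENNReal.ofReal (2 * sensRate K p c n * B) := by
  have hn : 0 < n := by
    rcases Nat.eq_zero_or_pos n with rfl | h
    · simp [hammingDist] at hD
    · exact h
  obtain ⟨d, d', hdd⟩ := exists_abs_sqrt_truncKDE_sub_le (K := K) hK.nonneg hc b hD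
  have hm : ∀ d, Measurable fun x => ‖√(kernelBump K c b n d x)‖ₑ := fun d =>
    (measurable_kernelBump hK.measurable b n d).sqrt.enorm
  have hold : ∀ d, ∫⁻ x, ‖√(kernelBump K c b n d x)‖ₑ * ‖P x‖ₑ ≤
      ENNReal.ofReal (sensRate K p c n) * ENNReal.ofReal B := fun d =>
    (ENNReal.lintegral_mul_le_Lp_mul_Lq volume hpq (hm d).aemeasurable
      hP.enorm.aemeasurable).trans
      (mul_le_mul' (lintegral_sqrt_kernelBump_rpow_le hK hs hc b hn d hp hp2) hPB)
  calc ∫⁻ x, ‖√(truncKDE K c b D x) - √(truncKDE K c b D' x)‖ₑ * ‖P x‖ₑ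
      ≤ ∫⁻ x, (‖√(kernelBump K c b n d x)‖ₑ * ‖P x‖ₑ
          + ‖√(kernelBump K c b n d' x)‖ₑ * ‖P x‖ₑ) := by
        refine lintegral_mono fun x => ?_
        rw [← add_mul]
        gcongr
        rw [← ofReal_norm, ← ofReal_norm, ← ofReal_norm,
          ← ENNReal.ofReal_add (norm_nonneg _) (norm_nonneg _)]
        refine ENNReal.ofReal_le_ofReal ?_
        rw [Real.norm_of_nonneg (Real.sqrt_nonneg _), Real.norm_of_nonneg (Real.sqrt_nonneg _)]
        exact hdd x
    _ ≤ ENNReal.ofReal (sensRate K p c n) * ENNReal.ofReal B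
        + ENNReal.ofReal (sensRate K p c n) * ENNReal.ofReal B := by
        rw [lintegral_add_left (f := fun x => ‖√(kernelBump K c b n d x)‖ₑ * ‖P x‖ₑ)
          ((hm d).mul hP.enorm)]
        exact add_le_add (hold d) (hold d')
    _ = _ := by
        have h1 := sensRate_nonneg (p := p) hK hc n
        rw [← ENNReal.ofReal_mul h1, ← ENNReal.ofReal_add (by positivity) (by positivity)]
        congr 1; ring

variable {C : ℝ} (hM : MomentBound Θ U f C) (hB : ConjBound Θ f p q B)
  (hK : IsDensity K) (hs : HasCompactSupport K) (hc : 0 < c) (b : ℝ)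
  {n : ℕ} {D D' : Fin n → ℝ} (hD : hammingDist D D' = 1)
include hM hB hK hs hc hD

lemma abs_lossGrad_truncKDE_sub_le {θ : Param m} (hθ : θ ∈ Θ) (i : Fin m) :
    |lossGrad f (truncKDE K c b D) θ i - lossGrad f (truncKDE K c b D') θ i| ≤
      4 * B * sensRate K p c n := by
  have hr := sensRate_nonneg (p := p) hK hc n
  have hB0 := hB.nonneg
  have q1 := (isSubDensity_truncKDE hK hc b D).weightBound (Θ := Θ) (f := f)
  have q2 := (isSubDensity_truncKDE hK hc b D').weightBound (Θ := Θ) (f := f)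
  rw [hM.lossGrad_apply _ hθ, hM.lossGrad_apply _ hθ, ← mul_sub,
    ← integral_sub (hM.integrable_powScore q1 hθ i) (hM.integrable_powScore q2 hθ i), abs_mul]
  simp_rw [← sub_mul]
  have h1 := abs_integral_le_of_lintegral (M := 2 * sensRate K p c n * B) (by positivity)
    (h := fun x => (√(truncKDE K c b D x) - √(truncKDE K c b D' x)) * powScore f (1 / 2) i θ x)
    (by simpa only [enorm_mul] using lintegral_sqrt_truncKDE_sub_mul_le hK hs hc b hD
          hB.one_lt hB.lt_two hB.conj
          (hM.smooth.measurable_powScore (hM.subset hθ) (1 / 2) i) hB0 (hB.score_le θ hθ i))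
  norm_num at h1 ⊢
  linarith

lemma abs_lossHess_truncKDE_sub_le {θ : Param m} (hθ : θ ∈ Θ) (i j : Fin m) :
    |lossHess f (truncKDE K c b D) θ i j - lossHess f (truncKDE K c b D') θ i j| ≤
      8 * B * sensRate K p c n := by
  have hr := sensRate_nonneg (p := p) hK hc n
  have hB0 := hB.nonneg
  have hU := hM.subset hθ
  have q1 := (isSubDensity_truncKDE hK hc b D).weightBound (Θ := Θ) (f := f)
  have q2 := (isSubDensity_truncKDE hK hc b D').weightBound (Θ := Θ) (f := f)
  rw [hM.lossHess_apply _ hθ, hM.lossHess_apply _ hθ, ← mul_sub,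
    ← integral_sub (hM.integrable_powScore2 q1 (by norm_num) (by norm_num) hθ i j)
      (hM.integrable_powScore2 q2 (by norm_num) (by norm_num) hθ i j), abs_mul]
  simp_rw [← sub_mul]
  have hd := hM.smooth.measurable_powDensity hU (1 / 2)
  have ms := hM.smooth.measurable_score hU
  have ms2 := hM.smooth.measurable_score2 hU
  have l1 := lintegral_sqrt_truncKDE_sub_mul_le hK hs hc b hD hB.one_lt hB.lt_two hB.conj
    (hd.mul ((ms i).mul (ms j))) hB0 (hB.outer_le θ hθ i j)
  have l2 := lintegral_sqrt_truncKDE_sub_mul_le hK hs hc b hD hB.one_lt hB.lt_two hB.conj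
    (hd.mul (ms2 j i)) hB0 (hB.score2_le θ hθ j i)
  have h1 := abs_integral_le_of_lintegral (M := 4 * sensRate K p c n * B) (by positivity)
    (h := fun x => (√(truncKDE K c b D x) - √(truncKDE K c b D' x)) *
      powScore2 f (1 / 2) i j θ x) ?_
  · norm_num at h1 ⊢
    linarith
  · have hmw : Measurable fun x => √(truncKDE K c b D x) - √(truncKDE K c b D' x) :=
      q1.measurable.sub q2.measurable
    calc _ ≤ ∫⁻ x, (‖√(truncKDE K c b D x) - √(truncKDE K c b D' x)‖ₑ *
            ‖powDensity f (1 / 2) θ x * (score f θ x i * score f θ x j)‖ₑ +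
          ‖√(truncKDE K c b D x) - √(truncKDE K c b D' x)‖ₑ *
            ‖powDensity f (1 / 2) θ x * score2 f θ x j i‖ₑ) := by
          refine lintegral_mono fun x => ?_
          rw [enorm_mul, ← mul_add]
          gcongr
          have : powScore2 f (1 / 2) i j θ x = (1 / 2 : ℝ) * (powDensity f (1 / 2) θ x *
              (score f θ x i * score f θ x j)) + powDensity f (1 / 2) θ x * score2 f θ x j i := by
            simp only [powScore2]; ring
          rw [this]
          refine (enorm_add_le _ _).trans ?_
          gcongr
          rw [enorm_mul]
          refine mul_le_of_le_one_left zero_le ?_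
          rw [← enorm_one (G := ℝ), enorm_le_iff_norm_le]
          norm_num
      _ ≤ ENNReal.ofReal (2 * sensRate K p c n * B) +
          ENNReal.ofReal (2 * sensRate K p c n * B) := by
          rw [lintegral_add_left (f := fun x => ‖√(truncKDE K c b D x) - √(truncKDE K c b D' x)‖ₑ *
            ‖powDensity f (1 / 2) θ x * (score f θ x i * score f θ x j)‖ₑ)
            (hmw.enorm.mul (hd.mul ((ms i).mul (ms j))).enorm)]
          exact add_le_add l1 l2
      _ = _ := by
          rw [← ENNReal.ofReal_add (by positivity) (by positivity)]
          congr 1; ring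

omit hM hB hK hs hc hD in
lemma norm_le_of_abs_coord_le {v : Param m} {a : ℝ} (h : ∀ i, |v i| ≤ a) : ‖v‖ ≤ m * a := by
  have : v = ∑ i, v i • EuclideanSpace.single i (1 : ℝ) := by
    ext j
    simp [Pi.single_apply]
  rw [this]
  refine (norm_sum_le _ _).trans ?_
  calc ∑ i, ‖v i • EuclideanSpace.single i (1 : ℝ)‖ ≤ ∑ _i : Fin m, a :=
        Finset.sum_le_sum fun i _ => by simpa [norm_smul] using h i
    _ = m * a := by simp

omit hM hB hK hs hc hD in
lemma sqrt_sum_sq_le_of_abs_le {A : Fin m → Fin m → ℝ} {a : ℝ} (ha : 0 ≤ a)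
    (h : ∀ i j, |A i j| ≤ a) : √(∑ i, ∑ j, A i j ^ 2) ≤ m * a := by
  rw [Real.sqrt_le_left (by positivity)]
  calc ∑ i, ∑ j, A i j ^ 2 ≤ ∑ _i : Fin m, ∑ _j : Fin m, a ^ 2 :=
        Finset.sum_le_sum fun i _ => Finset.sum_le_sum fun j _ => sq_le_sq' (abs_le.1 (h i j)).1
          (abs_le.1 (h i j)).2
    _ = (m * a) ^ 2 := by simp; ring

lemma norm_lossGrad_truncKDE_sub_le {θ : Param m} (hθ : θ ∈ Θ) :
    ‖lossGrad f (truncKDE K c b D) θ - lossGrad f (truncKDE K c b D') θ‖ ≤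
      m * (8 * B * sensRate K p c n) := by
  refine norm_le_of_abs_coord_le fun i => ?_
  -- The constant 4B would do here; 8B is used so that gradient and Hessian share one bound.
  have h1 := abs_lossGrad_truncKDE_sub_le hM hB hK hs hc b hD hθ i
  have := mul_nonneg hB.nonneg (sensRate_nonneg (p := p) hK hc n)
  rw [PiLp.sub_apply]
  linarith

lemma frobenius_lossHess_truncKDE_sub_le {θ : Param m} (hθ : θ ∈ Θ) :
    √(∑ i, ∑ j, (lossHess f (truncKDE K c b D) θ i j
      - lossHess f (truncKDE K c b D') θ i j) ^ 2) ≤ m * (8 * B * sensRate K p c n) :=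
  sqrt_sum_sq_le_of_abs_le (by
    have := mul_nonneg hB.nonneg (sensRate_nonneg (p := p) hK hc n); linarith)
    fun i j => abs_lossHess_truncKDE_sub_le hM hB hK hs hc b hD hθ i j

/-- The uniform Hölder bound shows that the set of differences is bounded above, so `sSup` is a true
supremum and not the default value zero. -/
lemma norm_lossGrad_truncKDE_sub_le_gradSens {θ : Param m} (hθ : θ ∈ Θ) :
    ‖lossGrad f (truncKDE K c b D) θ - lossGrad f (truncKDE K c b D') θ‖ ≤
      gradSens Θ f K c b n := by
  refine le_csSup ⟨m * (8 * B * sensRate K p c n), ?_⟩ ⟨θ, hθ, D, D', hD, rfl⟩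
  rintro _ ⟨θ, hθ, D, D', hD, rfl⟩
  exact norm_lossGrad_truncKDE_sub_le hM hB hK hs hc b hD hθ

lemma frobenius_lossHess_truncKDE_sub_le_hessSens {θ : Param m} (hθ : θ ∈ Θ) :
    √(∑ i, ∑ j, (lossHess f (truncKDE K c b D) θ i j
      - lossHess f (truncKDE K c b D') θ i j) ^ 2) ≤ hessSens Θ f K c b n := by
  refine le_csSup ⟨m * (8 * B * sensRate K p c n), ?_⟩ ⟨θ, hθ, D, D', hD, rfl⟩
  rintro _ ⟨θ, hθ, D, D', hD, rfl⟩
  exact frobenius_lossHess_truncKDE_sub_le hM hB hK hs hc b hD hθ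

omit hD in
lemma gradSens_le (n : ℕ) : gradSens Θ f K c b n ≤ m * (8 * B * sensRate K p c n) := by
  refine Real.sSup_le ?_ ?_
  · rintro _ ⟨θ, hθ, D, D', hD, rfl⟩
    exact norm_lossGrad_truncKDE_sub_le hM hB hK hs hc b hD hθ
  -- Without adjacent data sets the supremum is over the empty set and equals zero, so the bound
  -- must be nonnegative.
  · have := mul_nonneg hB.nonneg (sensRate_nonneg (p := p) hK hc n)
    have : 0 ≤ 8 * B * sensRate K p c n := by linarith
    positivity

omit hD in
lemma hessSens_le (n : ℕ) : hessSens Θ f K c b n ≤ m * (8 * B * sensRate K p c n) := by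
  refine Real.sSup_le ?_ ?_
  · rintro _ ⟨θ, hθ, D, D', hD, rfl⟩
    exact frobenius_lossHess_truncKDE_sub_le hM hB hK hs hc b hD hθ
  · have := mul_nonneg hB.nonneg (sensRate_nonneg (p := p) hK hc n)
    have : 0 ≤ 8 * B * sensRate K p c n := by linarith
    positivity

end Sensitivity

end PMHDE

/-! ### Measurability of the iteration and its privacy -/

namespace PMHDE

variable {m : ℕ} {Θ U : Set (Param m)} {f : Param m → ℝ → ℝ}

section Measurability

lemma measurable_indicator_of_continuousOn (hΘ : IsClosed Θ) {F : Param m → ℝ}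
    (hF : ContinuousOn F Θ) : Measurable (Θ.indicator F) := by
  classical
  rw [← Set.piecewise_eq_indicator]
  exact hF.measurable_piecewise continuousOn_const hΘ.measurableSet

/-- Cramer's rule writes the inverse as det⁻¹ times the adjugate. The formula also covers singular
matrices, where both the inverse and det⁻¹ are zero by convention. -/
lemma measurable_inv_mulVec (i : Fin m) :
    Measurable fun p : (Fin m → Fin m → ℝ) × (Fin m → ℝ) =>
      ((Matrix.of p.1)⁻¹.mulVec p.2) i := by
  have hA : Continuous fun p : (Fin m → Fin m → ℝ) × (Fin m → ℝ) => Matrix.of p.1 :=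
    continuous_fst
  have hadj := hA.matrix_adjugate
  have hdet := hA.matrix_det
  have e : ∀ p : (Fin m → Fin m → ℝ) × (Fin m → ℝ), ((Matrix.of p.1)⁻¹.mulVec p.2) i =
      ((Matrix.of p.1).det)⁻¹ * ∑ j, (Matrix.of p.1).adjugate i j * p.2 j := by
    intro p
    rw [Matrix.inv_def, Ring.inverse_eq_inv', Matrix.smul_mulVec, Pi.smul_apply, smul_eq_mul]
    rfl
  simp_rw [e]
  refine hdet.measurable.inv.mul (Finset.measurable_sum _ fun j _ => Continuous.measurable ?_)
  exact ((continuous_apply j).comp ((continuous_apply i).comp hadj)).mul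
    ((continuous_apply j).comp continuous_snd)

lemma indicator_lossGrad_apply (q : ℝ → ℝ) (θ : Param m) (i : Fin m) :
    Θ.indicator (lossGrad f q) θ i = Θ.indicator (fun θ => lossGrad f q θ i) θ := by
  by_cases h : θ ∈ Θ <;> simp [h]

lemma indicator_lossHess_apply (q : ℝ → ℝ) (θ : Param m) (i j : Fin m) :
    Θ.indicator (lossHess f q) θ i j = Θ.indicator (fun θ => lossHess f q θ i j) θ := by
  by_cases h : θ ∈ Θ <;> simp [h]

lemma measurable_pnrStep {C : ℝ} (hM : MomentBound Θ U f C) (hΘ : IsClosed Θ) {q : ℝ → ℝ}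
    (hq : IsSubDensity q) (Δ ΔH ε' η : ℝ) :
    Measurable fun p : Param m × StepNoise m => pnrStep Θ f q Δ ΔH ε' η p.1 p.2 := by
  have hG : ∀ i, Measurable fun θ : Param m => Θ.indicator (lossGrad f q) θ i := fun i => by
    simp_rw [indicator_lossGrad_apply]
    exact measurable_indicator_of_continuousOn hΘ (hM.continuousOn_lossGrad hq i)
  have hH : ∀ i j, Measurable fun θ : Param m => Θ.indicator (lossHess f q) θ i j := fun i j => by
    simp_rw [indicator_lossHess_apply]
    exact measurable_indicator_of_continuousOn hΘ (hM.continuousOn_lossHess hq i j)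
  have hz1 : ∀ i, Measurable fun p : Param m × StepNoise m => p.2.1 i := fun i => by fun_prop
  have hz2 : ∀ i j, Measurable fun p : Param m × StepNoise m => p.2.2 i j := fun i j => by fun_prop
  set v : Param m × StepNoise m → Fin m → ℝ := fun p i =>
    Θ.indicator (lossGrad f q) p.1 i + Δ * noiseMult (ε' / 2) * p.2.1 i with hvdef
  set A : Param m × StepNoise m → Fin m → Fin m → ℝ := fun p i j =>
    Θ.indicator (lossHess f q) p.1 i j + ΔH * noiseMult (ε' / 2) * p.2.2 (min i j) (max i j)
    with hAdef
  have hv : Measurable v :=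
    measurable_pi_iff.2 fun i => ((hG i).comp measurable_fst).add ((hz1 i).const_mul _)
  have hA : Measurable A := by
    refine measurable_pi_iff.2 fun i => measurable_pi_iff.2 fun j => ?_
    exact ((hH i j).comp measurable_fst).add ((hz2 (min i j) (max i j)).const_mul _)
  have hmv : Measurable fun p i => ((Matrix.of (A p))⁻¹.mulVec (v p)) i := by
    refine measurable_pi_iff.2 fun i => ?_
    have := (measurable_inv_mulVec i).comp (hA.prodMk hv)
    exact this
  have e : (fun p : Param m × StepNoise m => pnrStep Θ f q Δ ΔH ε' η p.1 p.2) =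
      fun p => p.1 - η • WithLp.toLp 2 (fun i => ((Matrix.of (A p))⁻¹.mulVec (v p)) i) := by
    ext1 p
    have : Θ.indicator (lossHess f q) p.1 + (ΔH * noiseMult (ε' / 2)) • symmOfUpper p.2.2 =
        Matrix.of (A p) := by
      ext i j
      simp [A, symmOfUpper]
    rw [pnrStep, this]
  rw [e]
  exact measurable_fst.sub (((WithLp.measurable_toLp 2 _).comp hmv).const_smul η)

end Measurability

section Recursion

variable {q : ℝ → ℝ} {Δ ΔH ε' η : ℝ} {θ₀ : Param m}

instance : IsProbabilityMeasure (stepNoiseLaw m) := by unfold stepNoiseLaw; infer_instance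

instance (k : ℕ) : IsProbabilityMeasure (noiseLaw m k) := by unfold noiseLaw; infer_instance

lemma measurable_pnr (hst : Measurable fun p : Param m × StepNoise m =>
    pnrStep Θ f q Δ ΔH ε' η p.1 p.2) (k : ℕ) : Measurable (pnr Θ f q Δ ΔH ε' η θ₀ k) := by
  induction k with
  | zero => exact measurable_const
  | succ k ih =>
    have h1 : Measurable fun z : Fin (k + 1) → StepNoise m => fun i : Fin k => z i.castSucc := by
      fun_prop
    exact hst.comp ((ih.comp h1).prodMk (measurable_pi_apply (Fin.last k)))

/-- Markov property: the noise of the last step is independent of the current iterate. This is the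
form of disintegration that `OverlapGE.comp` asks for. -/
lemma lintegral_pnrLaw_succ (hst : Measurable fun p : Param m × StepNoise m =>
    pnrStep Θ f q Δ ΔH ε' η p.1 p.2) (k : ℕ) (h : Param m → ℝ≥0∞) (hh : Measurable h) :
    ∫⁻ y, h y ∂(pnrLaw Θ f q Δ ΔH ε' η θ₀ (k + 1)) =
      ∫⁻ θ, ∫⁻ y, h y ∂((stepNoiseLaw m).map (pnrStep Θ f q Δ ΔH ε' η θ))
        ∂(pnrLaw Θ f q Δ ΔH ε' η θ₀ k) := by
  have hmap : ∀ θ, ∫⁻ y, h y ∂((stepNoiseLaw m).map (pnrStep Θ f q Δ ΔH ε' η θ)) =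
      ∫⁻ z, h (pnrStep Θ f q Δ ΔH ε' η θ z) ∂(stepNoiseLaw m) := fun θ =>
    lintegral_map hh (hst.comp measurable_prodMk_left)
  have hin : Measurable fun θ => ∫⁻ z, h (pnrStep Θ f q Δ ΔH ε' η θ z) ∂(stepNoiseLaw m) :=
    (hh.comp hst).lintegral_prod_right'
  simp_rw [hmap]
  rw [pnrLaw, pnrLaw, lintegral_map hh (measurable_pnr hst _),
    lintegral_map hin (measurable_pnr hst k)]
  have hmp := measurePreserving_piFinSuccAbove (fun _ : Fin (k + 1) => stepNoiseLaw m) (Fin.last k)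
  have hm2 : Measurable fun w : StepNoise m × (Fin k → StepNoise m) =>
      h (pnrStep Θ f q Δ ΔH ε' η (pnr Θ f q Δ ΔH ε' η θ₀ k w.2) w.1) :=
    hh.comp (hst.comp (((measurable_pnr hst k).comp measurable_snd).prodMk measurable_fst))
  calc ∫⁻ z, h (pnr Θ f q Δ ΔH ε' η θ₀ (k + 1) z) ∂(noiseLaw m (k + 1))
      = ∫⁻ w, h (pnrStep Θ f q Δ ΔH ε' η (pnr Θ f q Δ ΔH ε' η θ₀ k w.2) w.1)
          ∂((stepNoiseLaw m).prod (noiseLaw m k)) := by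
        have := hmp.lintegral_comp hm2
        rw [noiseLaw]
        refine Eq.trans (lintegral_congr fun z => ?_) this
        have e : (Fin.last k).removeNth z = fun i => z i.castSucc := by
          ext1 i
          simp [Fin.removeNth]
        simp only [pnr, MeasurableEquiv.piFinSuccAbove_apply, Fin.insertNthEquiv_symm_apply, e]
    _ = _ := lintegral_prod_symm _ hm2.aemeasurable

end Recursion

section Gaussian

lemma overlapGE_pi_gaussian (a : Fin m → ℝ) :
    OverlapGE (ENNReal.ofReal (Real.exp (-(∑ i, a i ^ 2) / 8)))
      ((Measure.pi fun _ : Fin m => gaussianReal 0 1).map (· + a))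
      (Measure.pi fun _ : Fin m => gaussianReal 0 1) := by
  have hm : ∀ i, Measurable fun x : ℝ => x + a i := fun i => measurable_add_const _
  have : ∀ i, IsProbabilityMeasure ((gaussianReal 0 1).map fun x => x + a i) := fun i =>
    Measure.isProbabilityMeasure_map (hm i).aemeasurable
  have e := Measure.pi_map_pi (μ := fun _ : Fin m => gaussianReal 0 1)
    (f := fun i x => x + a i) fun i => (hm i).aemeasurable
  have e2 : (fun x : Fin m → ℝ => x + a) = fun x i => x i + a i := rfl
  rw [e2, e]
  have := OverlapGE.pi (fun i => (gaussianReal 0 1).map fun x => x + a i)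
    (fun _ => gaussianReal 0 1) (fun i => ENNReal.ofReal (Real.exp (-(a i) ^ 2 / 8)))
    (fun _ => ENNReal.ofReal_ne_top) fun i => by
      have := overlapGE_gaussian (a i) 0
      simpa using this
  rw [← ENNReal.ofReal_prod_of_nonneg fun _ _ => (Real.exp_nonneg _), ← Real.exp_sum] at this
  convert this using 3
  rw [← Finset.sum_neg_distrib, Finset.sum_div]

lemma overlapGE_pi_pi_gaussian (A : Fin m → Fin m → ℝ) :
    OverlapGE (ENNReal.ofReal (Real.exp (-(∑ i, ∑ j, A i j ^ 2) / 8)))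
      ((Measure.pi fun _ : Fin m => Measure.pi fun _ : Fin m => gaussianReal 0 1).map (· + A))
      (Measure.pi fun _ : Fin m => Measure.pi fun _ : Fin m => gaussianReal 0 1) := by
  have hm : ∀ i, Measurable fun x : Fin m → ℝ => x + A i := fun i => measurable_add_const _
  have : ∀ i, IsProbabilityMeasure
      ((Measure.pi fun _ : Fin m => gaussianReal 0 1).map fun x => x + A i) := fun i =>
    Measure.isProbabilityMeasure_map (hm i).aemeasurable
  have e := Measure.pi_map_pi (μ := fun _ : Fin m => Measure.pi fun _ : Fin m => gaussianReal 0 1)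
    (f := fun i x => x + A i) fun i => (hm i).aemeasurable
  have e2 : (fun x : Fin m → Fin m → ℝ => x + A) = fun x i => x i + A i := rfl
  rw [e2, e]
  have := OverlapGE.pi (fun i => (Measure.pi fun _ : Fin m => gaussianReal 0 1).map
      fun x => x + A i)
    (fun _ => Measure.pi fun _ : Fin m => gaussianReal 0 1)
    (fun i => ENNReal.ofReal (Real.exp (-(∑ j, A i j ^ 2) / 8)))
    (fun _ => ENNReal.ofReal_ne_top) fun i => overlapGE_pi_gaussian (A i)
  rw [← ENNReal.ofReal_prod_of_nonneg fun _ _ => (Real.exp_nonneg _), ← Real.exp_sum] at this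
  convert this using 3
  rw [← Finset.sum_neg_distrib, Finset.sum_div]

/-- The vector noise and the matrix noise are independent, so their affinities multiply and each
query costs one factor. -/
lemma overlapGE_stepNoiseLaw (a : Fin m → ℝ) (A : Fin m → Fin m → ℝ) {t : ℝ}
    (ha : ∑ i, a i ^ 2 ≤ t) (hA : ∑ i, ∑ j, A i j ^ 2 ≤ t) :
    OverlapGE (ENNReal.ofReal (Real.exp (-t / 8) * Real.exp (-t / 8)))
      ((stepNoiseLaw m).map fun z => (z.1 + a, z.2 + A)) (stepNoiseLaw m) := by
  have e : (stepNoiseLaw m).map (fun z => (z.1 + a, z.2 + A)) =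
      ((Measure.pi fun _ : Fin m => gaussianReal 0 1).map (· + a)).prod
      ((Measure.pi fun _ : Fin m => Measure.pi fun _ : Fin m => gaussianReal 0 1).map (· + A)) := by
    rw [stepNoiseLaw, Measure.map_prod_map _ _ (measurable_add_const a) (measurable_add_const A)]
    rfl
  rw [e, ENNReal.ofReal_mul (Real.exp_nonneg _)]
  refine OverlapGE.prod ENNReal.ofReal_ne_top ((overlapGE_pi_gaussian a).mono ?_)
    ((overlapGE_pi_pi_gaussian A).mono ?_) <;>
  exact ENNReal.ofReal_le_ofReal (Real.exp_le_exp.2 (by linarith))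

/-- The multiplier is calibrated so that a shift of squared length 1/c² leaves affinity exactly 1 -
s/2. -/
lemma noiseMult_sq {s : ℝ} (h0 : 0 < s) (h1 : s ≤ 1) :
    0 < noiseMult s ∧ Real.exp (-(1 / noiseMult s ^ 2) / 8) = 1 - s / 2 := by
  have hl : Real.log (1 - 0.5 * s) < 0 := Real.log_neg (by linarith) (by linarith)
  have hp : 0 < 1 / (-8 * Real.log (1 - 0.5 * s)) := by
    apply one_div_pos.2; linarith
  refine ⟨Real.sqrt_pos.2 hp, ?_⟩
  rw [noiseMult, Real.sq_sqrt hp.le, one_div_one_div, show -(-8 * Real.log (1 - 0.5 * s)) / 8 =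
    Real.log (1 - 0.5 * s) by ring, Real.exp_log (by linarith)]
  ring

end Gaussian

/-- The recursion for h_k is the multiplication of affinities, rewritten in terms of squared
distances. -/
lemma one_sub_compLevel (k : ℕ) (x : ℝ) : 1 - compLevel k x / 2 = (1 - x / 2) ^ k := by
  induction k with
  | zero => simp [compLevel]
  | succ k ih =>
    rw [pow_succ, ← ih, compLevel]
    ring

section Privacy

variable {K : ℝ → ℝ} {c p q B C Δ ΔH ε' : ℝ}

/-- A change of the query within the sensitivity is absorbed by translating the unit noise by the
change divided by Δs. When Δ = 0 no noise is added, but then the query does not change either. -/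
lemma exists_noise_shift {ι : Type*} [Fintype ι] {x y : ι → ℝ} {Δ s : ℝ} (hs : 0 < s)
    (h : √(∑ i, (x i - y i) ^ 2) ≤ Δ) :
    ∃ a : ι → ℝ, (∀ i, x i = y i + Δ * s * a i) ∧ ∑ i, a i ^ 2 ≤ 1 / s ^ 2 := by
  have hΔ : 0 ≤ Δ := (Real.sqrt_nonneg _).trans h
  have hsum : ∑ i, (x i - y i) ^ 2 ≤ Δ ^ 2 := (Real.sqrt_le_left hΔ).1 h
  rcases hΔ.eq_or_lt with rfl | hpos
  · refine ⟨0, fun i => ?_, by simp [sq_nonneg]⟩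
    have h0 : (x i - y i) ^ 2 ≤ 0 := (Finset.single_le_sum (f := fun i => (x i - y i) ^ 2)
      (fun _ _ => sq_nonneg _) (Finset.mem_univ i)).trans (by simpa using hsum)
    have : x i - y i = 0 := pow_eq_zero_iff two_ne_zero |>.1 (le_antisymm h0 (sq_nonneg _))
    simp only [zero_mul, add_zero]
    linarith
  · refine ⟨fun i => (x i - y i) / (Δ * s), fun i => by field_simp; ring, ?_⟩
    simp_rw [div_pow]
    rw [← Finset.sum_div, div_le_div_iff₀ (by positivity) (by positivity)]
    nlinarith [sq_nonneg s, mul_le_mul_of_nonneg_right hsum (sq_nonneg s)]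

/-- The matrix noise reads only the upper triangle, so a translation of it can reproduce exactly the
symmetric perturbations. Hessians are symmetric, which suffices. -/
lemma symmOfUpper_add_of_symm {G A : Fin m → Fin m → ℝ} (hA : ∀ i j, A i j = A j i) :
    symmOfUpper (G + A) = symmOfUpper G + Matrix.of A := by
  ext i j
  simp only [symmOfUpper, Matrix.of_apply, Pi.add_apply, Matrix.add_apply]
  rcases le_total i j with h | h
  · simp [h]
  · simp [h, hA i j]

/-- One step with the queries of `q` is one step with those of `q'` and shifted noise. -/
lemma exists_pnrStep_shift {q q' : ℝ → ℝ} (hM : MomentBound Θ U f C) {η : ℝ} {θ : Param m}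
    (hs : 0 < noiseMult (ε' / 2)) (hΔH0 : 0 ≤ ΔH)
    (hG : θ ∈ Θ → ‖lossGrad f q θ - lossGrad f q' θ‖ ≤ Δ)
    (hH : θ ∈ Θ → √(∑ i, ∑ j, (lossHess f q θ i j - lossHess f q' θ i j) ^ 2) ≤ ΔH) :
    ∃ (a : Fin m → ℝ) (A : Fin m → Fin m → ℝ), ∑ i, a i ^ 2 ≤ 1 / noiseMult (ε' / 2) ^ 2 ∧
      ∑ i, ∑ j, A i j ^ 2 ≤ 1 / noiseMult (ε' / 2) ^ 2 ∧
      ∀ z : StepNoise m, pnrStep Θ f q Δ ΔH ε' η θ z =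
        pnrStep Θ f q' Δ ΔH ε' η θ (z.1 + a, z.2 + A) := by
  by_cases hθ : θ ∈ Θ
  · obtain ⟨a, ha, ha2⟩ := exists_noise_shift (x := fun i => lossGrad f q θ i)
      (y := fun i => lossGrad f q' θ i) (Δ := Δ) hs (by
        have := hG hθ
        rw [EuclideanSpace.norm_eq] at this
        simpa [sq_abs] using this)
    obtain ⟨A, hA, hA2⟩ := exists_noise_shift
      (x := fun ij : Fin m × Fin m => lossHess f q θ ij.1 ij.2)
      (y := fun ij : Fin m × Fin m => lossHess f q' θ ij.1 ij.2) (Δ := ΔH) hs (by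
        rw [Fintype.sum_prod_type]
        exact hH hθ)
    -- the shift is symmetrized, which does not change its norm bound when the scale vanishes
    rcases hΔH0.eq_or_lt with h0 | hpos
    · refine ⟨a, 0, ha2, by simp [sq_nonneg], fun z => ?_⟩
      have : lossHess f q θ = lossHess f q' θ := by
        ext i j
        simpa [← h0] using hA (i, j)
      simp only [pnrStep, Set.indicator_of_mem hθ, this, add_zero, Pi.add_apply]
      simp only [ha, mul_add]
      congr 4
      ext i
      ring
    -- A positive scale determines A from the two Hessians, so A inherits their symmetry.
    · have hsymm : ∀ i j, A (i, j) = A (j, i) := by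
        intro i j
        have h1 := hA (i, j)
        have h2 := hA (j, i)
        simp only at h1 h2
        rw [hM.lossHess_symm q hθ, hM.lossHess_symm q' hθ, h2] at h1
        have : ΔH * noiseMult (ε' / 2) * A (i, j) = ΔH * noiseMult (ε' / 2) * A (j, i) := by
          linarith
        exact mul_left_cancel₀ (by positivity) this
      refine ⟨a, fun i j => A (i, j), ha2, by rwa [← Fintype.sum_prod_type'], fun z => ?_⟩
      have : lossHess f q θ = lossHess f q' θ +
          (ΔH * noiseMult (ε' / 2)) • Matrix.of (fun i j => A (i, j)) := by
        ext i j
        simpa using hA (i, j)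
      simp only [pnrStep, Set.indicator_of_mem hθ, this,
        symmOfUpper_add_of_symm hsymm, Pi.add_apply, smul_add]
      simp only [ha, mul_add]
      congr 4
      · rw [add_assoc, add_comm ((ΔH * noiseMult (ε' / 2)) • Matrix.of _)]
      · ext i
        ring
  -- Outside Θ both queries return zero whatever the data, so no shift is needed.
  · refine ⟨0, 0, by simp [sq_nonneg], by simp [sq_nonneg], fun z => ?_⟩
    simp [pnrStep, hθ]

/-- Conditionally on the current iterate, one step with q is the image of shifted noise under the
step map of q'. Data processing handles the step and adaptive composition the iteration. -/
lemma overlapGE_pnrLaw {q q' : ℝ → ℝ} (hM : MomentBound Θ U f C) (hΘ : IsClosed Θ)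
    (hq : IsSubDensity q) (hq' : IsSubDensity q') (hε : 0 < ε') (hε2 : ε' ≤ 2)
    (hΔH0 : 0 ≤ ΔH)
    (hG : ∀ θ ∈ Θ, ‖lossGrad f q θ - lossGrad f q' θ‖ ≤ Δ)
    (hH : ∀ θ ∈ Θ, √(∑ i, ∑ j, (lossHess f q θ i j - lossHess f q' θ i j) ^ 2) ≤ ΔH)
    (η : ℝ) (θ₀ : Param m) (k : ℕ) :
    OverlapGE (ENNReal.ofReal ((1 - ε' / 2) ^ k)) (pnrLaw Θ f q Δ ΔH ε' η θ₀ k)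
      (pnrLaw Θ f q' Δ ΔH ε' η θ₀ k) := by
  have hst := measurable_pnrStep hM hΘ hq Δ ΔH ε' η
  have hst' := measurable_pnrStep hM hΘ hq' Δ ΔH ε' η
  obtain ⟨hs0, hs1⟩ := noiseMult_sq (s := ε' / 2) (by linarith) (by linarith)
  have h0 : 0 ≤ 1 - ε' / 2 := by linarith
  induction k with
  | zero =>
    have : IsProbabilityMeasure (pnrLaw Θ f q Δ ΔH ε' η θ₀ 0) :=
      Measure.isProbabilityMeasure_map (measurable_pnr hst 0).aemeasurable
    have := OverlapGE.refl (pnrLaw Θ f q Δ ΔH ε' η θ₀ 0)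
    simpa [pnrLaw, pnr] using this
  | succ k ih =>
    rw [pow_succ, ENNReal.ofReal_mul (by positivity)]
    refine ih.comp ENNReal.ofReal_ne_top
      (κ := fun θ => (stepNoiseLaw m).map (pnrStep Θ f q Δ ΔH ε' η θ))
      (κ' := fun θ => (stepNoiseLaw m).map (pnrStep Θ f q' Δ ΔH ε' η θ)) (fun θ => ?_) ?_
      (lintegral_pnrLaw_succ hst k) (lintegral_pnrLaw_succ hst' k)
    · obtain ⟨a, A, ha, hA, hz⟩ := exists_pnrStep_shift (η := η) hM hs0 hΔH0 (hG θ) (hH θ)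
      have hT : Measurable (pnrStep Θ f q' Δ ΔH ε' η θ) := hst'.comp measurable_prodMk_left
      have hT2 : Measurable fun z : StepNoise m => (z.1 + a, z.2 + A) := by fun_prop
      have h1 := (overlapGE_stepNoiseLaw a A ha hA).map hT
      rw [Measure.map_map hT hT2, hs1] at h1
      have e : (pnrStep Θ f q' Δ ΔH ε' η θ ∘ fun z : StepNoise m => (z.1 + a, z.2 + A)) =
          pnrStep Θ f q Δ ΔH ε' η θ := funext fun z => (hz z).symm
      rw [e] at h1
      refine h1.mono (ENNReal.ofReal_le_ofReal ?_)
      -- The two queries at level ε'/2 give (1 - ε'/4)², which is at least 1 - ε'/2.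
      nlinarith [sq_nonneg ε']
    · intro h hh
      have : ∀ θ, ∫⁻ y, h y ∂((stepNoiseLaw m).map (pnrStep Θ f q Δ ΔH ε' η θ)) =
          ∫⁻ z, h (pnrStep Θ f q Δ ΔH ε' η θ z) ∂(stepNoiseLaw m) := fun θ =>
        lintegral_map hh (hst.comp measurable_prodMk_left)
      simp_rw [this]
      exact (hh.comp hst).lintegral_prod_right'

lemma isHDP_pnrLaw (hM : MomentBound Θ U f C) (hΘ : IsClosed Θ) (hB : ConjBound Θ f p q B)
    (hK : IsDensity K) (hs : HasCompactSupport K) (hc : 0 < c) (b : ℝ) (n : ℕ)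
    (hΔ : gradSens Θ f K c b n ≤ Δ) (hΔH : hessSens Θ f K c b n ≤ ΔH) {ε η : ℝ}
    (hε : 0 < ε') (hε2 : ε' ≤ 2) (θ₀ : Param m) (k : ℕ) (hk : compLevel k ε' ≤ ε) :
    IsHDP ε fun D : Fin n → ℝ => pnrLaw Θ f (truncKDE K c b D) Δ ΔH ε' η θ₀ k := by
  have hsub := fun D : Fin n → ℝ => isSubDensity_truncKDE hK hc b D
  have hprob : ∀ D : Fin n → ℝ,
      IsProbabilityMeasure (pnrLaw Θ f (truncKDE K c b D) Δ ΔH ε' η θ₀ k) := fun D =>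
    Measure.isProbabilityMeasure_map
      (measurable_pnr (measurable_pnrStep hM hΘ (hsub D) Δ ΔH ε' η) k).aemeasurable
  refine ⟨hprob, fun D D' hD => ?_⟩
  have hs2 : 0 ≤ hessSens Θ f K c b n := by
    refine Real.sSup_nonneg ?_
    rintro _ ⟨_, _, _, _, _, rfl⟩
    positivity
  have h := overlapGE_pnrLaw hM hΘ (hsub D) (hsub D') hε hε2 (hs2.trans hΔH)
    (fun θ hθ => (norm_lossGrad_truncKDE_sub_le_gradSens hM hB hK hs hc b hD hθ).trans hΔ)
    (fun θ hθ => (frobenius_lossHess_truncKDE_sub_le_hessSens hM hB hK hs hc b hD hθ).trans hΔH)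
    η θ₀ k
  have h2 := hellDist_le_of_overlapGE h
  have h3 := one_sub_compLevel k ε'
  linarith

end Privacy

end PMHDE

/-! ### Bias and variance of the density estimator -/

namespace PMHDE

/-- Translation is continuous in `L¹`. -/
lemma tendsto_lintegral_sub_translate {g : ℝ → ℝ} (hg : Integrable g) (hgm : Measurable g) :
    Tendsto (fun s : ℝ => ∫⁻ x, ‖g x - g (x - s)‖ₑ) (𝓝 0) (𝓝 0) := by
  rw [ENNReal.tendsto_nhds_zero]
  intro ε hε
  have hε3 : ε / 3 ≠ 0 := (ENNReal.div_pos hε.ne' ENNReal.ofNat_ne_top).ne'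
  -- Uniform continuity is easy for continuous functions of compact support, and these are dense in
  -- L¹; translation preserves the approximation error.
  obtain ⟨φ, hφs, hφ, hφc, -⟩ := hg.exists_hasCompactSupport_lintegral_sub_le hε3
  have hφm := hφc.measurable
  have hlim : Tendsto (fun s : ℝ => ∫⁻ x, ‖φ x - φ (x - s)‖ₑ) (𝓝 0) (𝓝 (∫⁻ _ : ℝ, 0)) := by
    obtain ⟨B, hB⟩ := hφc.bounded_above_of_compact_support hφs
    obtain ⟨R, hR⟩ := hφs.isCompact.isBounded.subset_closedBall 0
    have hout : ∀ x, R < |x| → φ x = 0 := fun x hx => by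
      refine image_eq_zero_of_notMem_tsupport fun h => ?_
      have := hR h
      rw [mem_closedBall_zero_iff, Real.norm_eq_abs] at this
      linarith
    refine tendsto_lintegral_filter_of_dominated_convergence
      -- For |s| < 1 both φ and its translate vanish beyond R + 1, so a constant on this interval
      -- dominates.
      (bound := (Set.Icc (-(R + 1)) (R + 1)).indicator fun _ => ENNReal.ofReal (B + B)) ?_ ?_ ?_ ?_
    · exact Eventually.of_forall fun s => (hφm.sub (hφm.comp (measurable_sub_const s))).enorm
    · have h1 : ∀ᶠ s : ℝ in 𝓝 0, |s| < 1 := by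
        have := (continuous_abs (G := ℝ)).tendsto 0
        rw [abs_zero] at this
        exact this.eventually (gt_mem_nhds zero_lt_one)
      filter_upwards [h1] with s hs
      refine ae_of_all _ fun x => ?_
      by_cases hx : x ∈ Set.Icc (-(R + 1)) (R + 1)
      · rw [Set.indicator_of_mem hx, ← ofReal_norm]
        exact ENNReal.ofReal_le_ofReal ((norm_sub_le _ _).trans (add_le_add (hB _) (hB _)))
      · rw [Set.indicator_of_notMem hx]
        have hx1 : R + 1 < |x| := by
          by_contra h
          exact hx (abs_le.1 (not_lt.1 h))
        have hx2 : R < |x - s| := by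
          have := abs_sub_abs_le_abs_sub x s
          linarith
        simp [hout x (by linarith), hout _ hx2]
    · rw [lintegral_indicator measurableSet_Icc]
      simp only [lintegral_const, Measure.restrict_apply_univ, Real.volume_Icc]
      exact ENNReal.mul_ne_top ENNReal.ofReal_ne_top ENNReal.ofReal_ne_top
    · refine ae_of_all _ fun x => ?_
      have : Continuous fun s => ‖φ x - φ (x - s)‖ₑ :=
        (continuous_const.sub (hφc.comp (continuous_const.sub continuous_id))).enorm
      simpa using this.tendsto 0
  rw [lintegral_zero] at hlim
  filter_upwards [(ENNReal.tendsto_nhds_zero.1 hlim) (ε / 3) (pos_iff_ne_zero.2 hε3)] with s hs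
  have hshift : ∫⁻ x, ‖g (x - s) - φ (x - s)‖ₑ = ∫⁻ x, ‖g x - φ x‖ₑ :=
    lintegral_sub_right_eq_self (fun x => ‖g x - φ x‖ₑ) s
  have hm1 : Measurable fun x => ‖g x - φ x‖ₑ := (hgm.sub hφm).enorm
  have hm2 : Measurable fun x => ‖φ x - φ (x - s)‖ₑ :=
    (hφm.sub (hφm.comp (measurable_sub_const s))).enorm
  calc ∫⁻ x, ‖g x - g (x - s)‖ₑ
      ≤ ∫⁻ x, ((‖g x - φ x‖ₑ + ‖φ x - φ (x - s)‖ₑ) + ‖g (x - s) - φ (x - s)‖ₑ) := by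
        refine lintegral_mono fun x => ?_
        have e : g x - g (x - s) = (g x - φ x) + (φ x - φ (x - s)) - (g (x - s) - φ (x - s)) := by
          ring
        rw [e]
        exact enorm_sub_le.trans (add_le_add (enorm_add_le _ _) le_rfl)
    _ = (∫⁻ x, ‖g x - φ x‖ₑ) + (∫⁻ x, ‖φ x - φ (x - s)‖ₑ) + ∫⁻ x, ‖g x - φ x‖ₑ := by
        rw [lintegral_add_left (f := fun x => ‖g x - φ x‖ₑ + ‖φ x - φ (x - s)‖ₑ) (hm1.add hm2),
          lintegral_add_left hm1, hshift]
    _ ≤ ε / 3 + ε / 3 + ε / 3 := add_le_add (add_le_add hφ hs) hφ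
    _ = ε := ENNReal.add_thirds ε

/-- The law with density `g`. -/
noncomputable def densityLaw (g : ℝ → ℝ) : Measure ℝ :=
  volume.withDensity fun x => ENNReal.ofReal (g x)

lemma IsDensity.isProbabilityMeasure {g : ℝ → ℝ} (hg : IsDensity g) :
    IsProbabilityMeasure (densityLaw g) := by
  refine ⟨?_⟩
  rw [densityLaw, withDensity_apply _ MeasurableSet.univ, Measure.restrict_univ,
    ← ofReal_integral_eq_lintegral_ofReal hg.integrable (ae_of_all _ hg.nonneg),
    hg.integral_eq_one, ENNReal.ofReal_one]

lemma IsDensity.isProbabilityMeasure_sampleLaw {g : ℝ → ℝ} (hg : IsDensity g) (n : ℕ) :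
    IsProbabilityMeasure (sampleLaw g n) := by
  have := hg.isProbabilityMeasure
  exact inferInstanceAs (IsProbabilityMeasure (Measure.pi fun _ : Fin n => densityLaw g))

/-- The expectation of the truncated density estimator. -/
noncomputable def meanKDE (g K : ℝ → ℝ) (c b x : ℝ) : ℝ :=
  ∫ t, K t * (Set.Ioo (-b) b).indicator g (x - c * t)

/-- The kernel cut off at the level `M`. -/
structure IsBoundedKernel (K : ℝ → ℝ) (M R : ℝ) : Prop where
  measurable : Measurable K
  nonneg : ∀ x, 0 ≤ K x
  le : ∀ x, K x ≤ M
  integrable : Integrable K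
  support : ∀ x, R < |x| → K x = 0

section Mean

variable {g K : ℝ → ℝ} {M R c : ℝ} (hg : IsDensity g) (hK : IsBoundedKernel K M R)
include hg hK

lemma integrable_mul_translate (hc : 0 < c) (b x : ℝ) :
    Integrable fun t => K t * (Set.Ioo (-b) b).indicator g (x - c * t) := by
  have h1 : Integrable ((Set.Ioo (-b) b).indicator g) := hg.integrable.indicator measurableSet_Ioo
  have h2 : Integrable fun t => (Set.Ioo (-b) b).indicator g (x - c * t) :=
    (h1.comp_sub_left x).comp_mul_left' hc.ne'
  refine h2.bdd_mul (c := M) hK.measurable.aestronglyMeasurable (ae_of_all _ fun t => ?_)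
  rw [Real.norm_of_nonneg (hK.nonneg t)]
  exact hK.le t

omit hK in
-- The substitution d = x - ct cancels the bandwidth in the normalization of the bump.
lemma integral_kernelBump_densityLaw (hc : 0 < c) (b : ℝ) {n : ℕ} (x : ℝ) :
    ∫ d, kernelBump K c b n d x ∂(densityLaw g) = 1 / n * meanKDE g K c b x := by
  have h1 : ∫ d, kernelBump K c b n d x ∂(densityLaw g) =
      ∫ d, g d * kernelBump K c b n d x := by
    rw [densityLaw, integral_withDensity_eq_integral_toReal_smul
      (hg.measurable.ennreal_ofReal) (ae_of_all _ fun _ => ENNReal.ofReal_lt_top)]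
    simp only [ENNReal.toReal_ofReal (hg.nonneg _), smul_eq_mul]
  rw [h1, ← integral_sub_left_eq_self (fun d => g d * kernelBump K c b n d x) volume x]
  have h2 := Measure.integral_comp_mul_left
    (fun d => g (x - d) * kernelBump K c b n (x - d) x) c
  rw [abs_of_pos (inv_pos.2 hc), smul_eq_mul] at h2
  have h3 : ∫ d, g (x - d) * kernelBump K c b n (x - d) x =
      c * ∫ t, g (x - c * t) * kernelBump K c b n (x - c * t) x := by
    rw [h2]; field_simp
  rw [h3, meanKDE, ← integral_const_mul, ← integral_const_mul]
  refine integral_congr_ae (ae_of_all _ fun t => ?_)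
  simp only [kernelBump, sub_sub_cancel, mul_div_cancel_left₀ _ hc.ne']
  by_cases hx : x - c * t ∈ Set.Ioo (-b) b
  · simp only [Set.indicator_of_mem hx, Pi.one_apply]
    field_simp
  · simp only [Set.indicator_of_notMem hx]
    ring

lemma measurable_meanKDE (b : ℝ) : Measurable (meanKDE g K c b) := by
  have : StronglyMeasurable (Function.uncurry fun x t : ℝ =>
      K t * (Set.Ioo (-b) b).indicator g (x - c * t)) := by
    refine Measurable.stronglyMeasurable ?_
    refine (hK.measurable.comp measurable_snd).mul
      ((hg.measurable.indicator measurableSet_Ioo).comp ?_)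
    fun_prop
  exact this.integral_prod_right.measurable

/-- The bias of the density estimator. -/
lemma lintegral_bias_le (hc : 0 < c) (b : ℝ) {ω : ℝ≥0∞}
    (hω : ∀ t, |t| ≤ R → ∫⁻ x, ‖g x - g (x - c * t)‖ₑ ≤ ω) :
    ∫⁻ x, ‖(∫ t, K t) * g x - meanKDE g K c b x‖ₑ ≤
      ENNReal.ofReal (∫ t, K t) * (ω + ∫⁻ x, ‖g x - (Set.Ioo (-b) b).indicator g x‖ₑ) := by
  set gb := (Set.Ioo (-b) b).indicator g with hgb
  have hgbm : Measurable gb := hg.measurable.indicator measurableSet_Ioo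
  have hpt : ∀ x, ‖(∫ t, K t) * g x - meanKDE g K c b x‖ₑ ≤
      ∫⁻ t, ‖K t‖ₑ * ‖g x - gb (x - c * t)‖ₑ := by
    intro x
    have : (∫ t, K t) * g x - meanKDE g K c b x = ∫ t, K t * (g x - gb (x - c * t)) := by
      simp_rw [mul_sub]
      rw [meanKDE, integral_sub (hK.integrable.mul_const _) (integrable_mul_translate hg hK hc b x),
        integral_mul_const]
    rw [this]
    refine (enorm_integral_le_lintegral_enorm _).trans (le_of_eq ?_)
    simp_rw [enorm_mul]
  have hjm : Measurable (Function.uncurry fun x t : ℝ => ‖K t‖ₑ * ‖g x - gb (x - c * t)‖ₑ) := by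
    refine (hK.measurable.comp measurable_snd).enorm.mul
      (((hg.measurable.comp measurable_fst).sub (hgbm.comp ?_)).enorm)
    fun_prop
  calc ∫⁻ x, ‖(∫ t, K t) * g x - meanKDE g K c b x‖ₑ
      ≤ ∫⁻ x, ∫⁻ t, ‖K t‖ₑ * ‖g x - gb (x - c * t)‖ₑ := lintegral_mono hpt
    _ = ∫⁻ t, ∫⁻ x, ‖K t‖ₑ * ‖g x - gb (x - c * t)‖ₑ := lintegral_lintegral_swap hjm.aemeasurable
    -- For each t in the support the error splits into a translation error and a truncation error,
    -- and the latter is independent of t by translation invariance.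
    _ ≤ ∫⁻ t, ‖K t‖ₑ * (ω + ∫⁻ x, ‖g x - gb x‖ₑ) := by
        refine lintegral_mono fun t => ?_
        by_cases ht : |t| ≤ R
        · rw [lintegral_const_mul' _ _ enorm_ne_top]
          gcongr
          have hs : ∫⁻ x, ‖g (x - c * t) - gb (x - c * t)‖ₑ = ∫⁻ x, ‖g x - gb x‖ₑ :=
            lintegral_sub_right_eq_self (fun x => ‖g x - gb x‖ₑ) (c * t)
          rw [← hs]
          refine le_trans ?_ (add_le_add (hω t ht) le_rfl)
          rw [← lintegral_add_left (f := fun x => ‖g x - g (x - c * t)‖ₑ)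
            (hg.measurable.sub (hg.measurable.comp (measurable_sub_const _))).enorm]
          refine lintegral_mono fun x => ?_
          have : g x - gb (x - c * t) =
              (g x - g (x - c * t)) + (g (x - c * t) - gb (x - c * t)) := by ring
          rw [this]
          exact enorm_add_le _ _
        · simp [hK.support t (not_le.1 ht)]
    _ = _ := by
        rw [lintegral_mul_const _ hK.measurable.enorm,
          ofReal_integral_eq_lintegral_ofReal hK.integrable (ae_of_all _ hK.nonneg)]
        congr 1
        refine lintegral_congr fun t => ?_
        rw [← ofReal_norm, Real.norm_of_nonneg (hK.nonneg t)]

/-- The pointwise standard deviation of the density estimator. -/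
lemma lintegral_truncKDE_sub_mean_le (hM : 0 < M) (hc : 0 < c) (b : ℝ) {n : ℕ} (hn : 0 < n)
    (x : ℝ) : ∫⁻ D, ‖meanKDE g K c b x - truncKDE K c b D x‖ₑ ∂(sampleLaw g n) ≤
      ENNReal.ofReal (M / (√n * c)) := by
  have := hg.isProbabilityMeasure
  change ∫⁻ D, _ ∂(Measure.pi fun _ : Fin n => densityLaw g) ≤ _
  set ν : Measure (Fin n → ℝ) := Measure.pi fun _ : Fin n => densityLaw g with hν
  have hn' : (0 : ℝ) < n := by exact_mod_cast hn
  set φ : ℝ → ℝ := fun d => kernelBump K c b n d x with hφ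
  have hφm : Measurable φ := by
    simp only [hφ, kernelBump]
    refine ((hK.measurable.comp (by fun_prop)).mul ?_).const_mul _
    exact measurable_one.indicator measurableSet_Ioo
  have hφ0 : ∀ d, 0 ≤ φ d := fun d => kernelBump_nonneg hK.nonneg hc b n d x
  have hφM : ∀ d, φ d ≤ M / (n * c) := fun d => by
    refine (kernelBump_le hK.nonneg hc b n d x).trans ?_
    rw [one_div, inv_mul_eq_div]
    gcongr
    exact hK.le _
  have hφL : MemLp φ 2 (densityLaw g) := by
    refine MemLp.of_bound hφm.aestronglyMeasurable (M / (n * c)) (ae_of_all _ fun d => ?_)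
    rw [Real.norm_of_nonneg (hφ0 d)]
    exact hφM d
  set Z : (Fin n → ℝ) → ℝ := ∑ i, fun D : Fin n → ℝ => φ (D i) with hZ
  have hZe : ∀ D, truncKDE K c b D x = Z D := fun D => by
    rw [truncKDE_eq_sum, hZ, Finset.sum_apply]
  have hZL : MemLp Z 2 (ν) :=
    memLp_finsetSum' _ fun i _ => hφL.comp_measurePreserving (measurePreserving_eval _ i)
  -- Each of the n independent bumps is at most M/(nc), so the variance of the sum is at most
  -- n(M/(nc))².
  have hvar : Var[Z; ν] ≤ (M / (√n * c)) ^ 2 := by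
    have h1 := variance_sum_pi (μ := fun _ : Fin n => densityLaw g) (X := fun _ => φ) fun _ => hφL
    have h2 : Var[φ; densityLaw g] ≤ (M / (n * c)) ^ 2 := by
      refine (variance_le_expectation_sq hφm.aestronglyMeasurable).trans ?_
      calc ∫ d, (φ ^ 2) d ∂(densityLaw g) ≤ ∫ _, (M / (n * c)) ^ 2 ∂(densityLaw g) := by
            refine integral_mono_of_nonneg (ae_of_all _ fun d => sq_nonneg _)
              (integrable_const _) (ae_of_all _ fun d => ?_)
            exact pow_le_pow_left₀ (hφ0 d) (hφM d) 2
        _ = _ := by simp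
    have h3 : Var[Z; ν] = n * Var[φ; densityLaw g] := by
      refine h1.trans ?_
      simp
    rw [h3]
    calc (n : ℝ) * Var[φ; densityLaw g] ≤ n * (M / (n * c)) ^ 2 := by gcongr
      _ = _ := by
        rw [div_pow, div_pow, mul_pow, mul_pow, Real.sq_sqrt hn'.le]
        field_simp
  have hmean : (ν)[Z] = meanKDE g K c b x := by
    have h1 : ∀ i : Fin n, ∫ D, φ (D i) ∂(ν) = 1 / n * meanKDE g K c b x := by
      intro i
      rw [← integral_kernelBump_densityLaw hg hc b x]
      have hmp := measurePreserving_eval (fun _ : Fin n => densityLaw g) i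
      rw [← hmp.map_eq, integral_map hmp.measurable.aemeasurable hφm.aestronglyMeasurable]
    have h2 : ∫ D, Z D ∂(ν) = ∑ i : Fin n, ∫ D, φ (D i) ∂(ν) := by
      simp only [hZ, Finset.sum_apply]
      refine integral_finsetSum _ fun i _ => ?_
      exact (hφL.comp_measurePreserving (measurePreserving_eval _ i)).integrable one_le_two
    rw [h2, Finset.sum_congr rfl fun i _ => h1 i]
    simp only [Finset.sum_const, Finset.card_univ, Fintype.card_fin, nsmul_eq_mul]
    field_simp
  set s := M / (√n * c) with hs
  have hs0 : 0 < s := by positivity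
  have hdev : Integrable (fun D => meanKDE g K c b x - Z D) (ν) :=
    (integrable_const _).sub (hZL.integrable one_le_two)
  have hsq : Integrable (fun D => (Z D - (ν)[Z]) ^ 2) (ν) :=
    (hZL.sub (memLp_const _)).integrable_sq
  -- The elementary bound |y| ≤ s/2 + y²/(2s), with s the bound for the standard deviation, replaces
  -- Cauchy-Schwarz.
  have hE : ∫ D, ‖meanKDE g K c b x - Z D‖ ∂(ν) ≤ s := by
    calc ∫ D, ‖meanKDE g K c b x - Z D‖ ∂(ν)
        ≤ ∫ D, (s / 2 + (Z D - (ν)[Z]) ^ 2 * (1 / (2 * s))) ∂(ν) := by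
          refine integral_mono hdev.norm ((integrable_const _).add (hsq.mul_const _)) fun D => ?_
          simp only
          rw [hmean, Real.norm_eq_abs, abs_sub_comm, ← sq_abs (Z D - _)]
          set t := |Z D - meanKDE g K c b x|
          rw [← sub_nonneg]
          have : s / 2 + t ^ 2 * (1 / (2 * s)) - t = (s - t) ^ 2 / (2 * s) := by
            field_simp; ring
          rw [this]
          positivity
      _ = s / 2 + Var[Z; ν] * (1 / (2 * s)) := by
          rw [integral_add (integrable_const _) (hsq.mul_const _), integral_mul_const,
            ← variance_eq_integral hZL.aestronglyMeasurable.aemeasurable]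
          simp
      _ ≤ s / 2 + s ^ 2 * (1 / (2 * s)) := by gcongr
      _ = s := by field_simp; ring
  simp_rw [hZe]
  rw [← ofReal_integral_norm_eq_lintegral_enorm hdev]
  exact ENNReal.ofReal_le_ofReal hE

end Mean

end PMHDE

/-! ### Hellinger consistency of the density estimator -/

namespace PMHDE

/-- Since √(gq) ≥ min(g, q) = g - (g-q)⁺, the affinity is at least 1 - η, and the mass of q is at
most one. Only the deficit of q below g has to be controlled, not its excess. -/
lemma hellSq_le_of_lintegral_sub_le {q g : ℝ → ℝ} (hq : IsSubDensity q) (hg : IsDensity g) {η : ℝ}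
    (hη : 0 ≤ η) (h : ∫⁻ x, ENNReal.ofReal (g x - q x) ≤ ENNReal.ofReal η) :
    hellSq q g ≤ 2 * η := by
  have hsub := hg.isSubDensity
  have hmi : Integrable fun x => max (g x - q x) 0 := (hg.integrable.sub hq.integrable).pos_part
  have h1 : ∫ x, max (g x - q x) 0 ≤ η := by
    rw [← ENNReal.ofReal_le_ofReal_iff hη,
      ofReal_integral_eq_lintegral_ofReal hmi (ae_of_all _ fun x => le_max_right _ _)]
    refine le_trans (le_of_eq (lintegral_congr fun x => ?_)) h
    rcases le_total (g x - q x) 0 with h | h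
    · simp [h, ENNReal.ofReal_of_nonpos h]
    · simp [h]
  have hsi := integrable_sqrt_mul_sqrt hg.measurable hq.measurable hg.nonneg hq.nonneg
    hg.integrable hq.integrable
  have h2 : ∫ x, (g x - max (g x - q x) 0) ≤ ∫ x, √(g x) * √(q x) := by
    refine integral_mono (hg.integrable.sub hmi) hsi fun x => ?_
    have hg0 := hg.nonneg x
    have hq0 := hq.nonneg x
    simp only
    rcases le_total (g x) (q x) with h | h
    · rw [max_eq_right (by linarith), sub_zero]
      calc g x = √(g x) * √(g x) := (Real.mul_self_sqrt hg0).symm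
        _ ≤ _ := by gcongr
    · rw [max_eq_left (by linarith), sub_sub_cancel]
      calc q x = √(q x) * √(q x) := (Real.mul_self_sqrt hq0).symm
        _ ≤ _ := by gcongr
  rw [integral_sub hg.integrable hmi, hg.integral_eq_one] at h2
  rw [hq.hellSq_eq hsub, hg.integral_eq_one]
  have := hq.integral_le_one
  linarith

lemma tendsto_lintegral_sub_indicator {g : ℝ → ℝ} (hg : IsDensity g) :
    Tendsto (fun b : ℝ => ∫⁻ x, ‖g x - (Set.Ioo (-b) b).indicator g x‖ₑ) atTop (𝓝 0) := by
  have h : Tendsto (fun b : ℝ => ∫⁻ x, ‖g x - (Set.Ioo (-b) b).indicator g x‖ₑ) atTop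
      (𝓝 (∫⁻ _ : ℝ, 0)) := by
    refine tendsto_lintegral_filter_of_dominated_convergence (fun x => ‖g x‖ₑ) ?_ ?_ ?_ ?_
    · exact Eventually.of_forall fun b =>
        (hg.measurable.sub (hg.measurable.indicator measurableSet_Ioo)).enorm
    · refine Eventually.of_forall fun b => ae_of_all _ fun x => ?_
      by_cases hx : x ∈ Set.Ioo (-b) b <;> simp [hx]
    · exact hg.integrable.hasFiniteIntegral.ne
    · refine ae_of_all _ fun x => tendsto_const_nhds.congr' ?_
      filter_upwards [eventually_gt_atTop |x|] with b hb
      have hm : x ∈ Set.Ioo (-b) b := abs_lt.1 hb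
      rw [Set.indicator_of_mem hm]
      simp
  simpa using h

/-- The kernel is not assumed bounded, so its bumps may have infinite variance. Capping it lowers
the estimator, which is harmless because only deficits count. -/
lemma exists_boundedKernel {K : ℝ → ℝ} (hK : IsDensity K) (hs : HasCompactSupport K) {η : ℝ}
    (hη : 0 < η) : ∃ K' M R, 0 < M ∧ 0 ≤ R ∧ IsBoundedKernel K' M R ∧ (∀ x, K' x ≤ K x) ∧
      1 - η ≤ ∫ x, K' x ∧ ∫ x, K' x ≤ 1 := by
  obtain ⟨R, hR⟩ := hs.isCompact.isBounded.subset_closedBall 0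
  have hint : ∀ k : ℕ, Integrable fun x => min (K x) k := fun k =>
    hK.integrable.mono' (hK.measurable.min measurable_const).aestronglyMeasurable
      (ae_of_all _ fun x => by
        rw [Real.norm_of_nonneg (le_min (hK.nonneg x) (Nat.cast_nonneg k))]
        exact min_le_left _ _)
  have hlim : Tendsto (fun k : ℕ => ∫ x, min (K x) k) atTop (𝓝 (∫ x, K x)) := by
    refine tendsto_integral_of_dominated_convergence K
      (fun k => (hint k).aestronglyMeasurable) hK.integrable (fun k => ae_of_all _ fun x => ?_)
      (ae_of_all _ fun x => tendsto_const_nhds.congr' ?_)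
    · rw [Real.norm_of_nonneg (le_min (hK.nonneg x) (Nat.cast_nonneg k))]
      exact min_le_left _ _
    · filter_upwards [eventually_ge_atTop ⌈K x⌉₊] with k hk
      exact (min_eq_left (Nat.ceil_le.1 hk)).symm
  rw [hK.integral_eq_one] at hlim
  obtain ⟨k, hk1, hk2⟩ := ((hlim.eventually (lt_mem_nhds (show 1 - η < 1 by linarith))).and
    (eventually_ge_atTop 1)).exists
  refine ⟨fun x => min (K x) k, k, max R 0, by exact_mod_cast hk2, le_max_right _ _,
    ⟨hK.measurable.min measurable_const, fun x => le_min (hK.nonneg x) (Nat.cast_nonneg k),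
      fun x => min_le_right _ _, hint k, fun x hx => ?_⟩, fun x => min_le_left _ _, hk1.le, ?_⟩
  · have : K x = 0 := by
      refine image_eq_zero_of_notMem_tsupport fun h => ?_
      have := hR h
      rw [mem_closedBall_zero_iff, Real.norm_eq_abs] at this
      exact absurd ((le_max_left R 0).trans_lt hx) (not_lt.2 this)
    simp [this]
  · rw [← hK.integral_eq_one]
    exact integral_mono (hint k) hK.integrable fun x => min_le_left _ _

lemma truncKDE_mono {K K' : ℝ → ℝ} (h : ∀ x, K' x ≤ K x) {c : ℝ} (hc : 0 < c) (b : ℝ) {n : ℕ}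
    (D : Fin n → ℝ) (x : ℝ) : truncKDE K' c b D x ≤ truncKDE K c b D x := by
  unfold truncKDE
  refine mul_le_mul_of_nonneg_left (Finset.sum_le_sum fun i _ => ?_) (by positivity)
  exact mul_le_mul_of_nonneg_right (h _) (indicator_one_nonneg _ _)

lemma measurable_truncKDE_uncurry {K : ℝ → ℝ} (hK : Measurable K) (c b : ℝ) (n : ℕ) :
    Measurable fun p : (Fin n → ℝ) × ℝ => truncKDE K c b p.1 p.2 := by
  unfold truncKDE
  refine (Finset.measurable_sum _ fun i _ => ?_).const_mul _
  refine (hK.comp (by fun_prop)).mul ?_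
  exact (measurable_one.indicator measurableSet_Ioo).comp (by fun_prop)

/-- The truncated kernel density estimator is consistent in the Hellinger distance. -/
theorem hellSq_truncKDE_consistent {g K : ℝ → ℝ} (hg : IsDensity g) (hK : IsDensity K)
    (hs : HasCompactSupport K) {c b : ℕ → ℝ} (hc : ∀ n, 0 < c n) (hc0 : Tendsto c atTop (𝓝 0))
    (hcn : Tendsto (fun n : ℕ => √(n : ℝ) * c n) atTop atTop) (hb : Tendsto b atTop atTop)
    {δ ξ : ℝ} (hδ : 0 < δ) (hξ : 0 < ξ) :
    ∀ᶠ n : ℕ in atTop, sampleLaw g n {D | δ < hellSq (truncKDE K (c n) (b n) D) g} ≤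
      ENNReal.ofReal ξ := by
  set η := δ / 10 with hη
  have hη0 : 0 < η := by positivity
  have hη0' : 0 < ENNReal.ofReal η := ENNReal.ofReal_pos.2 hη0
  obtain ⟨K', M, R, hM, hR, hK', hle, hmass, hmass1⟩ := exists_boundedKernel hK hs hη0
  have htail := (ENNReal.tendsto_nhds_zero.1 (tendsto_lintegral_sub_indicator hg)) _ hη0'
  obtain ⟨T, hT, hT0⟩ := (htail.and (eventually_gt_atTop 0)).exists
  have htr := (ENNReal.tendsto_nhds_zero.1
    (tendsto_lintegral_sub_translate hg.integrable hg.measurable)) _ hη0'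
  obtain ⟨r, hr0, hr⟩ := Metric.eventually_nhds_iff.1 htr
  have hcR : ∀ᶠ n in atTop, c n * R < r := by
    have := hc0.mul_const R
    rw [zero_mul] at this
    exact this.eventually (gt_mem_nhds hr0)
  have hdev : ∀ᶠ n : ℕ in atTop, M * (2 * T) / (η * ξ) ≤ √(n : ℝ) * c n :=
    hcn.eventually_ge_atTop _
  filter_upwards [hb.eventually htail, hcR, hdev, eventually_gt_atTop 0] with n hbn hcRn hdevn hn
  have hn' : (0 : ℝ) < n := by exact_mod_cast hn
  have hcn0 := hc n
  have hnc : 0 < √(n : ℝ) * c n := by positivity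
  set h := meanKDE g K' (c n) (b n) with hh
  have hhm : Measurable h := measurable_meanKDE hg hK' _
  have hbias : ∫⁻ x, ‖(∫ t, K' t) * g x - h x‖ₑ ≤ ENNReal.ofReal (2 * η) := by
    refine (lintegral_bias_le hg hK' hcn0 (b n) (ω := ENNReal.ofReal η) fun t ht => ?_).trans ?_
    · refine hr ?_
      rw [Real.dist_eq, sub_zero, abs_mul, abs_of_pos hcn0]
      exact (mul_le_mul_of_nonneg_left ht hcn0.le).trans_lt hcRn
    · calc _ ≤ ENNReal.ofReal 1 * (ENNReal.ofReal η + ENNReal.ofReal η) := by gcongr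
        _ = _ := by
          rw [ENNReal.ofReal_one, one_mul, ← ENNReal.ofReal_add hη0.le hη0.le, two_mul]
  -- The pointwise deviation is integrated only over a bounded window, as its bound is not
  -- integrable on the line; outside the window the deficit is at most g.
  set A : Set ℝ := Set.Ioo (-T) T with hA
  set V : (Fin n → ℝ) → ℝ≥0∞ := fun D => ∫⁻ x in A, ‖h x - truncKDE K' (c n) (b n) D x‖ₑ with hV
  have hprob := hg.isProbabilityMeasure_sampleLaw n
  have hjm : Measurable fun p : (Fin n → ℝ) × ℝ => ‖h p.2 - truncKDE K' (c n) (b n) p.1 p.2‖ₑ :=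
    ((hhm.comp measurable_snd).sub (measurable_truncKDE_uncurry hK'.measurable _ _ n)).enorm
  have hVm : Measurable V := hjm.lintegral_prod_right'
  have hEV : ∫⁻ D, V D ∂(sampleLaw g n) ≤ ENNReal.ofReal (η * ξ) := by
    rw [hV, lintegral_lintegral_swap hjm.aemeasurable]
    calc ∫⁻ x in A, ∫⁻ D, ‖h x - truncKDE K' (c n) (b n) D x‖ₑ ∂(sampleLaw g n)
        ≤ ∫⁻ _ in A, ENNReal.ofReal (M / (√n * c n)) :=
          lintegral_mono fun x => lintegral_truncKDE_sub_mean_le hg hK' hM hcn0 (b n) hn x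
      _ = ENNReal.ofReal (M / (√n * c n) * (2 * T)) := by
          rw [lintegral_const, Measure.restrict_apply_univ, hA, Real.volume_Ioo,
            ← ENNReal.ofReal_mul (by positivity)]
          congr 2; ring
      _ ≤ ENNReal.ofReal (η * ξ) := by
          refine ENNReal.ofReal_le_ofReal ?_
          rw [div_le_iff₀ (by positivity)] at hdevn
          rw [div_mul_eq_mul_div, div_le_iff₀ hnc]
          linarith
  have hmarkov : sampleLaw g n {D | ENNReal.ofReal η ≤ V D} ≤ ENNReal.ofReal ξ := by
    refine (meas_ge_le_lintegral_div hVm.aemeasurable hη0'.ne' ENNReal.ofReal_ne_top).trans ?_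
    refine ENNReal.div_le_of_le_mul ?_
    rwa [← ENNReal.ofReal_mul hξ.le, mul_comm ξ]
  refine (measure_mono fun D hD => ?_).trans hmarkov
  by_contra hVD
  have hVD' : V D ≤ ENNReal.ofReal η := (not_le.1 hVD).le
  have hD' : δ < hellSq (truncKDE K (c n) (b n) D) g := hD
  refine absurd hD' (not_lt.2 ?_)
  have key : ∫⁻ x, ENNReal.ofReal (g x - truncKDE K (c n) (b n) D x) ≤
      ENNReal.ofReal (5 * η) := by
    set q' := truncKDE K' (c n) (b n) D with hq'
    have hq'm : Measurable q' := (measurable_truncKDE_uncurry hK'.measurable _ _ n).comp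
      measurable_prodMk_left
    have hq'0 : ∀ x, 0 ≤ q' x := fun x => by
      rw [hq', truncKDE_eq_sum]
      exact Finset.sum_nonneg fun i _ => kernelBump_nonneg hK'.nonneg hcn0 _ _ _ _
    set κ := ∫ t, K' t with hκ
    have hpt : ∀ x, ENNReal.ofReal (g x - truncKDE K (c n) (b n) D x) ≤
        ENNReal.ofReal ((1 - κ) * g x) + (‖κ * g x - h x‖ₑ +
          (A.indicator (fun x => ‖h x - q' x‖ₑ) x + ‖g x - A.indicator g x‖ₑ)) := by
      intro x
      have h1 : g x - truncKDE K (c n) (b n) D x ≤ g x - q' x :=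
        sub_le_sub_left (truncKDE_mono hle hcn0 (b n) D x) _
      by_cases hx : x ∈ A
      · rw [Set.indicator_of_mem hx]
        refine (ENNReal.ofReal_le_ofReal (q := (1 - κ) * g x + (‖κ * g x - h x‖
          + ‖h x - q' x‖)) ?_).trans ?_
        · have := Real.le_norm_self (κ * g x - h x)
          have := Real.le_norm_self (h x - q' x)
          linarith
        · refine ENNReal.ofReal_add_le.trans (add_le_add le_rfl ?_)
          refine ENNReal.ofReal_add_le.trans (add_le_add (by rw [ofReal_norm]) ?_)
          rw [ofReal_norm]
          exact le_self_add
      · rw [Set.indicator_of_notMem hx, Set.indicator_of_notMem hx, sub_zero, zero_add]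
        refine le_trans ?_ (le_add_left (le_add_left le_rfl))
        rw [← ofReal_norm]
        refine ENNReal.ofReal_le_ofReal ?_
        have := Real.le_norm_self (g x)
        have := hq'0 x
        linarith
    refine (lintegral_mono hpt).trans ?_
    rw [lintegral_add_left (hg.measurable.const_mul _).ennreal_ofReal,
      lintegral_add_left (f := fun x => ‖κ * g x - h x‖ₑ)
        ((hg.measurable.const_mul _).sub hhm).enorm,
      lintegral_add_left (f := fun x => A.indicator (fun x => ‖h x - q' x‖ₑ) x)
        ((hhm.sub hq'm).enorm.indicator measurableSet_Ioo),
      lintegral_indicator measurableSet_Ioo]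
    have h1 : ∫⁻ x, ENNReal.ofReal ((1 - κ) * g x) ≤ ENNReal.ofReal η := by
      rw [← ofReal_integral_eq_lintegral_ofReal (hg.integrable.const_mul _)
        (ae_of_all _ fun x => mul_nonneg (by linarith) (hg.nonneg x)), integral_const_mul,
        hg.integral_eq_one]
      exact ENNReal.ofReal_le_ofReal (by linarith)
    calc _ ≤ ENNReal.ofReal η + (ENNReal.ofReal (2 * η) + (ENNReal.ofReal η + ENNReal.ofReal η)) :=
          add_le_add h1 (add_le_add hbias (add_le_add hVD' hT))
      _ = _ := by
          rw [← ENNReal.ofReal_add hη0.le hη0.le, ← ENNReal.ofReal_add (by positivity)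
            (by positivity), ← ENNReal.ofReal_add (by positivity) (by positivity)]
          congr 1; ring
  have := hellSq_le_of_lintegral_sub_le (isSubDensity_truncKDE hK hcn0 (b n) D) hg
    (by positivity) key
  rw [hη] at this
  linarith

end PMHDE

namespace PMHDE

/-! ### Tails of the Gaussian noise -/

lemma gaussianReal_abs_ge_le {t : ℝ} (ht : 0 ≤ t) :
    gaussianReal 0 1 {x | t ≤ |x|} ≤ ENNReal.ofReal (2 * Real.exp (-t ^ 2 / 2)) := by
  have h : HasSubgaussianMGF (id : ℝ → ℝ) 1 (gaussianReal 0 1) :=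
    ⟨fun s => integrable_exp_mul_gaussianReal s, fun s => by
      rw [mgf_id_gaussianReal]; simp⟩
  have h1 := h.measure_ge_le ht
  have h2 := h.neg.measure_ge_le ht
  rw [two_mul, ENNReal.ofReal_add (by positivity) (by positivity)]
  have hsub : {x : ℝ | t ≤ |x|} ⊆ {x | t ≤ id x} ∪ {x | t ≤ (-id) x} := by
    intro x hx
    rcases le_abs.1 (show t ≤ |x| from hx) with h | h
    · exact Or.inl h
    · exact Or.inr h
  refine (measure_mono hsub).trans ((measure_union_le _ _).trans (add_le_add ?_ ?_))
  · rw [← ofReal_measureReal]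
    exact ENNReal.ofReal_le_ofReal (by simpa using h1)
  · rw [← ofReal_measureReal]
    exact ENNReal.ofReal_le_ofReal (by simpa using h2)

/-- The event that all standard normal variables of `k` steps are at most `t` in absolute
value. -/
def NoiseBounded {m k : ℕ} (t : ℝ) (z : Fin k → StepNoise m) : Prop :=
  ∀ l, (∀ i, |(z l).1 i| ≤ t) ∧ ∀ i j, |(z l).2 i j| ≤ t

lemma noiseLaw_not_noiseBounded_le (m k : ℕ) {t : ℝ} (ht : 0 ≤ t) :
    noiseLaw m k {z | ¬ NoiseBounded t z} ≤
      ENNReal.ofReal (k * (m + m * m) * (2 * Real.exp (-t ^ 2 / 2))) := by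
  have hmeas : MeasurableSet {x : ℝ | t ≤ |x|} :=
    measurableSet_le measurable_const measurable_id.abs
  set G := ENNReal.ofReal (2 * Real.exp (-t ^ 2 / 2))
  have h1 : ∀ l i, noiseLaw m k {z | t ≤ |(z l).1 i|} ≤ G := by
    intro l i
    have hp : MeasurePreserving (fun z : Fin k → StepNoise m => (z l).1 i) (noiseLaw m k)
        (gaussianReal 0 1) :=
      (measurePreserving_eval (fun _ : Fin m => gaussianReal 0 1) i).comp
        (measurePreserving_fst.comp (measurePreserving_eval (fun _ : Fin k => stepNoiseLaw m) l))
    have := hp.measure_preimage hmeas.nullMeasurableSet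
    exact this.le.trans (gaussianReal_abs_ge_le ht)
  have h2 : ∀ l i j, noiseLaw m k {z | t ≤ |(z l).2 i j|} ≤ G := by
    intro l i j
    have hp : MeasurePreserving (fun z : Fin k → StepNoise m => (z l).2 i j) (noiseLaw m k)
        (gaussianReal 0 1) :=
      (measurePreserving_eval (fun _ : Fin m => gaussianReal 0 1) j).comp
        ((measurePreserving_eval
          (fun _ : Fin m => Measure.pi fun _ : Fin m => gaussianReal 0 1) i).comp
        (measurePreserving_snd.comp (measurePreserving_eval (fun _ : Fin k => stepNoiseLaw m) l)))
    have := hp.measure_preimage hmeas.nullMeasurableSet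
    exact this.le.trans (gaussianReal_abs_ge_le ht)
  have hsub : {z : Fin k → StepNoise m | ¬ NoiseBounded t z} ⊆
      ⋃ l, ((⋃ i, {z | t ≤ |(z l).1 i|}) ∪ ⋃ i, ⋃ j, {z | t ≤ |(z l).2 i j|}) := by
    intro z hz
    by_contra hcon
    simp only [Set.mem_iUnion, Set.mem_union, Set.mem_ofPred_eq, not_exists, not_or, not_le] at hcon
    exact hz fun l => ⟨fun i => ((hcon l).1 i).le, fun i j => ((hcon l).2 i j).le⟩
  refine (measure_mono hsub).trans ((measure_iUnion_fintype_le _ _).trans ?_)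
  calc ∑ l : Fin k, noiseLaw m k ((⋃ i, {z | t ≤ |(z l).1 i|}) ∪ ⋃ i, ⋃ j, {z | t ≤ |(z l).2 i j|})
      ≤ ∑ _l : Fin k, (∑ _i : Fin m, G + ∑ _i : Fin m, ∑ _j : Fin m, G) := by
        refine Finset.sum_le_sum fun l _ => (measure_union_le _ _).trans (add_le_add ?_ ?_)
        · exact (measure_iUnion_fintype_le _ _).trans (Finset.sum_le_sum fun i _ => h1 l i)
        · exact (measure_iUnion_fintype_le _ _).trans (Finset.sum_le_sum fun i _ =>
            (measure_iUnion_fintype_le _ _).trans (Finset.sum_le_sum fun j _ => h2 l i j))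
    _ = _ := by
        rw [ENNReal.ofReal_mul (by positivity), ENNReal.ofReal_mul (by positivity),
          ENNReal.ofReal_add (by positivity) (by positivity), ENNReal.ofReal_mul (by positivity)]
        simp only [Finset.sum_const, Finset.card_univ, Fintype.card_fin, nsmul_eq_mul,
          ENNReal.ofReal_natCast]
        ring

/-- The radius outside which some coordinate of the noise of `k` steps falls with probability at
most `ξ / 2`. -/
noncomputable def noiseRadius (m k : ℕ) (ξ : ℝ) : ℝ :=
  √(2 * Real.log (4 * (m + m * m + 1) * (k / ξ)))

/-- A union bound over k(m + m²) normal variables, at the radius where exp(-t²/2) is the reciprocal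
of 4(m + m² + 1)k/ξ. The summand 1 keeps the logarithm nonnegative when m = 0. -/
lemma noiseLaw_not_noiseBounded_le_half (m : ℕ) {k : ℕ} {ξ : ℝ} (hk : 1 ≤ k) (hξ : 0 < ξ)
    (hξ1 : ξ ≤ 1) :
    noiseLaw m k {z | ¬ NoiseBounded (noiseRadius m k ξ) z} ≤ ENNReal.ofReal (ξ / 2) := by
  refine (noiseLaw_not_noiseBounded_le m k (Real.sqrt_nonneg _)).trans
    (ENNReal.ofReal_le_ofReal ?_)
  have hk1 : (1 : ℝ) ≤ k := by exact_mod_cast hk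
  have hkξ : 1 ≤ k / ξ := by rw [le_div_iff₀ hξ]; linarith
  have hm : (0 : ℝ) ≤ m + m * m := by positivity
  have harg : 1 ≤ 4 * (m + m * m + 1) * (k / ξ) := by nlinarith
  have hsq : √(2 * Real.log (4 * (m + m * m + 1) * (k / ξ))) ^ 2 =
      2 * Real.log (4 * (m + m * m + 1) * (k / ξ)) :=
    Real.sq_sqrt (by have := Real.log_nonneg harg; linarith)
  rw [hsq, show -(2 * Real.log (4 * (m + m * m + 1) * (k / ξ))) / 2 =
      -Real.log (4 * (m + m * m + 1) * (k / ξ)) by ring, Real.exp_neg,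
    Real.exp_log (by linarith)]
  have hk0 : (0 : ℝ) < k := by linarith
  have : (k : ℝ) * (m + m * m) * (2 * (4 * (m + m * m + 1) * (k / ξ))⁻¹) =
      (m + m * m) / (m + m * m + 1) * (ξ / 2) := by
    field_simp
    ring
  rw [this]
  refine mul_le_of_le_one_left (by positivity) ?_
  rw [div_le_one (by positivity)]
  linarith

end PMHDE

namespace PMHDE

/-! ### Local convergence of the perturbed Newton iteration -/

variable {m : ℕ} {Θ U : Set (Param m)} {f : Param m → ℝ → ℝ}

/-- Matrices entrywise close to an invertible matrix are invertible, with a uniform bound on the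
inverse. -/
lemma exists_mulVec_lower_bound {A₀ : Matrix (Fin m) (Fin m) ℝ} (h : IsUnit A₀.det) :
    ∃ L > 0, ∃ δ > 0, ∀ A : Matrix (Fin m) (Fin m) ℝ, (∀ i j, |A i j - A₀ i j| ≤ δ) →
      IsUnit A.det ∧ ∀ v : Fin m → ℝ, ‖v‖ ≤ L * ‖A.mulVec v‖ := by
  set M : ℝ := 1 + ∑ i, ∑ j, |A₀⁻¹ i j| with hM
  have hM1 : 1 ≤ M := by
    have : 0 ≤ ∑ i, ∑ j, |A₀⁻¹ i j| :=
      Finset.sum_nonneg fun i _ => Finset.sum_nonneg fun j _ => abs_nonneg _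
    linarith
  have hbound : ∀ v : Fin m → ℝ, ‖v‖ ≤ M * ‖A₀.mulVec v‖ := by
    intro v
    refine (pi_norm_le_iff_of_nonneg (by positivity)).2 fun i => ?_
    have hv : v i = ∑ j, A₀⁻¹ i j * (A₀.mulVec v) j := by
      have : A₀⁻¹.mulVec (A₀.mulVec v) = v := by
        rw [Matrix.mulVec_mulVec, Matrix.nonsing_inv_mul _ h, Matrix.one_mulVec]
      exact (congrFun this i).symm
    rw [hv, Real.norm_eq_abs]
    calc |∑ j, A₀⁻¹ i j * (A₀.mulVec v) j| ≤ ∑ j, |A₀⁻¹ i j| * ‖A₀.mulVec v‖ := by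
          refine (Finset.abs_sum_le_sum_abs _ _).trans (Finset.sum_le_sum fun j _ => ?_)
          rw [abs_mul]
          exact mul_le_mul_of_nonneg_left (norm_le_pi_norm (A₀.mulVec v) j) (abs_nonneg _)
      _ = (∑ j, |A₀⁻¹ i j|) * ‖A₀.mulVec v‖ := by rw [Finset.sum_mul]
      _ ≤ M * ‖A₀.mulVec v‖ := by
          refine mul_le_mul_of_nonneg_right ?_ (norm_nonneg _)
          have : ∑ j, |A₀⁻¹ i j| ≤ ∑ i, ∑ j, |A₀⁻¹ i j| :=
            Finset.single_le_sum (f := fun i => ∑ j, |A₀⁻¹ i j|)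
              (fun i _ => Finset.sum_nonneg fun j _ => abs_nonneg _) (Finset.mem_univ i)
          linarith
  have hmpos : (0 : ℝ) < m + 1 := by positivity
  -- Such perturbations have operator norm at most 1/(2M) in the sup norm, so half of ‖v‖ can be
  -- absorbed on the left.
  refine ⟨2 * M, by linarith, 1 / (2 * M * (m + 1)), by positivity, fun A hA => ?_⟩
  have key : ∀ v : Fin m → ℝ, ‖v‖ ≤ 2 * M * ‖A.mulVec v‖ := by
    intro v
    have hsub : ‖(A₀ - A).mulVec v‖ ≤ 1 / (2 * M) * ‖v‖ := by
      refine (pi_norm_le_iff_of_nonneg (by positivity)).2 fun i => ?_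
      rw [Real.norm_eq_abs]
      calc |∑ j, (A₀ - A) i j * v j| ≤ ∑ _j : Fin m, 1 / (2 * M * (m + 1)) * ‖v‖ := by
            refine (Finset.abs_sum_le_sum_abs _ _).trans (Finset.sum_le_sum fun j _ => ?_)
            rw [abs_mul]
            refine mul_le_mul ?_ (norm_le_pi_norm v j) (abs_nonneg _) (by positivity)
            rw [Matrix.sub_apply, abs_sub_comm]
            exact hA i j
        _ = m / (m + 1) * (1 / (2 * M) * ‖v‖) := by
            rw [Finset.sum_const, Finset.card_univ, Fintype.card_fin, nsmul_eq_mul]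
            field_simp
        _ ≤ 1 / (2 * M) * ‖v‖ := by
            refine mul_le_of_le_one_left (by positivity) ?_
            rw [div_le_one hmpos]
            linarith
    have h1 : ‖A₀.mulVec v‖ ≤ ‖A.mulVec v‖ + 1 / (2 * M) * ‖v‖ := by
      have e : A₀.mulVec v = A.mulVec v + (A₀ - A).mulVec v := by
        rw [Matrix.sub_mulVec]; abel
      rw [e]
      exact (norm_add_le _ _).trans (add_le_add le_rfl hsub)
    have h2 := (hbound v).trans (mul_le_mul_of_nonneg_left h1 (by linarith))
    have h3 : M * (‖A.mulVec v‖ + 1 / (2 * M) * ‖v‖) = M * ‖A.mulVec v‖ + ‖v‖ / 2 := by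
      field_simp
    linarith
  refine ⟨?_, key⟩
  rw [← Matrix.isUnit_iff_isUnit_det, ← Matrix.mulVec_injective_iff_isUnit]
  intro v w hvw
  have := key (v - w)
  rw [Matrix.mulVec_sub, hvw, sub_self, norm_zero, mul_zero] at this
  exact sub_eq_zero.1 (norm_le_zero_iff.1 this)

/-- Minimizers of the loss for `q` are close to the unique minimizer for `g` if `q` is close to
`g` in the Hellinger distance. -/
lemma FamilyAssumptions.exists_minimizer_close (hf : FamilyAssumptions Θ f) {g : ℝ → ℝ}
    (hg : IsDensity g) {θg : Param m} (hθg : θg ∈ Θ)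
    (hmin : ∀ θ ∈ Θ, θ ≠ θg → hellSq (f θg) g < hellSq (f θ) g) {r : ℝ} (hr : 0 < r) :
    ∃ δ > 0, ∀ q, IsSubDensity q → hellSq q g ≤ δ → ∀ θ ∈ Θ, IsMinOn (loss f q) Θ θ →
      ‖θ - θg‖ < r := by
  obtain ⟨U, C, hB⟩ := hf.exists_momentBound
  have hC := hB.pos
  have hS : IsCompact (Θ \ Metric.ball θg r) := hf.compact.diff Metric.isOpen_ball
  rcases (Θ \ Metric.ball θg r).eq_empty_or_nonempty with h0 | hne
  · refine ⟨1, one_pos, fun q _ _ θ hθ _ => ?_⟩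
    have : θ ∈ Metric.ball θg r := by
      by_contra hcon
      exact (h0 ▸ (⟨hθ, hcon⟩ : θ ∈ Θ \ Metric.ball θg r) : θ ∈ (∅ : Set (Param m)))
    rwa [mem_ball_iff_norm] at this
  · obtain ⟨θ₁, hθ₁, hθ₁min⟩ := hS.exists_isMinOn hne
      ((hB.continuousOn_loss hg.isSubDensity hf.density).mono Set.sdiff_subset)
    have hgap : loss f g θg < loss f g θ₁ := by
      have hne' : θ₁ ≠ θg := by
        rintro rfl
        exact hθ₁.2 (Metric.mem_ball_self hr)
      have := hmin θ₁ hθ₁.1 hne'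
      unfold loss
      linarith
    set γ := loss f g θ₁ - loss f g θg with hγ
    have hγ0 : 0 < γ := by linarith
    -- Both losses then move by at most γ/4 up to a common constant, so the gap γ outside the ball
    -- survives and excludes a minimizer there.
    refine ⟨(γ / (16 * C)) ^ 2, by positivity, fun q hq hqg θ hθ hθmin => ?_⟩
    by_contra hcon
    have hθS : θ ∈ Θ \ Metric.ball θg r := ⟨hθ, by rwa [mem_ball_iff_norm]⟩
    have h1 : loss f g θ₁ ≤ loss f g θ := hθ₁min hθS
    have h2 : loss f q θ ≤ loss f q θg := hθmin hθg
    have h3 := abs_le.1 (hB.abs_loss_sub_le hg.isSubDensity hq hf.density hθ)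
    have h4 := abs_le.1 (hB.abs_loss_sub_le hg.isSubDensity hq hf.density hθg)
    have h5 : √(hellSq q g) ≤ γ / (16 * C) := by
      rw [Real.sqrt_le_left (by positivity)]
      exact hqg
    rw [le_div_iff₀ (by positivity)] at h5
    nlinarith

section Step

variable {C : ℝ} (hB : MomentBound Θ U f C) {q : ℝ → ℝ} (hq : IsSubDensity q)
  {Δ ΔH ε' τ L : ℝ} {θ θhat : Param m} {z : StepNoise m}
include hB hq

/-- Multiplying the new error by the perturbed Hessian gives the Taylor remainder of the gradient
between θ and its zero, plus W(θ - θhat), minus the gradient noise. The first is quadratic in the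
old error and the others are of order τ. The exact cancellation of the linear term requires learning
rate one. -/
lemma norm_pnrStep_sub_le (hL : 0 ≤ L) (hτ : 0 ≤ τ) (hθ : θ ∈ Θ) (hθhat : θhat ∈ Θ)
    (hgrad : lossGrad f q θhat = 0)
    (hz : ∀ i, |Δ * noiseMult (ε' / 2) * z.1 i| ≤ τ)
    (hZ : ∀ i j, |ΔH * noiseMult (ε' / 2) * z.2 i j| ≤ τ) (hle : ‖θ - θhat‖ ≤ 1)
    (hdet : IsUnit (lossHess f q θ + (ΔH * noiseMult (ε' / 2)) • symmOfUpper z.2).det)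
    (hinv : ∀ v : Fin m → ℝ, ‖v‖ ≤
      L * ‖(lossHess f q θ + (ΔH * noiseMult (ε' / 2)) • symmOfUpper z.2).mulVec v‖) :
    ‖pnrStep Θ f q Δ ΔH ε' 1 θ z - θhat‖ ≤
      m * L * (2 * (m * m * C)) * ‖θ - θhat‖ ^ 2 + m * L * (m + 1) * τ := by
  set W := (ΔH * noiseMult (ε' / 2)) • symmOfUpper z.2 with hW
  set A := lossHess f q θ + W with hA
  set w : Fin m → ℝ := fun i => lossGrad f q θ i + Δ * noiseMult (ε' / 2) * z.1 i with hw
  set v : Fin m → ℝ := (fun i => (θ - θhat) i) - A⁻¹.mulVec w with hv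
  have hstep : ∀ i, (pnrStep Θ f q Δ ΔH ε' 1 θ z - θhat) i = v i := by
    intro i
    simp only [pnrStep, Set.indicator_of_mem hθ, one_smul, hv, PiLp.sub_apply, Pi.sub_apply]
    rw [← hW, ← hA, ← hw]
    ring
  have hAv : A.mulVec v = A.mulVec (fun i => (θ - θhat) i) - w := by
    rw [hv, Matrix.mulVec_sub, Matrix.mulVec_mulVec, Matrix.mul_nonsing_inv _ hdet,
      Matrix.one_mulVec]
  set a := 2 * (m * m * C) * ‖θ - θhat‖ ^ 2 + (m + 1) * τ with ha
  have hC := hB.pos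
  have ha0 : 0 ≤ a := by positivity
  have hAvn : ‖A.mulVec v‖ ≤ a := by
    refine (pi_norm_le_iff_of_nonneg ha0).2 fun i => ?_
    have ht := hB.lossGrad_taylor hq hθ hθhat i
    rw [hgrad, norm_sub_rev] at ht
    have hWsum : |∑ j, W i j * (θ - θhat) j| ≤ m * τ := by
      refine (abs_sum_mul_coord_le (W i) (θ - θhat)).trans ?_
      have : ∑ j, |W i j| ≤ ∑ _j : Fin m, τ := Finset.sum_le_sum fun j _ => by
        simpa [hW, symmOfUpper] using hZ (min i j) (max i j)
      rw [Finset.sum_const, Finset.card_univ, Fintype.card_fin, nsmul_eq_mul] at this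
      exact (mul_le_mul this hle (norm_nonneg _) (by positivity)).trans (by rw [mul_one])
    have e : (A.mulVec v) i = ((0 : Param m) i - lossGrad f q θ i
        - ∑ j, lossHess f q θ i j * (θhat j - θ j)) + ((∑ j, W i j * (θ - θhat) j)
        - Δ * noiseMult (ε' / 2) * z.1 i) := by
      rw [hAv, Pi.sub_apply, hw]
      have e1 : A.mulVec (fun i => (θ - θhat) i) i =
          -(∑ j, lossHess f q θ i j * (θhat j - θ j)) + ∑ j, W i j * (θ - θhat) j := by
        rw [show A.mulVec (fun i => (θ - θhat) i) i = ∑ j, A i j * (θ - θhat) j from rfl,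
          ← Finset.sum_neg_distrib, ← Finset.sum_add_distrib]
        refine Finset.sum_congr rfl fun j _ => ?_
        simp only [hA, Matrix.add_apply, PiLp.sub_apply]
        ring
      rw [e1]
      simp only [PiLp.zero_apply]
      ring
    rw [e, Real.norm_eq_abs, ha]
    have h1 := hz i
    refine (abs_add_le _ _).trans ((add_le_add ht ((abs_sub _ _).trans
      (add_le_add hWsum h1))).trans_eq ?_)
    ring
  have hvn : ‖v‖ ≤ L * a := (hinv v).trans (mul_le_mul_of_nonneg_left hAvn hL)
  have := norm_le_of_abs_coord_le (v := pnrStep Θ f q Δ ΔH ε' 1 θ z - θhat) (a := L * a)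
    fun i => by
      rw [hstep i]
      exact (norm_le_pi_norm v i).trans hvn
  refine this.trans_eq ?_
  rw [ha]
  ring

end Step

lemma half_pow_two_pow_sq (k : ℕ) : ((1 / 2 : ℝ) ^ (2 ^ k)) ^ 2 = (1 / 2) ^ (2 ^ (k + 1)) := by
  rw [← pow_mul, pow_succ]

/-- The quadratic recursion `x ↦ x² + σ`. -/
lemma quadratic_recursion_le {x σ r : ℝ} (hx0 : 0 ≤ x) (hσ0 : 0 ≤ σ) (hσ : σ ≤ 1 / 8)
    (hx : x ≤ 1 / 2 * r + 2 * σ) : x ^ 2 + σ ≤ 1 / 2 * r ^ 2 + 2 * σ := by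
  -- The cross term 2rσ is at most r²/4 + 4σ², and the remaining 8σ² is at most σ because σ ≤ 1/8.
  nlinarith [sq_nonneg (r - 4 * σ), mul_self_le_mul_self hx0 hx]

set_option maxHeartbeats 800000 in
/-- Deterministic local convergence of the perturbed Newton iteration, uniformly over densities
close to `g`. -/
lemma FamilyAssumptions.exists_newton_convergence (hf : FamilyAssumptions Θ f) {g : ℝ → ℝ}
    (hg : IsDensity g) {θg : Param m} (hθg : θg ∈ interior Θ)
    (hdet : IsUnit (lossHess f g θg).det) :
    ∃ ρ > 0, ∃ δ > 0, ∃ τ₀ > 0, ∃ b > 0, ∀ q, IsSubDensity q → hellSq q g ≤ δ →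
      ∀ θhat, ‖θhat - θg‖ < ρ → IsMinOn (loss f q) Θ θhat →
      ∀ Δ ΔH ε' τ : ℝ, 0 ≤ τ → τ ≤ τ₀ → ∀ θ₀ ∈ Metric.closedBall θg ρ,
      ∀ (k : ℕ) (z : Fin k → StepNoise m),
      (∀ l, (∀ i, |Δ * noiseMult (ε' / 2) * (z l).1 i| ≤ τ) ∧
        ∀ i j, |ΔH * noiseMult (ε' / 2) * (z l).2 i j| ≤ τ) →
      ‖pnr Θ f q Δ ΔH ε' 1 θ₀ k z - θhat‖ ≤ (1 / 2) ^ (2 ^ k) + b * τ := by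
  obtain ⟨U, C, hB⟩ := hf.exists_momentBound
  have hC := hB.pos
  obtain ⟨L, hL, δ₀, hδ₀, hinv⟩ := exists_mulVec_lower_bound hdet
  obtain ⟨r, hr, hball⟩ := Metric.isOpen_iff.1 isOpen_interior θg hθg
  -- One step reads e ↦ a e² + sτ; the added ones make a and s at least one, also when m = 0.
  set a : ℝ := m * L * (2 * (m * m * C)) + 1 with ha
  have ha1 : 1 ≤ a := by
    have : 0 ≤ m * L * (2 * (m * m * C)) := by positivity
    linarith
  set s : ℝ := m * L * (m + 1) + 1 with hs
  have hs1 : 1 ≤ s := by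
    have : 0 ≤ m * L * (m + 1) := by positivity
    linarith
  have hmC : 0 < m * C + 1 := by positivity
  -- Iterates stay within 2ρ of the minimizer, hence within 3ρ of θ_g. The three terms keep them in
  -- the interior, start the recursion at ae ≤ 1/4, and limit the drift of the Hessian to δ₀/3.
  -- Hellinger error and noise may use another δ₀/3 each.
  set ρ : ℝ := min (r / 4) (min (1 / (8 * a)) (δ₀ / (18 * (m * C + 1)))) with hρ
  have hρ0 : 0 < ρ := by positivity
  have hρr : ρ ≤ r / 4 := min_le_left _ _
  have hρa : ρ ≤ 1 / (8 * a) := (min_le_right _ _).trans (min_le_left _ _)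
  have hρδ : ρ ≤ δ₀ / (18 * (m * C + 1)) := (min_le_right _ _).trans (min_le_right _ _)
  rw [le_div_iff₀ (by positivity)] at hρa hρδ
  set τ₀ : ℝ := min (δ₀ / 3) (ρ / (8 * a * s)) with hτ₀
  refine ⟨ρ, hρ0, (δ₀ / (6 * C)) ^ 2, by positivity, τ₀, by positivity, 2 * s, by positivity, ?_⟩
  intro q hq hqg θhat hθhat hmin Δ ΔH ε' τ hτ hττ₀ θ₀ hθ₀
  have hτδ : τ ≤ δ₀ / 3 := hττ₀.trans (min_le_left _ _)
  have hτρ : τ ≤ ρ / (8 * a * s) := hττ₀.trans (min_le_right _ _)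
  rw [le_div_iff₀ (by positivity)] at hτρ
  have hin : ∀ θ : Param m, ‖θ - θg‖ ≤ 3 * ρ → θ ∈ interior Θ := fun θ hθ =>
    hball (by rw [mem_ball_iff_norm]; linarith)
  have hhat : θhat ∈ interior Θ := hin θhat (by linarith)
  have hgrad := hB.lossGrad_eq_zero hq hf.density hhat hmin
  have hsq : √(hellSq q g) ≤ δ₀ / (6 * C) := by
    rw [Real.sqrt_le_left (by positivity)]
    exact hqg
  rw [le_div_iff₀ (by positivity)] at hsq
  have ρ2 : 2 * ρ ≤ 1 / 4 := by nlinarith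
  set σ := a * (s * τ) with hσ
  have hσ0 : 0 ≤ σ := by positivity
  have hσρ : σ ≤ ρ / 8 := by rw [hσ]; linarith
  -- In the variable ae the step becomes x ↦ x² + σ. The first conjunct keeps the iterate where the
  -- one-step estimate is valid; the second records the quadratic convergence down to the noise
  -- level.
  have main : ∀ (k : ℕ) (z : Fin k → StepNoise m),
      (∀ l, (∀ i, |Δ * noiseMult (ε' / 2) * (z l).1 i| ≤ τ) ∧
        ∀ i j, |ΔH * noiseMult (ε' / 2) * (z l).2 i j| ≤ τ) →
      ‖pnr Θ f q Δ ΔH ε' 1 θ₀ k z - θhat‖ ≤ 2 * ρ ∧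
      a * ‖pnr Θ f q Δ ΔH ε' 1 θ₀ k z - θhat‖ ≤ 1 / 2 * (1 / 2) ^ (2 ^ k) + 2 * σ := by
    intro k
    induction k with
    | zero =>
      intro z _
      have h1 : ‖θ₀ - θhat‖ ≤ 2 * ρ := by
        rw [mem_closedBall_iff_norm] at hθ₀
        calc ‖θ₀ - θhat‖ = ‖(θ₀ - θg) - (θhat - θg)‖ := by congr 1; abel
          _ ≤ 2 * ρ := (norm_sub_le _ _).trans (by linarith)
      refine ⟨h1, ?_⟩
      change a * ‖θ₀ - θhat‖ ≤ _
      norm_num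
      nlinarith
    | succ k ih =>
      intro z hz
      obtain ⟨ih1, ih2⟩ := ih (fun i => z i.castSucc) fun l => hz l.castSucc
      set θ := pnr Θ f q Δ ΔH ε' 1 θ₀ k fun i => z i.castSucc with hθdef
      have hθg' : ‖θ - θg‖ ≤ 3 * ρ := by
        calc ‖θ - θg‖ = ‖(θ - θhat) + (θhat - θg)‖ := by congr 1; abel
          _ ≤ 3 * ρ := (norm_add_le _ _).trans (by linarith)
      have hθ : θ ∈ Θ := interior_subset (hin θ hθg')
      obtain ⟨hd, hv⟩ := hinv (lossHess f q θ +
        (ΔH * noiseMult (ε' / 2)) • symmOfUpper (z (Fin.last k)).2) fun i j => by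
          have h1 := hB.lossHess_increment hq (interior_subset hθg) hθ i j
          have h2 := hB.abs_lossHess_sub_le hg.isSubDensity hq (interior_subset hθg) i j
          have h3 : |ΔH * noiseMult (ε' / 2) * symmOfUpper (z (Fin.last k)).2 i j| ≤ τ :=
            (hz (Fin.last k)).2 (min i j) (max i j)
          have h4 : 2 * (m * C) * ‖θ - θg‖ ≤ δ₀ / 3 := by
            have : 2 * (m * C) * ‖θ - θg‖ ≤ 2 * (m * C) * (3 * ρ) :=
              mul_le_mul_of_nonneg_left hθg' (by positivity)
            nlinarith
          rw [Matrix.add_apply, Matrix.smul_apply, smul_eq_mul]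
          calc _ = |(lossHess f q θ i j - lossHess f q θg i j) + (lossHess f q θg i j -
                lossHess f g θg i j) + ΔH * noiseMult (ε' / 2) *
                symmOfUpper (z (Fin.last k)).2 i j| := by congr 1; ring
            _ ≤ _ := (abs_add_three _ _ _).trans (by linarith)
      have hstep := norm_pnrStep_sub_le hB hq hL.le hτ hθ (interior_subset hhat) hgrad
        (hz (Fin.last k)).1 (hz (Fin.last k)).2 (by linarith) hd hv
      change ‖pnrStep Θ f q Δ ΔH ε' 1 θ (z (Fin.last k)) - θhat‖ ≤ _ ∧
        a * ‖pnrStep Θ f q Δ ΔH ε' 1 θ (z (Fin.last k)) - θhat‖ ≤ _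
      set e := ‖θ - θhat‖ with he
      have he0 : 0 ≤ e := norm_nonneg _
      have hstep' : ‖pnrStep Θ f q Δ ΔH ε' 1 θ (z (Fin.last k)) - θhat‖ ≤ a * e ^ 2 + s * τ := by
        refine hstep.trans ?_
        rw [ha, hs]
        nlinarith [sq_nonneg e]
      have hsτ : s * τ ≤ σ := by
        rw [hσ]
        exact le_mul_of_one_le_left (by positivity) ha1
      constructor
      · have : a * e ^ 2 ≤ a * (2 * ρ) * (2 * ρ) := by
          rw [mul_assoc]
          refine mul_le_mul_of_nonneg_left ?_ (by linarith)
          rw [sq]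
          exact mul_le_mul ih1 ih1 he0 (by linarith)
        have h2 : a * (2 * ρ) * (2 * ρ) ≤ 1 / 4 * (2 * ρ) :=
          mul_le_mul_of_nonneg_right (by linarith) (by linarith)
        linarith
      · have h1 := quadratic_recursion_le (mul_nonneg (by linarith) he0) hσ0 (by linarith) ih2
        calc a * ‖pnrStep Θ f q Δ ΔH ε' 1 θ (z (Fin.last k)) - θhat‖
            ≤ a * (a * e ^ 2 + s * τ) := mul_le_mul_of_nonneg_left hstep' (by linarith)
          _ = (a * e) ^ 2 + σ := by rw [hσ]; ring
          _ ≤ _ := by rwa [half_pow_two_pow_sq] at h1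
  intro k z hz
  obtain ⟨-, h⟩ := main k z hz
  have hp : (0 : ℝ) ≤ (1 / 2) ^ (2 ^ k) := by positivity
  set e := ‖pnr Θ f q Δ ΔH ε' 1 θ₀ k z - θhat‖
  have : a * e ≤ a * ((1 / 2) ^ (2 ^ k) + 2 * s * τ) := by
    refine h.trans ?_
    rw [hσ]
    nlinarith
  exact le_of_mul_le_mul_left this (by linarith)

end PMHDE

namespace PMHDE

/-! ### Rates -/

/-- From n^{1/2}c² ≤ 1 follows c ≤ n^{-1/4}, so the gain c^{1/p-1/2} is a genuine negative power of
n. -/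
lemma eventually_sensRate_le {K : ℝ → ℝ} {p : ℝ} {c : ℕ → ℝ} (hK : IsDensity K)
    (hc : ∀ n, 0 < c n) (hcn : Tendsto (fun n : ℕ => √(n : ℝ) * c n ^ 2) atTop (𝓝 0))
    (hp : 1 < p) (hp2 : p < 2) :
    ∀ᶠ n in atTop, sensRate K p (c n) n ≤
      (∫ x, K x ^ (p / 2)) ^ (1 / p) * (n : ℝ) ^ (-(1 / 2) - (1 / p - 1 / 2) / 4 : ℝ) := by
  filter_upwards [hcn.eventually_le_const one_pos, eventually_gt_atTop 0] with n hn hn0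
  have hn' : (0 : ℝ) < n := by exact_mod_cast hn0
  have hα : 0 ≤ 1 / p - 1 / 2 := by
    have := one_div_lt_one_div_of_lt (by linarith) hp2
    linarith
  have hI : 0 ≤ ∫ x, K x ^ (p / 2) := integral_nonneg fun x => Real.rpow_nonneg (hK.nonneg x) _
  refine mul_le_mul_of_nonneg_left ?_ (Real.rpow_nonneg hI _)
  have hc4 : c n ≤ (n : ℝ) ^ (-(1 / 4) : ℝ) := by
    refine (sq_le_sq₀ (hc n).le (by positivity)).1 ?_
    rw [← Real.rpow_natCast ((n : ℝ) ^ (-(1 / 4) : ℝ)), ← Real.rpow_mul hn'.le,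
      show (-(1 / 4) : ℝ) * ((2 : ℕ) : ℝ) = -(1 / 2) by norm_num, Real.rpow_neg hn'.le,
      ← Real.sqrt_eq_rpow, ← one_div, le_div_iff₀ (Real.sqrt_pos.2 hn')]
    linarith
  calc (n : ℝ) ^ (-(1 / 2) : ℝ) * c n ^ (1 / p - 1 / 2)
      ≤ (n : ℝ) ^ (-(1 / 2) : ℝ) * ((n : ℝ) ^ (-(1 / 4) : ℝ)) ^ (1 / p - 1 / 2) :=
        mul_le_mul_of_nonneg_left (Real.rpow_le_rpow (hc n).le hc4 hα) (by positivity)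
    _ = (n : ℝ) ^ (-(1 / 2) - (1 / p - 1 / 2) / 4 : ℝ) := by
        rw [← Real.rpow_mul hn'.le, ← Real.rpow_add hn']
        congr 1
        ring

/-- By -log(1 - x) ≥ x the squared multiplier is at most 1/ε', hence at most k/ε. -/
lemma noiseMult_half_le {ε ε' : ℝ} {k : ℝ} (hε : 0 < ε) (hk : 0 < k) (hε' : 0 < ε')
    (hε'2 : ε' ≤ 2) (h : ε / k ≤ ε') : noiseMult (ε' / 2) ≤ √(k / ε) := by
  unfold noiseMult
  refine Real.sqrt_le_sqrt ?_
  have hlog := Real.log_le_sub_one_of_pos (show 0 < 1 - 0.5 * (ε' / 2) by linarith)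
  have h1 : ε' ≤ -8 * Real.log (1 - 0.5 * (ε' / 2)) := by linarith
  calc 1 / (-8 * Real.log (1 - 0.5 * (ε' / 2))) ≤ 1 / ε' := one_div_le_one_div_of_le hε' h1
    _ ≤ 1 / (ε / k) := one_div_le_one_div_of_le (by positivity) h
    _ = k / ε := one_div_div _ _

lemma noiseMult_nonneg (s : ℝ) : 0 ≤ noiseMult s := Real.sqrt_nonneg _

lemma log_two_le_log_div {k ξ : ℝ} (hk : 2 ≤ k) (hξ : 0 < ξ) (hξ1 : ξ ≤ 1) :
    Real.log 2 ≤ Real.log (k / ξ) := by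
  refine Real.log_le_log (by norm_num) ?_
  rw [le_div_iff₀ hξ]
  nlinarith

/-- The dimensional constant inside the logarithm becomes a factor, because log(k/ξ) ≥ log 2. -/
lemma noiseRadius_le (m : ℕ) {k : ℕ} {ξ : ℝ} (hk : 2 ≤ k) (hξ : 0 < ξ) (hξ1 : ξ ≤ 1) :
    noiseRadius m k ξ ≤ √(2 * (Real.log (4 * (m + m * m + 1)) / Real.log 2 + 1)) *
      √(Real.log (k / ξ)) := by
  have hk' : (2 : ℝ) ≤ k := by exact_mod_cast hk
  have h1 := log_two_le_log_div hk' hξ hξ1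
  have hlog2 := Real.log_pos one_lt_two
  have hm : (1 : ℝ) ≤ 4 * (m + m * m + 1) := by
    have : (0 : ℝ) ≤ m + m * m := by positivity
    linarith
  have hlm := Real.log_nonneg hm
  rw [← Real.sqrt_mul (by positivity)]
  refine Real.sqrt_le_sqrt ?_
  rw [Real.log_mul (by positivity) (by positivity)]
  have : Real.log (4 * (m + m * m + 1)) ≤
      Real.log (4 * (m + m * m + 1)) / Real.log 2 * Real.log (k / ξ) := by
    rw [div_mul_eq_mul_div, le_div_iff₀ hlog2]
    exact mul_le_mul_of_nonneg_left h1 hlm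
  linarith

lemma log_div_le {k ξ : ℝ} (hk : 2 ≤ k) (hξ : 0 < ξ) (hξ1 : ξ ≤ 1) :
    Real.log (k / ξ) ≤ (1 + Real.log (1 / ξ) / Real.log 2) * Real.log k := by
  have hlog2 := Real.log_pos one_lt_two
  have h1 : Real.log 2 ≤ Real.log k := Real.log_le_log (by norm_num) hk
  have h2 : 0 ≤ Real.log (1 / ξ) := Real.log_nonneg (by rwa [le_div_iff₀ hξ, one_mul])
  rw [div_eq_mul_one_div, Real.log_mul (by linarith) (by positivity)]
  have : Real.log (1 / ξ) ≤ Real.log (1 / ξ) / Real.log 2 * Real.log k := by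
    rw [div_mul_eq_mul_div, le_div_iff₀ hlog2]
    exact mul_le_mul_of_nonneg_left h1 h2
  linarith

/-- Moves the confidence level out of the logarithm. It serves both to pass from the given limit to
the ξ-dependent rate and to derive the O_p statement. -/
lemma sqrt_mul_log_div_le {k ξ : ℝ} (hk : 2 ≤ k) (hξ : 0 < ξ) (hξ1 : ξ ≤ 1) :
    √(k * Real.log (k / ξ)) ≤
      √(1 + Real.log (1 / ξ) / Real.log 2) * √(k * Real.log k) := by
  have hlog2 := Real.log_pos one_lt_two
  have h2 : 0 ≤ Real.log (1 / ξ) := Real.log_nonneg (by rwa [le_div_iff₀ hξ, one_mul])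
  rw [← Real.sqrt_mul (by positivity)]
  refine Real.sqrt_le_sqrt ?_
  have := mul_le_mul_of_nonneg_left (log_div_le hk hξ hξ1) (show 0 ≤ k by linarith)
  linarith

lemma tendsto_loglog_natCast : Tendsto (fun n : ℕ => Real.log (Real.log n)) atTop atTop :=
  Real.tendsto_log_atTop.comp (Real.tendsto_log_atTop.comp tendsto_natCast_atTop_atTop)

/-- Here 2^k ≥ (log n)², so (1/2)^(2^k) = exp(-log 2 · 2^k) is below exp(-2 log n) once log n ≥
2/log 2. Quadratic convergence is what makes log log n steps enough. -/
lemma eventually_half_pow_le : ∀ᶠ n : ℕ in atTop, ∀ k : ℕ,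
    2 / Real.log 2 * Real.log (Real.log n) ≤ k → (1 / 2 : ℝ) ^ (2 ^ k) ≤ (n : ℝ) ^ (-2 : ℝ) := by
  have hlog2 := Real.log_pos one_lt_two
  filter_upwards [(Real.tendsto_log_atTop.comp
    (tendsto_natCast_atTop_atTop (R := ℝ))).eventually_ge_atTop (2 / Real.log 2),
    eventually_gt_atTop 0] with n hn hn0 k hk
  have hn' : (0 : ℝ) < n := by exact_mod_cast hn0
  have hl : 2 / Real.log 2 ≤ Real.log n := hn
  have hl0 : 0 < Real.log n := lt_of_lt_of_le (by positivity) hl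
  have h1 : Real.log n ^ 2 ≤ (2 : ℝ) ^ k := by
    rw [← Real.exp_log hl0, ← Real.exp_nat_mul, ← Real.rpow_natCast 2 k,
      Real.rpow_def_of_pos two_pos, Real.exp_le_exp]
    rw [div_mul_eq_mul_div, div_le_iff₀ hlog2] at hk
    push_cast
    linarith
  have h2 : 2 * Real.log n ≤ Real.log 2 * (2 : ℝ) ^ k := by
    rw [div_le_iff₀ hlog2] at hl
    nlinarith
  rw [show (1 / 2 : ℝ) ^ (2 ^ k) = Real.exp (-(Real.log 2 * (2 : ℝ) ^ k)) by
    rw [one_div, inv_pow, Real.exp_neg, mul_comm,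
      show (2 : ℝ) ^ k = ((2 ^ k : ℕ) : ℝ) by push_cast; rfl, Real.exp_nat_mul,
      Real.exp_log two_pos],
    Real.rpow_def_of_pos hn', Real.exp_le_exp]
  linarith

lemma gradSens_nonneg {m : ℕ} (Θ : Set (Param m)) (f : Param m → ℝ → ℝ) (K : ℝ → ℝ) (c b : ℝ)
    (n : ℕ) : 0 ≤ gradSens Θ f K c b n := by
  refine Real.sSup_nonneg ?_
  rintro _ ⟨θ, -, D, D', -, rfl⟩
  exact norm_nonneg _

lemma hessSens_nonneg {m : ℕ} (Θ : Set (Param m)) (f : Param m → ℝ → ℝ) (K : ℝ → ℝ) (c b : ℝ)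
    (n : ℕ) : 0 ≤ hessSens Θ f K c b n := by
  refine Real.sSup_nonneg ?_
  rintro _ ⟨θ, -, D, D', -, rfl⟩
  exact Real.sqrt_nonneg _

/-- A bound of the order `n ^ (-1/2 - δ)` for noise scales proportional to the sensitivities. -/
lemma FamilyAssumptions.exists_sens_rate {m : ℕ} {Θ : Set (Param m)} {f : Param m → ℝ → ℝ}
    (hf : FamilyAssumptions Θ f) : ∃ δ : ℝ, 0 < δ ∧ δ < 1 ∧
      ∀ (K : ℝ → ℝ) (c b : ℕ → ℝ), IsDensity K → HasCompactSupport K → (∀ n, 0 < c n) →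
      Tendsto (fun n : ℕ => √(n : ℝ) * c n ^ 2) atTop (𝓝 0) →
      ∀ (C : ℝ) (Δ ΔH : ℕ → ℝ), (∀ n, Δ n ≤ C * gradSens Θ f K (c n) (b n) n) →
      (∀ n, ΔH n ≤ C * hessSens Θ f K (c n) (b n) n) →
      ∃ M ≥ (0 : ℝ), ∀ᶠ n : ℕ in atTop, Δ n ≤ M * (n : ℝ) ^ (-(1 / 2) - δ) ∧
        ΔH n ≤ M * (n : ℝ) ^ (-(1 / 2) - δ) := by
  obtain ⟨U, CM, hM⟩ := hf.exists_momentBound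
  obtain ⟨p, q, B, hB⟩ := hf.exists_conjBound hM.smooth hM.subset
  have hp := hB.one_lt
  have hp2 := hB.lt_two
  have h1 : 1 / 2 < 1 / p := one_div_lt_one_div_of_lt (by linarith) hp2
  have h2 : 1 / p < 1 := by rwa [div_lt_one (by linarith)]
  refine ⟨(1 / p - 1 / 2) / 4, by linarith, by linarith, ?_⟩
  intro K c b hK hs hc hcn C Δ ΔH hΔ hΔH
  set I := (∫ x, K x ^ (p / 2)) ^ (1 / p) with hI
  have hI0 : 0 ≤ I :=
    Real.rpow_nonneg (integral_nonneg fun x => Real.rpow_nonneg (hK.nonneg x) _) _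
  have hB0 := hB.nonneg
  refine ⟨|C| * (m * (8 * B * I)), by positivity, ?_⟩
  filter_upwards [eventually_sensRate_le hK hc hcn hp hp2] with n hn
  have key : ∀ s d : ℝ, 0 ≤ s → s ≤ m * (8 * B * sensRate K p (c n) n) → d ≤ C * s →
      d ≤ |C| * (m * (8 * B * I)) * (n : ℝ) ^ (-(1 / 2) - (1 / p - 1 / 2) / 4 : ℝ) := by
    intro s d hs0 hs1 hd
    calc d ≤ C * s := hd
      _ ≤ |C| * s := mul_le_mul_of_nonneg_right (le_abs_self C) hs0
      _ ≤ |C| * (m * (8 * B * (I * (n : ℝ) ^ (-(1 / 2) - (1 / p - 1 / 2) / 4 : ℝ)))) := by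
          refine mul_le_mul_of_nonneg_left (hs1.trans ?_) (abs_nonneg C)
          gcongr
      _ = _ := by ring
  exact ⟨key _ _ (gradSens_nonneg _ _ _ _ _ _) (gradSens_le hM hB hK hs (hc n) (b n) n) (hΔ n),
    key _ _ (hessSens_nonneg _ _ _ _ _ _) (hessSens_le hM hB hK hs (hc n) (b n) n) (hΔH n)⟩

/-- The scale of the noise, for `k` steps and `n` observations, is negligible compared to
`n ^ (-r) * √(k * log (k / ξ))`. -/
lemma noise_scale_le {m k n : ℕ} {ε ε' ξ M δ Δ : ℝ} (hM : 0 ≤ M) (hn : 0 < n) (hk : 2 ≤ k)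
    (hξ : 0 < ξ) (hξ1 : ξ ≤ 1) (hε : 0 < ε) (hε' : 0 < ε') (hε'2 : ε' ≤ 2) (h : ε / k ≤ ε')
    (hΔ : Δ ≤ M * (n : ℝ) ^ (-(1 / 2) - δ)) :
    Δ * noiseMult (ε' / 2) * noiseRadius m k ξ ≤
      M * √(2 * (Real.log (4 * (m + m * m + 1)) / Real.log 2 + 1) / ε) * (n : ℝ) ^ (-(δ / 2)) *
        ((n : ℝ) ^ (-(1 / 2 + δ / 2)) * √(k * Real.log (k / ξ))) := by
  have hk' : (2 : ℝ) ≤ k := by exact_mod_cast hk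
  have hk0 : (0 : ℝ) < k := by linarith
  have hn' : (0 : ℝ) < n := by exact_mod_cast hn
  set A := 2 * (Real.log (4 * (m + m * m + 1)) / Real.log 2 + 1) with hA
  have hl : 0 ≤ Real.log (k / ξ) :=
    (Real.log_pos one_lt_two).le.trans (log_two_le_log_div hk' hξ hξ1)
  have hlm : 0 ≤ Real.log (4 * (m + m * m + 1) : ℝ) := Real.log_nonneg (by
    have : (0 : ℝ) ≤ m + m * m := by positivity
    linarith)
  have hA0 : 0 ≤ A := by
    have := Real.log_pos one_lt_two
    positivity
  calc Δ * noiseMult (ε' / 2) * noiseRadius m k ξ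
      ≤ M * (n : ℝ) ^ (-(1 / 2) - δ) * √(k / ε) * (√A * √(Real.log (k / ξ))) := by
        refine mul_le_mul ?_ (noiseRadius_le m hk hξ hξ1) (Real.sqrt_nonneg _) (by positivity)
        exact mul_le_mul hΔ (noiseMult_half_le hε hk0 hε' hε'2 h) (noiseMult_nonneg _)
          (by positivity)
    -- Half of the gained exponent δ goes into the rate; the other half is kept as a vanishing
    -- factor.
    _ = _ := by
        rw [show (-(1 / 2) - δ : ℝ) = -(δ / 2) + -(1 / 2 + δ / 2) by ring, Real.rpow_add hn',
          Real.sqrt_div hk0.le, Real.sqrt_div hA0, Real.sqrt_mul hk0.le]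
        ring

end PMHDE

/-! ### Convergence on the good event and the final assembly -/

namespace PMHDE

/-- The optimization error uses up half of the allowed bound: k log(k/ξ) ≥ 1 when k ≥ 2, and n^{-2}
≤ n^{-1}/2. -/
lemma rpow_neg_two_le_half_rate {n k : ℕ} {ξ r : ℝ} (hn : 2 ≤ n) (hk : 2 ≤ k) (hξ : 0 < ξ)
    (hξ1 : ξ ≤ 1) (hr : r ≤ 1) :
    (n : ℝ) ^ (-2 : ℝ) ≤ 1 / 2 * ((n : ℝ) ^ (-r) * √(k * Real.log (k / ξ))) := by
  have hn' : (2 : ℝ) ≤ n := by exact_mod_cast hn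
  have hk' : (2 : ℝ) ≤ k := by exact_mod_cast hk
  have h1 : 1 ≤ √(k * Real.log (k / ξ)) := by
    rw [Real.one_le_sqrt]
    have := log_two_le_log_div hk' hξ hξ1
    have := Real.log_two_gt_d9
    nlinarith
  have h2 : (n : ℝ) ^ (-1 : ℝ) ≤ (n : ℝ) ^ (-r) :=
    Real.rpow_le_rpow_of_exponent_le (by linarith) (by linarith)
  have h3 : (n : ℝ) ^ (-2 : ℝ) ≤ 1 / 2 * (n : ℝ) ^ (-1 : ℝ) := by
    rw [show (-2 : ℝ) = -1 + -1 by norm_num, Real.rpow_add (by linarith), Real.rpow_neg_one]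
    refine mul_le_mul_of_nonneg_right ?_ (by positivity)
    rw [one_div]
    exact inv_anti₀ two_pos hn'
  have h4 : (n : ℝ) ^ (-1 : ℝ) ≤ (n : ℝ) ^ (-r) * √(k * Real.log (k / ξ)) :=
    h2.trans (le_mul_of_one_le_right (by positivity) h1)
  linarith

lemma measure_prod_union_le {α β : Type*} [MeasurableSpace α] [MeasurableSpace β]
    (μ : Measure α) (ν : Measure β) [IsProbabilityMeasure μ] [IsProbabilityMeasure ν]
    {s : Set (α × β)} {A : Set α} {B : Set β} (h : ∀ ω ∈ s, ω.1 ∈ A ∨ ω.2 ∈ B) {ξ : ℝ}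
    (hξ : 0 ≤ ξ) (hA : μ A ≤ ENNReal.ofReal (ξ / 2)) (hB : ν B ≤ ENNReal.ofReal (ξ / 2)) :
    (μ.prod ν) s ≤ ENNReal.ofReal ξ := by
  have hsub : s ⊆ A ×ˢ Set.univ ∪ Set.univ ×ˢ B := fun ω hω => by
    rcases h ω hω with h | h
    · exact Or.inl ⟨h, trivial⟩
    · exact Or.inr ⟨trivial, h⟩
  refine (measure_mono hsub).trans ((measure_union_le _ _).trans ?_)
  rw [Measure.prod_prod, Measure.prod_prod, measure_univ, measure_univ, mul_one, one_mul]
  refine (add_le_add hA hB).trans_eq ?_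
  rw [← ENNReal.ofReal_add (by linarith) (by linarith), add_halves]

lemma abs_noise_le {d t s x τ : ℝ} (hd : 0 ≤ d) (hs : 0 ≤ s) (hx : |x| ≤ t)
    (h : d * s * t ≤ τ) : |d * s * x| ≤ τ := by
  rw [abs_mul, abs_of_nonneg (mul_nonneg hd hs)]
  exact (mul_le_mul_of_nonneg_left hx (mul_nonneg hd hs)).trans h

/-- High-probability convergence of private Newton-Raphson to the minimum Hellinger distance
estimator. -/
theorem FamilyAssumptions.exists_pnr_rate {m : ℕ} {Θ : Set (Param m)} {f : Param m → ℝ → ℝ}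
    (hf : FamilyAssumptions Θ f) {g K : ℝ → ℝ} {c b a : ℕ → ℝ} {θg : Param m}
    (hS : SamplingAssumptions Θ f g K c b a θg) {C : ℝ} {Δ ΔH : ℕ → ℝ}
    (hΔ : ∀ n, gradSens Θ f K (c n) (b n) n ≤ Δ n ∧ Δ n ≤ C * gradSens Θ f K (c n) (b n) n)
    (hΔH : ∀ n, hessSens Θ f K (c n) (b n) n ≤ ΔH n ∧ ΔH n ≤ C * hessSens Θ f K (c n) (b n) n)
    {ε : ℝ} (hε : 0 < ε) (hdet : IsUnit (lossHess f g θg).det) :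
    ∃ p : ℝ, 1 < p ∧ p < 2 ∧ ∃ ρ > (0 : ℝ),
      ∀ (κ : ℕ → ℕ) (ε' : ℕ → ℝ) (θhat : (n : ℕ) → (Fin n → ℝ) → Param m),
      (∀ᶠ n : ℕ in atTop, 2 / Real.log 2 * Real.log (Real.log n) ≤ κ n) →
      Tendsto (fun n : ℕ => (n : ℝ) ^ (-1 / p) * √(κ n * Real.log (κ n))) atTop (𝓝 0) →
      (∀ n, 0 < ε' n ∧ ε' n ≤ 2 ∧ ε / κ n ≤ ε' n) →
      (∀ n D, θhat n D ∈ Θ ∧ IsMinOn (loss f (truncKDE K (c n) (b n) D)) Θ (θhat n D)) →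
      ∀ ξ : ℝ, 0 < ξ → ξ < 1 → ∀ᶠ n in atTop, 2 ≤ κ n ∧
        ((sampleLaw g n).prod (noiseLaw m (κ n)))
          {ω | ∃ θ₀ ∈ Metric.closedBall θg ρ,
            (n : ℝ) ^ (-1 / p) * √(κ n * Real.log (κ n / ξ)) <
              ‖pnr Θ f (truncKDE K (c n) (b n) ω.1) (Δ n) (ΔH n) (ε' n) 1 θ₀ (κ n) ω.2
                - θhat n ω.1‖} ≤ ENNReal.ofReal ξ := by
  have hlog2 := Real.log_pos one_lt_two
  obtain ⟨δ, hδ, hδ1, hsens⟩ := hf.exists_sens_rate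
  obtain ⟨M, hM, hMn⟩ := hsens K c b hS.kernel_density hS.kernel_support hS.bandwidth_pos
    hS.bandwidth_upper C Δ ΔH (fun n => (hΔ n).2) fun n => (hΔH n).2
  obtain ⟨ρ, hρ, δN, hδN, τ₀, hτ₀, β, hβ, hnewton⟩ :=
    hf.exists_newton_convergence hS.density hS.interior hdet
  obtain ⟨δC, hδC, hclose⟩ := hf.exists_minimizer_close hS.density (interior_subset hS.interior)
    hS.unique_min hρ
  -- This p satisfies 1/p = 1/2 + δ/2, and 0 < δ < 1 places it in (1, 2).
  refine ⟨1 / (1 / 2 + δ / 2), ?_, ?_, ρ, hρ, ?_⟩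
  · rw [lt_div_iff₀ (by linarith)]
    linarith
  · rw [div_lt_iff₀ (by linarith)]
    linarith
  intro κ ε' θhat hκ hκ0 hε' hθhat ξ hξ hξ1
  rw [show -1 / (1 / (1 / 2 + δ / 2)) = -(1 / 2 + δ / 2) by field_simp] at *
  set r := 1 / 2 + δ / 2 with hr
  set M₂ := M * √(2 * (Real.log (4 * (m + m * m + 1)) / Real.log 2 + 1) / ε) with hM₂
  have hM₂0 : 0 ≤ M₂ := by positivity
  have hsmall : Tendsto (fun n : ℕ => β * M₂ * (n : ℝ) ^ (-(δ / 2))) atTop (𝓝 0) := by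
    have := ((tendsto_rpow_neg_atTop (half_pos hδ)).comp
      (tendsto_natCast_atTop_atTop (R := ℝ))).const_mul (β * M₂)
    rwa [mul_zero] at this
  have hrate := hκ0.const_mul (√(1 + Real.log (1 / ξ) / Real.log 2))
  rw [mul_zero] at hrate
  have hκ2 : ∀ᶠ n : ℕ in atTop, 2 ≤ κ n := by
    filter_upwards [hκ, (tendsto_loglog_natCast.const_mul_atTop
      (show 0 < 2 / Real.log 2 by positivity)).eventually_ge_atTop 2] with n h1 h2
    exact_mod_cast h2.trans h1
  filter_upwards [hκ, hκ2, hMn, eventually_half_pow_le, eventually_ge_atTop 2,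
    hsmall.eventually_le_const (show (0 : ℝ) < 1 / 2 by norm_num),
    hrate.eventually_le_const (show (0 : ℝ) < 2 * β * τ₀ by positivity),
    hellSq_truncKDE_consistent hS.density hS.kernel_density hS.kernel_support hS.bandwidth_pos
      hS.bandwidth_zero hS.bandwidth_lower hS.trunc_top (lt_min hδN hδC) (half_pos hξ)]
    with n hκn hκ2n hMn hpow hn hsm hrt hcons
  refine ⟨hκ2n, ?_⟩
  have hκ' : (2 : ℝ) ≤ κ n := by exact_mod_cast hκ2n
  have := hS.density.isProbabilityMeasure_sampleLaw n
  -- Half of ξ is spent on the estimator being far from g, half on large noise. Outside these events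
  -- the Newton bound holds for all starting points in the ball at once.
  refine measure_prod_union_le _ _ ?_ hξ.le hcons
    (noiseLaw_not_noiseBounded_le_half m (by omega) hξ hξ1.le)
  rintro ⟨D, z⟩ ⟨θ₀, hθ₀, hbad⟩
  by_contra hcon
  simp only [Set.mem_ofPred_eq, not_or, not_lt, not_not, le_min_iff] at hcon
  obtain ⟨⟨hN, hC⟩, hz⟩ := hcon
  refine absurd hbad (not_lt.2 ?_)
  have hq := isSubDensity_truncKDE hS.kernel_density (hS.bandwidth_pos n) (b n) D
  obtain ⟨hhat, hmin⟩ := hθhat n D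
  obtain ⟨he0, he2, heκ⟩ := hε' n
  set R := (n : ℝ) ^ (-r) * √(κ n * Real.log (κ n / ξ)) with hR
  have hR0 : 0 ≤ R := by positivity
  set τ := M₂ * (n : ℝ) ^ (-(δ / 2)) * R with hτ
  have hτ0 : 0 ≤ τ := by positivity
  have hβτ : β * τ ≤ 1 / 2 * R := by
    rw [hτ, show β * (M₂ * (n : ℝ) ^ (-(δ / 2)) * R) = β * M₂ * (n : ℝ) ^ (-(δ / 2)) * R by ring]
    exact mul_le_mul_of_nonneg_right hsm hR0
  have hRτ : R ≤ 2 * β * τ₀ := by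
    refine le_trans ?_ hrt
    rw [hR, mul_left_comm]
    exact mul_le_mul_of_nonneg_left (sqrt_mul_log_div_le hκ' hξ hξ1.le) (by positivity)
  -- The chain βτ ≤ R/2 ≤ βτ₀ brings the noise below the threshold of the Newton lemma, R being
  -- small by the assumption on the number of steps.
  have hττ₀ : τ ≤ τ₀ := by
    refine le_of_mul_le_mul_left (a := β) ?_ hβ
    linarith
  have hnm := noiseMult_nonneg (ε' n / 2)
  have hscale : ∀ d, d ≤ M * (n : ℝ) ^ (-(1 / 2) - δ) →
      d * noiseMult (ε' n / 2) * noiseRadius m (κ n) ξ ≤ τ := fun d hd =>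
    noise_scale_le hM (by omega) hκ2n hξ hξ1.le hε he0 he2 heκ hd
  have hΔ0 := (gradSens_nonneg _ _ _ _ _ _).trans (hΔ n).1
  have hΔH0 := (hessSens_nonneg _ _ _ _ _ _).trans (hΔH n).1
  have hfin := hnewton _ hq hN (θhat n D) (hclose _ hq hC _ hhat hmin) hmin (Δ n) (ΔH n) (ε' n) τ
    hτ0 hττ₀ θ₀ hθ₀ (κ n) z fun l =>
      ⟨fun i => abs_noise_le hΔ0 hnm ((hz l).1 i) (hscale _ hMn.1),
        fun i j => abs_noise_le hΔH0 hnm ((hz l).2 i j) (hscale _ hMn.2)⟩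
  have hopt := (hpow (κ n) hκn).trans
    (rpow_neg_two_le_half_rate hn hκ2n hξ hξ1.le (show r ≤ 1 by rw [hr]; linarith))
  exact hfin.trans (by linarith)

end PMHDE

theorem theorem4 {m : ℕ} (Θ : Set (PMHDE.Param m)) (f : PMHDE.Param m → ℝ → ℝ)
    (hf : PMHDE.FamilyAssumptions Θ f) :
    ∃ ε₀ > (0 : ℝ), ∃ c₂ > (0 : ℝ),
      ∀ (g K : ℝ → ℝ) (c b a : ℕ → ℝ) (θg : PMHDE.Param m),
      PMHDE.SamplingAssumptions Θ f g K c b a θg →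
      -- the sensitivity estimates used to scale the noise, and the privacy budget
      ∀ (C : ℝ) (Δ ΔH : ℕ → ℝ),
      (∀ n, PMHDE.gradSens Θ f K (c n) (b n) n ≤ Δ n ∧
        Δ n ≤ C * PMHDE.gradSens Θ f K (c n) (b n) n) →
      (∀ n, PMHDE.hessSens Θ f K (c n) (b n) n ≤ ΔH n ∧
        ΔH n ≤ C * PMHDE.hessSens Θ f K (c n) (b n) n) →
      ∀ ε : ℝ, 0 < ε → ε ≤ 2 →
      -- privacy
      (∀ (n k : ℕ) (ε' η : ℝ) (θ₀ : PMHDE.Param m), 0 < ε' → ε' ≤ 2 →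
        PMHDE.compLevel k ε' ≤ ε →
        PMHDE.IsHDP ε fun D : Fin n → ℝ =>
          PMHDE.pnrLaw Θ f (PMHDE.truncKDE K (c n) (b n) D) (Δ n) (ΔH n) ε' η θ₀ k) ∧
      -- utility
      ((PMHDE.hellSq (f θg) g < ε₀ ∨ IsUnit (PMHDE.lossHess f g θg).det) →
        ∃ p : ℝ, 1 < p ∧ p < 2 ∧ ∃ c₁ > (0 : ℝ), ∃ η > (0 : ℝ), ∃ ρ > (0 : ℝ),
        ∀ (κ : ℕ → ℕ) (ε' : ℕ → ℝ) (θhat : (n : ℕ) → (Fin n → ℝ) → PMHDE.Param m),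
        (∀ᶠ n : ℕ in Filter.atTop, c₁ * Real.log (Real.log n) ≤ κ n) →
        Filter.Tendsto (fun n : ℕ => (n : ℝ) ^ (-1 / p) * √(κ n * Real.log (κ n)))
          Filter.atTop (nhds 0) →
        (∀ n, 0 < ε' n ∧ ε' n ≤ 2 ∧ ε / κ n ≤ ε' n ∧ PMHDE.compLevel (κ n) (ε' n) ≤ ε) →
        (∀ n D, θhat n D ∈ Θ ∧
          IsMinOn (PMHDE.loss f (PMHDE.truncKDE K (c n) (b n) D)) Θ (θhat n D)) →
        (∀ ξ : ℝ, 0 < ξ → ξ < 1 → ∃ N : ℕ, ∀ n > N,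
          ((PMHDE.sampleLaw g n).prod (PMHDE.noiseLaw m (κ n)))
            {ω | ∃ θ₀ ∈ Metric.closedBall θg ρ,
              c₂ * (n : ℝ) ^ (-1 / p) * √(κ n * Real.log (κ n / ξ)) <
                ‖PMHDE.pnr Θ f (PMHDE.truncKDE K (c n) (b n) ω.1) (Δ n) (ΔH n) (ε' n) η θ₀
                  (κ n) ω.2 - θhat n ω.1‖} ≤ ENNReal.ofReal ξ) ∧
        (∀ ξ : ℝ, 0 < ξ → ∃ (B : ℝ) (N : ℕ), ∀ n > N,
          ((PMHDE.sampleLaw g n).prod (PMHDE.noiseLaw m (κ n)))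
            {ω | ∃ θ₀ ∈ Metric.closedBall θg ρ,
              B * (n : ℝ) ^ (-1 / p) * √(κ n * Real.log (κ n)) <
                ‖PMHDE.pnr Θ f (PMHDE.truncKDE K (c n) (b n) ω.1) (Δ n) (ΔH n) (ε' n) η θ₀
                  (κ n) ω.2 - θhat n ω.1‖} ≤ ENNReal.ofReal ξ)) := by
  obtain ⟨ε₀, hε₀, hunit⟩ := hf.exists_isUnit_det
  -- The constant c₂ = 1 suffices, since the spare power of n dominates all constants for large n.
  refine ⟨ε₀, hε₀, 1, one_pos, ?_⟩
  intro g K c b a θg hS C Δ ΔH hΔ hΔH ε hε _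
  constructor
  · intro n k ε' η θ₀ hε' hε'2 hk
    obtain ⟨U, CM, hM⟩ := hf.exists_momentBound
    obtain ⟨p, q, B, hB⟩ := hf.exists_conjBound hM.smooth hM.subset
    exact PMHDE.isHDP_pnrLaw hM hf.compact.isClosed hB hS.kernel_density hS.kernel_support
      (hS.bandwidth_pos n) (b n) n (hΔ n).1 (hΔH n).1 hε' hε'2 θ₀ k hk
  · intro hg
    have hdet : IsUnit (PMHDE.lossHess f g θg).det :=
      hg.elim (hunit g hS.density θg hS.interior) id
    obtain ⟨p, hp1, hp2, ρ, hρ, hrate⟩ := hf.exists_pnr_rate hS hΔ hΔH hε hdet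
    refine ⟨p, hp1, hp2, 2 / Real.log 2, div_pos two_pos (Real.log_pos one_lt_two), 1, one_pos, ρ,
      hρ, ?_⟩
    intro κ ε' θhat hκ hκ0 hε' hθhat
    have hmain := hrate κ ε' θhat hκ hκ0
      (fun n => ⟨(hε' n).1, (hε' n).2.1, (hε' n).2.2.1⟩) hθhat
    constructor
    · intro ξ hξ hξ1
      obtain ⟨N, hN⟩ := Filter.eventually_atTop.1 (hmain ξ hξ hξ1)
      refine ⟨N, fun n hn => ?_⟩
      rw [one_mul]
      exact (hN n hn.le).2
    · intro ξ hξ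
      -- The bounded-in-probability statement allows any positive ξ, so ξ is first reduced below
      -- one.
      have hξ' : 0 < min ξ (1 / 2) := lt_min hξ (by norm_num)
      have hξ1 : min ξ (1 / 2) < 1 := (min_le_right _ _).trans_lt (by norm_num)
      obtain ⟨N, hN⟩ := Filter.eventually_atTop.1 (hmain _ hξ' hξ1)
      refine ⟨√(1 + Real.log (1 / min ξ (1 / 2)) / Real.log 2), N, fun n hn => ?_⟩
      obtain ⟨hκ2, hbad⟩ := hN n hn.le
      refine (MeasureTheory.measure_mono ?_).trans
        (hbad.trans (ENNReal.ofReal_le_ofReal (min_le_left _ _)))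
      rintro ω ⟨θ₀, hθ₀, hlt⟩
      refine ⟨θ₀, hθ₀, lt_of_le_of_lt ?_ hlt⟩
      rw [mul_comm (√(1 + _)), mul_assoc]
      exact mul_le_mul_of_nonneg_left
        (PMHDE.sqrt_mul_log_div_le (by exact_mod_cast hκ2) hξ' hξ1.le) (by positivity)
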